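/- All graphs are finite and simple. A \emph{layering} of a graph $G$ is a function $\lambda:V(G)\to\mathbb Z$ with $|\lambda(u)-\lambda(v)|\le 1$ for every edge $uv$. An \emph{ordered graph} is a graph together with a linear ordering of its vertices; subgraphs inherit the ordering. The \emph{Baker game} is played by Destroyer and Preserver. A state is a pair $(G,\mathbf r)$ of an ordered graph $G$ and an infinite sequence $\mathbf r=r_1,r_2,\ldots$ of non-negative integers; let $\mathrm{tail}(\mathbf r)=r_2,r_3,\ldots$. The game stops when $V(G)=\emptyset$. Otherwise Destroyer chooses one of two actions: (Delete) the smallest vertex $v$ is deleted and the game proceeds with the state $(G-v,\mathrm{tail}(\mathbf r))$; (Restrict) Destroyer selects a layering $\lambda$ of $G$, Preserver selects an interval $I$ of at most $r_1$ consecutive integers, and the game proceeds with the state $(G[\lambda^{-1}(I)],\mathrm{tail}(\mathbf r))$. Destroyer wins in $t$ rounds if the game stops after at most $t$ rounds, whatever Preserver does. For functions $f,s:\mathbb N\to\mathbb N$, a class $\mathcal C$ of graphs is \emph{$(f,s)$-efficiently Baker} if there exist algorithms $\mathcal A_1$ and $\mathcal A_2$ and for every sequence $\mathbf r$ there exists an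 integer $t$ so that for each $G\in\mathcal C$: the algorithm $\mathcal A_1$ (which does not depend on $\mathbf r$) determines in time $f(|V(G)|)$ an ordering of the vertices of $G$, and possibly other auxiliary information; and for the resulting ordered graph, the algorithm $\mathcal A_2$, playing as Destroyer, wins the Baker game on $(G,\mathbf r)$ in $t$ rounds, using time $s(|V(G)|)$ to determine the action at each state of the game. Here the algorithms are programs for a word random access machine with unit-cost addition, subtraction, multiplication, comparison and indirect addressing, whose input graph is given by adjacency lists in arbitrary order. On $n$-vertex graphs all stored numbers are at most $D\,(n+1)^e$, where $e$ and $D$ are constants, except that $D$ may depend on $\mathbf r$ for $\mathcal A_2$. In each round $\mathcal A_2$ is given the vertex set of the current graph, has access to the elements of the current sequence, and keeps its memory from the previous rounds, starting from the memory left by $\mathcal A_1$. \textbf{Theorem.} For every integer $k\ge 1$, there are functions $f,s:\mathbb N\to\mathbb N$ with $f(n)=O(n^2)$ and $s(n)=O(n)$ such that the class of graphs that do not contain $K_k$ as a minor is $(f,s)$-efficiently Baker. -/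

import Mathlib

open Filter Asymptotics

namespace BakerGame

/-! ### Minors -/

/-- `H` is a minor of `G`: there are pairwise disjoint vertex sets (branch sets) of `G`, one for
each vertex of `H`, each inducing a connected (in particular nonempty) subgraph of `G`, such that
adjacent vertices of `H` have branch sets joined by an edge of `G`. -/
def IsMinor {W V : Type*} (H : SimpleGraph W) (G : SimpleGraph V) : Prop :=
  ∃ B : W → Set V,
    (∀ w, (G.induce (B w)).Connected) ∧
    (∀ u w, u ≠ w → Disjoint (B u) (B w)) ∧
    (∀ u w, H.Adj u w → ∃ x ∈ B u, ∃ y ∈ B w, G.Adj x y)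

/-- A class of finite graphs; an `n`-vertex graph is given with vertices `0, …, n - 1`. -/
abbrev GraphClass := ∀ n : ℕ, Set (SimpleGraph (Fin n))

/-- The class of finite graphs that do not contain the complete graph `K_k` as a minor. -/
def completeMinorFree (k : ℕ) : GraphClass :=
  fun _ => {G | ¬ IsMinor (⊤ : SimpleGraph (Fin k)) G}

/-! ### The Baker game -/

/-- A layering of a graph: adjacent vertices lie in the same layer or in consecutive layers. -/
def IsLayering {V : Type*} (G : SimpleGraph V) (lam : V → ℤ) : Prop :=
  ∀ u v, G.Adj u v → |lam u - lam v| ≤ 1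

/-- A graph with a linear ordering of its vertices: `order i` is the `i`-th smallest vertex. -/
structure OrderedGraph (n : ℕ) where
  graph : SimpleGraph (Fin n)
  order : Equiv.Perm (Fin n)

/-- The position of a vertex in the ordering. -/
def OrderedGraph.rank {n : ℕ} (G : OrderedGraph n) (v : Fin n) : Fin n := G.order.symm v

/-- The actions of Destroyer. In `restrict lam`, only the values of `lam` on the vertices of the
current graph matter. -/
inductive Action (n : ℕ) where
  | delete : Action n
  | restrict (lam : Fin n → ℤ) : Action n

/-- The graphs occurring in the game on `G` are the induced subgraphs `G[S]`. In the state `G[S]`,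
Destroyer may always delete, and may restrict with a layering of `G[S]`. -/
def Action.Legal {n : ℕ} (G : OrderedGraph n) (S : Finset (Fin n)) : Action n → Prop
  | .delete => True
  | .restrict lam => IsLayering (G.graph.induce (S : Set (Fin n))) (fun v => lam v)

/-- `act.Next G S h S'`: if Destroyer takes the action `act` in the state `G[S]`, with `h` the head
of the current sequence, then the graph of the next state can be `G[S']`. For `delete`, the
smallest vertex is removed; for `restrict lam`, Preserver chooses an interval
`a, a + 1, …, a + l - 1` of `l ≤ h` consecutive integers and only its layers are kept. -/
def Action.Next {n : ℕ} (G : OrderedGraph n) (S : Finset (Fin n)) (h : ℕ) :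
    Action n → Finset (Fin n) → Prop
  | .delete, S' => ∃ v ∈ S, (∀ u ∈ S, G.rank v ≤ G.rank u) ∧ S' = S.erase v
  | .restrict lam, S' => ∃ (a : ℤ) (l : ℕ), l ≤ h ∧
      S' = S.filter (fun v => a ≤ lam v ∧ lam v < a + l)

/-- The sequence without its first element. -/
def tail (r : ℕ → ℕ) : ℕ → ℕ := fun i => r (i + 1)

/-! ### Word random access machines -/

/-- Instructions of a random access machine with registers `reg 0, reg 1, …` and arrays
`arr 0, arr 1, …`, all holding natural numbers. -/
inductive Instr where
  /-- `reg x := c` -/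
  | const (x c : ℕ)
  /-- `reg x := reg y + reg z` -/
  | add (x y z : ℕ)
  /-- `reg x := reg y - reg z` (truncated at zero) -/
  | sub (x y z : ℕ)
  /-- `reg x := reg y * reg z` -/
  | mul (x y z : ℕ)
  /-- `reg x := arr a [reg y]` -/
  | load (x a y : ℕ)
  /-- `arr a [reg x] := reg y` -/
  | store (a x y : ℕ)
  /-- `reg x := r (reg y)`, where `r` is the infinite input sequence -/
  | ask (x y : ℕ)
  /-- if `reg x < reg y`, then continue with the instruction number `l` -/
  | jumpLt (x y l : ℕ)

/-- A program is a finite list of instructions. -/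
abbrev Program := List Instr

/-- The contents of the arrays: `m a i` is the entry `i` of the array `a`. -/
abbrev Memory := ℕ → ℕ → ℕ

/-- A configuration of the machine. -/
structure Config where
  pc : ℕ
  reg : ℕ → ℕ
  arr : Memory

/-- The effect of one instruction, with the infinite input sequence `r`. -/
def Instr.exec (r : ℕ → ℕ) (c : Config) : Instr → Config
  | .const x a => ⟨c.pc + 1, Function.update c.reg x a, c.arr⟩
  | .add x y z => ⟨c.pc + 1, Function.update c.reg x (c.reg y + c.reg z), c.arr⟩
  | .sub x y z => ⟨c.pc + 1, Function.update c.reg x (c.reg y - c.reg z), c.arr⟩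
  | .mul x y z => ⟨c.pc + 1, Function.update c.reg x (c.reg y * c.reg z), c.arr⟩
  | .load x a y => ⟨c.pc + 1, Function.update c.reg x (c.arr a (c.reg y)), c.arr⟩
  | .store a x y => ⟨c.pc + 1, c.reg,
      Function.update c.arr a (Function.update (c.arr a) (c.reg x) (c.reg y))⟩
  | .ask x y => ⟨c.pc + 1, Function.update c.reg x (r (c.reg y)), c.arr⟩
  | .jumpLt x y l => ⟨if c.reg x < c.reg y then l else c.pc + 1, c.reg, c.arr⟩

/-- One step of the machine; it rests once the program counter has left the program. -/
def Program.step (P : Program) (r : ℕ → ℕ) (c : Config) : Config :=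
  match P[c.pc]? with
  | none => c
  | some ins => ins.exec r c

/-- All numbers stored in the configuration are at most `w`. -/
def Config.Bounded (w : ℕ) (c : Config) : Prop :=
  (∀ x, c.reg x ≤ w) ∧ ∀ a i, c.arr a i ≤ w

/-- Started in the configuration `c`, the program `P` halts in the configuration `c'` after at most
`T` steps, and all numbers stored during the computation are at most `w`. -/
def Program.RunsTo (P : Program) (r : ℕ → ℕ) (T w : ℕ) (c c' : Config) : Prop :=
  ∃ τ ≤ T, (P.step r)^[τ] c = c' ∧ P.length ≤ c'.pc ∧
    ∀ i ≤ τ, ((P.step r)^[i] c).Bounded w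

/-- The start of a computation on an `n`-vertex graph: `reg 0` holds `n`, the other registers hold
`0`, and the arrays contain `m`. -/
def startConfig (n : ℕ) (m : Memory) : Config :=
  ⟨0, Function.update (fun _ => 0) 0 n, m⟩

/-! ### Input and output conventions -/

/-- Adjacency lists of a graph, in an arbitrary order. -/
structure AdjLists {n : ℕ} (G : SimpleGraph (Fin n)) where
  nbrs : Fin n → List (Fin n)
  nodup : ∀ v, (nbrs v).Nodup
  mem_iff : ∀ v u, u ∈ nbrs v ↔ G.Adj v u

/-- The input memory for a graph given by adjacency lists. Array `1` holds the concatenation of the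
lists of the vertices `0, …, n - 1`; the list of `v` occupies the positions from `arr 0 [v]` up to
`arr 0 [v + 1]` (exclusive). All other entries are `0`. -/
def AdjLists.memory {n : ℕ} {G : SimpleGraph (Fin n)} (L : AdjLists G) : Memory := fun a i =>
  if a = 0 then (if i ≤ n then ((List.ofFn L.nbrs).take i).flatten.length else 0)
  else if a = 1 then (((List.ofFn L.nbrs).flatten.map Fin.val).getD i 0)
  else 0

/-- The ordering `σ` is written in array `2`: entry `i` is the `i`-th smallest vertex. -/
def WritesOrder {n : ℕ} (m : Memory) (σ : Equiv.Perm (Fin n)) : Prop :=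
  ∀ i : Fin n, m 2 i = (σ i : ℕ)

/-- The graph `G[S]` of the current state is made known by writing the characteristic function
of `S` in array `3`; the other arrays keep their contents. -/
def present {n : ℕ} (S : Finset (Fin n)) (m : Memory) : Memory :=
  Function.update m 3 (fun i => if ∃ v ∈ S, (v : ℕ) = i then 1 else 0)

/-- The action determined by a halted machine: `reg 1 = 0` stands for `delete`; otherwise the
action is `restrict` with the layering written in array `4`. -/
def Config.action (n : ℕ) (c : Config) : Action n :=
  if c.reg 1 = 0 then .delete else .restrict (fun v => (c.arr 4 v : ℤ))

/-! ### Efficiently Baker classes -/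

/-- Playing as Destroyer from the state `(G[S], r)` with memory `m`, the program `P` wins in at most
`t` rounds against every Preserver, using at most `T` steps (on numbers bounded by `w`) to determine
the action at each state. In each round it is given the current state: the vertex set `S` in
array `3`, and the current sequence `r` through the instruction `ask`. The arrays are kept from
round to round. The game stops as soon as there are no vertices. -/
def WinsWith (P : Program) (T w : ℕ) {n : ℕ} (G : OrderedGraph n) :
    ℕ → (ℕ → ℕ) → Finset (Fin n) → Memory → Prop
  | 0, _, S, _ => S = ∅
  | t + 1, r, S, m => S = ∅ ∨
      ∃ c : Config, P.RunsTo r T w (startConfig n (present S m)) c ∧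
        (c.action n).Legal G S ∧
        ∀ S', (c.action n).Next G S (r 0) S' → WinsWith P T w G t (tail r) S' c.arr

/-- `(f, s)`-efficiently Baker classes. The programs `A₁`, `A₂` do not depend on the sequence `r`,
and neither do the time bounds `f n`, `s n`, where `n` is the number of vertices of the input graph.
The machines have words of `O(log n)` bits: on `n`-vertex graphs, all numbers that occur are at most
a constant times `(n + 1) ^ e`. As the elements of `r` are arbitrarily large numbers, this constant
may depend on `r` for `A₂`. The program `A₁` has no access to `r`; `A₂` starts with the memory left
by `A₁`, that is, with the ordering and possibly other auxiliary information. -/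
def EfficientlyBaker (f s : ℕ → ℕ) (C : GraphClass) : Prop :=
  ∃ (A₁ A₂ : Program) (e D : ℕ), ∀ r : ℕ → ℕ, ∃ t D' : ℕ,
    ∀ (n : ℕ) (G : SimpleGraph (Fin n)), G ∈ C n → ∀ L : AdjLists G,
      ∃ (c : Config) (σ : Equiv.Perm (Fin n)),
        A₁.RunsTo (fun _ => 0) (f n) (D * (n + 1) ^ e) (startConfig n L.memory) c ∧
        WritesOrder c.arr σ ∧
        WinsWith A₂ (s n) (D' * (n + 1) ^ e) ⟨G, σ⟩ t r Finset.univ c.arr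

end BakerGame

namespace BakerGame

/-! ### A structured language for the random access machine -/

/-! Decomposition. The vertices are taken in turn; from each one that lies in no piece yet, a
breadth-first search explores its component of the graph left by the earlier pieces. Whenever the
search meets a new earlier piece, the search path from the point of contact towards the root is
added to the current piece, labelled by the piece that was met. A piece is thus connected and has,
besides its root, at most one vertex for each label and level (`Row.card_levels`). Two earlier
pieces touching the same component are adjacent to each other (`Rows.chord`). Together with the
current piece they are the branch sets of a clique minor, so there are fewer than `k - 1` of them
(`Rows.card_nbrPieces_lt`).

Tree. Joining each piece to the earlier pieces touching its component gives a chordal graph `xt`,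
with a tree of pieces in which the parent is the latest adjacent piece. Below a piece `u` the table
`hd u` assigns to a piece the number `n + 1` minus its distance from `u` along steps to earlier
adjacent pieces, and `0` if it is no descendant of `u`. Along an edge below `u` this level changes
by at most one (`Dec.hd_lip`).

Strategy. A phase restricts to tree levels below a topmost piece met by the current graph, then to
search levels of a topmost piece of what remains. The latter piece keeps at most `k` vertices per
surviving level; they come first in the ordering, so a bounded number of deletions removes them. If
there are several topmost pieces, their subtrees are shifted so far apart in the layering that
Preserver's interval meets only one of them (`wins_restrict`).

Termination. Each phase leaves a piece `u i` and a window for `hd (u i)` such that all remaining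
pieces lie strictly below `u i` and in the window. A vertex that survives long would give a long
descending chain of pieces. Along it the level below a fixed `u p` never increases and can drop only
boundedly often. While it is constant, every piece of the chain has one more neighbor in a common
set of pieces, and having `k` neighbors is impossible. So the length is bounded in terms of `k` and
the window widths (`exists_chain_bound`), which bounds the number of rounds (`exists_wins`).

Efficiency. The programs are written in a small structured language whose verification rules account
for time and number sizes. A search costs a constant per vertex and list entry, plus a linear amount
for each of the fewer than `k` adjacent pieces. The decomposition itself shows that there are at
most linearly many edges (`Dec.card_adj_le`), so all searches take quadratic time. A move consists
of a few linear scans over stored tables (`moveCmd_wp_restrict`). -/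

/-- The data of a configuration without the program counter. -/
structure St where
  reg : ℕ → ℕ
  arr : Memory

/-- Overwrite a register. -/
def St.setReg (s : St) (x v : ℕ) : St := ⟨Function.update s.reg x v, s.arr⟩

/-- Overwrite an array entry. -/
def St.setArr (s : St) (a i v : ℕ) : St :=
  ⟨s.reg, Function.update s.arr a (Function.update (s.arr a) i v)⟩

@[simp] theorem St.setReg_reg (s : St) (x v y : ℕ) :
    (s.setReg x v).reg y = if y = x then v else s.reg y := by
  simp [St.setReg, Function.update_apply]

@[simp] theorem St.setReg_arr (s : St) (x v : ℕ) : (s.setReg x v).arr = s.arr := rfl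

@[simp] theorem St.setArr_reg (s : St) (a i v : ℕ) : (s.setArr a i v).reg = s.reg := rfl

@[simp] theorem St.setArr_arr (s : St) (a i v b : ℕ) :
    (s.setArr a i v).arr b = if b = a then Function.update (s.arr a) i v else s.arr b := by
  simp [St.setArr, Function.update_apply]

/-- The configuration with given program counter. -/
def St.at (s : St) (pc : ℕ) : Config := ⟨pc, s.reg, s.arr⟩

/-- Structured commands. -/
inductive Cmd where
  | nop
  | op (i : Instr)
  | seq (c d : Cmd)
  | ite (x y : ℕ) (c d : Cmd)
  | loop (x y : ℕ) (c : Cmd)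

/-- The sequence of a list of commands. -/
def Cmd.seqs : List Cmd → Cmd
  | [] => .nop
  | c :: l => .seq c (Cmd.seqs l)

/-- The instruction is not a jump. -/
def Instr.Straight : Instr → Prop
  | .jumpLt _ _ _ => False
  | _ => True

/-- The effect of an instruction on the data. -/
def Instr.eff (r : ℕ → ℕ) (s : St) : Instr → St
  | .const x a => s.setReg x a
  | .add x y z => s.setReg x (s.reg y + s.reg z)
  | .sub x y z => s.setReg x (s.reg y - s.reg z)
  | .mul x y z => s.setReg x (s.reg y * s.reg z)
  | .load x a y => s.setReg x (s.arr a (s.reg y))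
  | .store a x y => s.setArr a (s.reg x) (s.reg y)
  | .ask x y => s.setReg x (r (s.reg y))
  | .jumpLt _ _ _ => s

theorem Instr.exec_eq_eff (r : ℕ → ℕ) (s : St) (pc : ℕ) (i : Instr) (hi : i.Straight) :
    i.exec r (s.at pc) = (i.eff r s).at (pc + 1) := by
  cases i <;> first | rfl | exact hi.elim

/-- The number of instructions of the compiled command. -/
def Cmd.size : Cmd → ℕ
  | .nop => 0
  | .op _ => 1
  | .seq c d => c.size + d.size
  | .ite _ _ c d => c.size + d.size + 2
  | .loop _ _ c => c.size + 2

/-- The compiled command at a given address. Registers `2` and `3` hold `0` and `1`. -/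
def Cmd.code : Cmd → ℕ → Program
  | .nop, _ => []
  | .op i, _ => [i]
  | .seq c d, o => c.code o ++ d.code (o + c.size)
  | .ite x y c d, o =>
      .jumpLt x y (o + d.size + 2) :: (d.code (o + 1) ++
        .jumpLt 2 3 (o + d.size + 2 + c.size) :: c.code (o + d.size + 2))
  | .loop x y c, o =>
      .jumpLt 2 3 (o + 1 + c.size) :: (c.code (o + 1) ++ [.jumpLt x y (o + 1)])

theorem Cmd.length_code (c : Cmd) (o : ℕ) : (c.code o).length = c.size := by
  induction c generalizing o with
  | nop => rfl
  | op i => rfl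
  | seq c d hc hd => simp [Cmd.code, Cmd.size, hc, hd]
  | ite x y c d hc hd => simp [Cmd.code, Cmd.size, hc, hd]; omega
  | loop x y c hc => simp [Cmd.code, Cmd.size, hc]

/-- All numbers are at most `w`, and registers `2` and `3` hold the constants `0` and `1`. -/
structure Ok (w : ℕ) (s : St) : Prop where
  reg_le : ∀ x, s.reg x ≤ w
  arr_le : ∀ a i, s.arr a i ≤ w
  zero : s.reg 2 = 0
  one : s.reg 3 = 1

/-- Big-step execution with the number of steps; all intermediate data satisfy `Ok w`. -/
inductive Exec (r : ℕ → ℕ) (w : ℕ) : Cmd → St → ℕ → St → Prop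
  | nop (s) : Exec r w .nop s 0 s
  | op (i s) : i.Straight → Ok w (i.eff r s) → Exec r w (.op i) s 1 (i.eff r s)
  | seq {c d s t s' t' s''} : Exec r w c s t s' → Exec r w d s' t' s'' →
      Exec r w (.seq c d) s (t + t') s''
  | ite_true {x y c d s t s'} : s.reg x < s.reg y → Exec r w c s t s' →
      Exec r w (.ite x y c d) s (t + 1) s'
  | ite_false {x y c d s t s'} : ¬ s.reg x < s.reg y → Exec r w d s t s' →
      Exec r w (.ite x y c d) s (t + 2) s'
  | loop_done {x y c s} : ¬ s.reg x < s.reg y → Exec r w (.loop x y c) s 2 s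
  | loop_step {x y c s t s' t' s''} : s.reg x < s.reg y → Exec r w c s t s' →
      Exec r w (.loop x y c) s' t' s'' → Exec r w (.loop x y c) s (t + 1 + t') s''

theorem Exec.ok {r : ℕ → ℕ} {w : ℕ} {c : Cmd} {s s' : St} {t : ℕ} (h : Exec r w c s t s')
    (hs : Ok w s) : Ok w s' := by
  induction h with
  | nop => exact hs
  | op _ _ _ h => exact h
  | seq _ _ h1 h2 => exact h2 (h1 hs)
  | ite_true _ _ h => exact h hs
  | ite_false _ _ h => exact h hs
  | loop_done => exact hs
  | loop_step _ _ _ h1 h2 => exact h2 (h1 hs)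

/-- Lets `Exec.reach` take one step off the time of the remaining iterations. -/
theorem Exec.loop_pos {r : ℕ → ℕ} {w : ℕ} {x y : ℕ} {c : Cmd} {s s' : St} {t : ℕ}
    (h : Exec r w (.loop x y c) s t s') : 0 < t := by
  cases h <;> omega

/-- `P` passes from `c` to `c'` in exactly `t` steps with all numbers at most `w`. -/
def Reach (P : Program) (r : ℕ → ℕ) (w t : ℕ) (c c' : Config) : Prop :=
  (P.step r)^[t] c = c' ∧ ∀ i ≤ t, ((P.step r)^[i] c).Bounded w

theorem Reach.refl {P : Program} {r : ℕ → ℕ} {w : ℕ} {c : Config} (h : c.Bounded w) :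
    Reach P r w 0 c c := by
  refine ⟨rfl, fun i hi => ?_⟩
  obtain rfl : i = 0 := by omega
  exact h

theorem Reach.trans {P : Program} {r : ℕ → ℕ} {w t t' : ℕ} {c c' c'' : Config}
    (h : Reach P r w t c c') (h' : Reach P r w t' c' c'') : Reach P r w (t + t') c c'' := by
  refine ⟨by rw [add_comm, Function.iterate_add_apply, h.1, h'.1], fun i hi => ?_⟩
  by_cases hit : i ≤ t
  · exact h.2 i hit
  · obtain ⟨j, rfl⟩ : ∃ j, i = j + t := ⟨i - t, by omega⟩
    rw [Function.iterate_add_apply, h.1]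
    exact h'.2 j (by omega)

theorem Reach.one {P : Program} {r : ℕ → ℕ} {w : ℕ} {c c' : Config} (h : P.step r c = c')
    (hc : c.Bounded w) (hc' : c'.Bounded w) : Reach P r w 1 c c' := by
  refine ⟨h, fun i hi => ?_⟩
  obtain rfl | rfl : i = 0 ∨ i = 1 := by omega
  · exact hc
  · simpa [h] using hc'

theorem Reach.unstep {P : Program} {r : ℕ → ℕ} {w t : ℕ} {c c' : Config}
    (h : Reach P r w (t + 1) c c') : Reach P r w t (P.step r c) c' :=
  ⟨by simpa using h.1, fun i hi => by simpa using h.2 (i + 1) (by omega)⟩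

theorem Ok.bounded {w : ℕ} {s : St} (h : Ok w s) (pc : ℕ) : (s.at pc).Bounded w :=
  ⟨h.reg_le, h.arr_le⟩

theorem Program.step_at {P : Program} {r : ℕ → ℕ} {s : St} {pc : ℕ} {i : Instr}
    (h : P[pc]? = some i) : P.step r (s.at pc) = i.exec r (s.at pc) := by
  simp only [Program.step, St.at, h]

/-- `Q` stands in `P` at the address `o`. -/
def CodeAt (P : Program) (o : ℕ) (Q : Program) : Prop := ∀ i < Q.length, P[o + i]? = Q[i]?

theorem CodeAt.left {P Q R : Program} {o : ℕ} (h : CodeAt P o (Q ++ R)) : CodeAt P o Q := by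
  intro i hi
  rw [h i (by simp; omega), List.getElem?_append_left hi]

theorem CodeAt.right {P Q R : Program} {o : ℕ} (h : CodeAt P o (Q ++ R)) :
    CodeAt P (o + Q.length) R := by
  intro i hi
  rw [add_assoc, h (Q.length + i) (by simp; omega), List.getElem?_append_right (by omega)]
  simp

theorem CodeAt.head {P Q : Program} {i : Instr} {o : ℕ} (h : CodeAt P o (i :: Q)) :
    P[o]? = some i := by
  simpa using h 0 (by simp)

theorem CodeAt.tail {P Q : Program} {i : Instr} {o : ℕ} (h : CodeAt P o (i :: Q)) :
    CodeAt P (o + 1) Q := by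
  intro j hj
  have := h (j + 1) (by simp; omega)
  simpa [add_assoc, add_comm 1] using this

theorem Ok.step_goto {P : Program} {r : ℕ → ℕ} {w : ℕ} {s : St} (hs : Ok w s) {o l : ℕ}
    (h : P[o]? = some (.jumpLt 2 3 l)) : P.step r (s.at o) = s.at l := by
  rw [Program.step_at h]
  simp [Instr.exec, St.at, hs.zero, hs.one]

/-- Correctness of the compiler with exact time. Jump targets are absolute, so the address is
generalized in the induction. An unconditional jump is the test of register `2` against register
`3`, which works only because `Ok` persists. -/
theorem Exec.reach {P : Program} {r : ℕ → ℕ} {w : ℕ} {c : Cmd} {s s' : St} {t : ℕ}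
    (h : Exec r w c s t s') (hs : Ok w s) {o : ℕ} (hP : CodeAt P o (c.code o)) :
    Reach P r w t (s.at o) (s'.at (o + c.size)) := by
  induction h generalizing o with
  | nop => exact .refl (hs.bounded o)
  | op i s hi hok =>
    exact .one (by rw [Program.step_at hP.head, Instr.exec_eq_eff _ _ _ _ hi]; rfl)
      (hs.bounded o) (hok.bounded _)
  | @seq c d s t s' t' s'' h1 h2 ih1 ih2 =>
    have h := hP.right
    rw [Cmd.length_code] at h
    have := (ih1 hs hP.left).trans (ih2 (h1.ok hs) h)
    rwa [add_assoc] at this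
  | @ite_true x y c d s t s' hxy h1 ih =>
    -- The code of `d` precedes that of `c`: the true branch stands behind the test, `d` and the
    -- jump over `c`.
    have h := hP.tail.right.tail
    rw [Cmd.length_code, show o + 1 + d.size + 1 = o + d.size + 2 by ring] at h
    have h0 : P.step r (s.at o) = s.at (o + d.size + 2) := by
      rw [Program.step_at hP.head]; simp [Instr.exec, St.at, hxy]
    have := (Reach.one h0 (hs.bounded _) (hs.bounded _)).trans (ih hs h)
    rw [add_comm t 1]
    convert this using 2
    simp only [Cmd.size]; ring
  | @ite_false x y c d s t s' hxy h1 ih =>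
    have h := hP.tail.left
    have hg := hP.tail.right.head
    rw [Cmd.length_code] at hg
    have h0 : P.step r (s.at o) = s.at (o + 1) := by
      rw [Program.step_at hP.head]; simp [Instr.exec, St.at, hxy]
    have hs' := h1.ok hs
    have := ((Reach.one h0 (hs.bounded _) (hs.bounded _)).trans (ih hs h)).trans
      (Reach.one (hs'.step_goto hg) (hs'.bounded _) (hs'.bounded _))
    rw [show t + 2 = 1 + t + 1 by ring]
    convert this using 2
    simp only [Cmd.size]; ring
  | @loop_done x y c s hxy =>
    have hg := hP.tail.right.head
    rw [Cmd.length_code] at hg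
    have h0 : P.step r (s.at (o + 1 + c.size)) = s.at (o + 1 + c.size + 1) := by
      rw [Program.step_at hg]; simp [Instr.exec, St.at, hxy]
    have := (Reach.one (hs.step_goto (r := r) hP.head) (hs.bounded _) (hs.bounded _)).trans
      (Reach.one h0 (hs.bounded _) (hs.bounded _))
    convert this using 2
    simp only [Cmd.size]; ring
  | @loop_step x y c s t s' t' s'' hxy h1 h2 ih1 ih2 =>
    have hg := hP.tail.right.head
    rw [Cmd.length_code] at hg
    have h0 : P.step r (s.at (o + 1 + c.size)) = s.at (o + 1) := by
      rw [Program.step_at hg]; simp [Instr.exec, St.at, hxy]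
    have hs' := h1.ok hs
    have hr := ih2 hs' hP
    -- The derivation for the remaining iterations begins with the jump to the test. After the body
    -- the machine already stands at the test, so this step is removed.
    obtain ⟨t', rfl⟩ : ∃ u, t' = u + 1 := ⟨t' - 1, by have := h2.loop_pos; omega⟩
    have hr := hr.unstep
    rw [hs'.step_goto hP.head] at hr
    have := (((Reach.one (hs.step_goto (r := r) hP.head) (hs.bounded _) (hs.bounded _)).trans
      (Reach.one h0 (hs.bounded _) (hs.bounded _))).trans (ih1 hs hP.tail.left)).trans hr
    convert this using 1
    ring

/-! ### Verification rules -/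

/-- Started in `s`, the command terminates and its time and final data satisfy `Q`. -/
def Wp (r : ℕ → ℕ) (w : ℕ) (c : Cmd) (s : St) (Q : ℕ → St → Prop) : Prop :=
  ∃ t s', Exec r w c s t s' ∧ Ok w s' ∧ Q t s'

section rules

variable {r : ℕ → ℕ} {w : ℕ} {s : St} {Q : ℕ → St → Prop} {x y z a v : ℕ} {c d : Cmd}

theorem Wp.mono {Q' : ℕ → St → Prop} (h : Wp r w c s Q)
    (hQ : ∀ t s', Ok w s' → Q t s' → Q' t s') : Wp r w c s Q' := by
  obtain ⟨t, s', h1, h2, h3⟩ := h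
  exact ⟨t, s', h1, h2, hQ _ _ h2 h3⟩

theorem Wp.nop (hs : Ok w s) (h : Q 0 s) : Wp r w .nop s Q := ⟨0, s, .nop s, hs, h⟩

theorem Wp.seqs_nil (hs : Ok w s) (h : Q 0 s) : Wp r w (Cmd.seqs []) s Q := ⟨0, s, .nop s, hs, h⟩

theorem Wp.seqs_cons {l : List Cmd}
    (h : Wp r w c s fun t s' => Wp r w (Cmd.seqs l) s' fun t' s'' => Q (t + t') s'') :
    Wp r w (Cmd.seqs (c :: l)) s Q := by
  obtain ⟨t, s', h1, -, t', s'', h2, h3, h4⟩ := h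
  exact ⟨t + t', s'', .seq h1 h2, h3, h4⟩

theorem Ok.setReg (hs : Ok w s) (hx : x ≠ 2 ∧ x ≠ 3) (hv : v ≤ w) : Ok w (s.setReg x v) where
  reg_le y := by simp only [St.setReg_reg]; split_ifs; exacts [hv, hs.reg_le y]
  arr_le := hs.arr_le
  zero := by simp [hx.1.symm, hs.zero]
  one := by simp [hx.2.symm, hs.one]

theorem Ok.setArr (hs : Ok w s) {i : ℕ} (hv : v ≤ w) : Ok w (s.setArr a i v) where
  reg_le := hs.reg_le
  arr_le b j := by
    simp only [St.setArr_arr]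
    split_ifs
    · simp only [Function.update_apply]; split_ifs; exacts [hv, hs.arr_le _ _]
    · exact hs.arr_le _ _
  zero := hs.zero
  one := hs.one

theorem Wp.const (hs : Ok w s) (hx : x ≠ 2 ∧ x ≠ 3) (hv : v ≤ w)
    (h : Ok w (s.setReg x v) → Q 1 (s.setReg x v)) : Wp r w (.op (.const x v)) s Q :=
  have h' := hs.setReg hx hv
  ⟨1, _, .op _ _ trivial h', h', h h'⟩

theorem Wp.add (hs : Ok w s) (hx : x ≠ 2 ∧ x ≠ 3) (hv : s.reg y + s.reg z ≤ w)
    (h : Ok w (s.setReg x (s.reg y + s.reg z)) → Q 1 (s.setReg x (s.reg y + s.reg z))) :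
    Wp r w (.op (.add x y z)) s Q :=
  have h' := hs.setReg hx hv
  ⟨1, _, .op _ _ trivial h', h', h h'⟩

theorem Wp.mul (hs : Ok w s) (hx : x ≠ 2 ∧ x ≠ 3) (hv : s.reg y * s.reg z ≤ w)
    (h : Ok w (s.setReg x (s.reg y * s.reg z)) → Q 1 (s.setReg x (s.reg y * s.reg z))) :
    Wp r w (.op (.mul x y z)) s Q :=
  have h' := hs.setReg hx hv
  ⟨1, _, .op _ _ trivial h', h', h h'⟩

theorem Wp.sub (hs : Ok w s) (hx : x ≠ 2 ∧ x ≠ 3)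
    (h : Ok w (s.setReg x (s.reg y - s.reg z)) → Q 1 (s.setReg x (s.reg y - s.reg z))) :
    Wp r w (.op (.sub x y z)) s Q :=
  have h' := hs.setReg hx ((Nat.sub_le _ _).trans (hs.reg_le y))
  ⟨1, _, .op _ _ trivial h', h', h h'⟩

theorem Wp.load (hs : Ok w s) (hx : x ≠ 2 ∧ x ≠ 3)
    (h : Ok w (s.setReg x (s.arr a (s.reg y))) → Q 1 (s.setReg x (s.arr a (s.reg y)))) :
    Wp r w (.op (.load x a y)) s Q :=
  have h' := hs.setReg hx (hs.arr_le _ _)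
  ⟨1, _, .op _ _ trivial h', h', h h'⟩

theorem Wp.store (hs : Ok w s)
    (h : Ok w (s.setArr a (s.reg x) (s.reg y)) → Q 1 (s.setArr a (s.reg x) (s.reg y))) :
    Wp r w (.op (.store a x y)) s Q :=
  have h' := hs.setArr (hs.reg_le y)
  ⟨1, _, .op _ _ trivial h', h', h h'⟩

theorem Wp.ask (hs : Ok w s) (hx : x ≠ 2 ∧ x ≠ 3) (hv : r (s.reg y) ≤ w)
    (h : Ok w (s.setReg x (r (s.reg y))) → Q 1 (s.setReg x (r (s.reg y)))) :
    Wp r w (.op (.ask x y)) s Q :=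
  have h' := hs.setReg hx hv
  ⟨1, _, .op _ _ trivial h', h', h h'⟩

theorem Wp.ite (h1 : s.reg x < s.reg y → Wp r w c s fun t s' => Q (t + 1) s')
    (h2 : s.reg y ≤ s.reg x → Wp r w d s fun t s' => Q (t + 2) s') :
    Wp r w (.ite x y c d) s Q := by
  by_cases h : s.reg x < s.reg y
  · obtain ⟨t, s', h3, h4, h5⟩ := h1 h
    exact ⟨_, s', .ite_true h h3, h4, h5⟩
  · obtain ⟨t, s', h3, h4, h5⟩ := h2 (not_lt.1 h)
    exact ⟨_, s', .ite_false h h3, h4, h5⟩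

/-- The loop rule with an invariant `I` and a potential `φ` paying for the time. -/
theorem Wp.loop (I : St → Prop) (φ : St → ℕ) (hs : Ok w s) (hI : I s)
    (hbody : ∀ s, Ok w s → I s → s.reg x < s.reg y →
      Wp r w c s fun t s' => I s' ∧ φ s' + t + 1 ≤ φ s)
    (hQ : ∀ t s', Ok w s' → I s' → s'.reg y ≤ s'.reg x → φ s' + t ≤ φ s + 2 → Q t s') :
    Wp r w (.loop x y c) s Q := by
  -- An iteration lowers `φ` by at least one, so induction on a bound for `φ` also gives
  -- termination.
  suffices H : ∀ N s, φ s ≤ N → Ok w s → I s →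
      ∃ t s', Exec r w (.loop x y c) s t s' ∧ Ok w s' ∧ I s' ∧ s'.reg y ≤ s'.reg x ∧
        φ s' + t ≤ φ s + 2 by
    obtain ⟨t, s', h1, h2, h3, h4, h5⟩ := H _ s le_rfl hs hI
    exact ⟨t, s', h1, h2, hQ t s' h2 h3 h4 h5⟩
  intro N
  induction N with
  | zero =>
    intro s hN hs hI
    by_cases h : s.reg x < s.reg y
    · obtain ⟨t, s', h1, h2, h3, h4⟩ := hbody s hs hI h
      omega
    · exact ⟨2, s, .loop_done h, hs, hI, not_lt.1 h, le_rfl⟩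
  | succ N ih =>
    intro s hN hs hI
    by_cases h : s.reg x < s.reg y
    · obtain ⟨t, s', h1, h2, h3, h4⟩ := hbody s hs hI h
      obtain ⟨t', s'', h5, h6, h7, h8, h9⟩ := ih s' (by omega) h2 h3
      exact ⟨t + 1 + t', s'', .loop_step h h1 h5, h6, h7, h8, by omega⟩
    · exact ⟨2, s, .loop_done h, hs, hI, not_lt.1 h, le_rfl⟩

end rules

/-- The program executing a command after setting up the constant `1`. -/
def Cmd.program (c : Cmd) : Program := .const 3 1 :: c.code 1

/-- Passes from the rules to `RunsTo`. The extra step in `t + 1 ≤ T` is the instruction setting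
register `3` to `1`; register `2` is `0` from the start. -/
theorem Cmd.program_runsTo {r : ℕ → ℕ} {w n T : ℕ} {m : Memory} {c : Cmd} {Q : ℕ → St → Prop}
    (hw : 1 ≤ w) (hn : n ≤ w) (hm : ∀ a i, m a i ≤ w)
    (h : Ok w ⟨Function.update (Function.update (fun _ => 0) 0 n) 3 1, m⟩ →
      Wp r w c ⟨Function.update (Function.update (fun _ => 0) 0 n) 3 1, m⟩ Q)
    (hT : ∀ t s', Q t s' → t + 1 ≤ T) :
    ∃ (s' : St) (t pc : ℕ), Ok w s' ∧ Q t s' ∧ c.program.RunsTo r T w (startConfig n m) (s'.at pc) := by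
  set s : St := ⟨Function.update (Function.update (fun _ => 0) 0 n) 3 1, m⟩ with hsdef
  have hs : Ok w s := by
    refine ⟨fun x => ?_, hm, by simp [hsdef], by simp [hsdef]⟩
    simp only [hsdef, Function.update_apply]
    split_ifs <;> omega
  obtain ⟨t, s', h1, h2, h3⟩ := h hs
  refine ⟨s', t, 1 + c.size, h2, h3, 1 + t, by have := hT _ _ h3; omega, ?_⟩
  have h0 : Reach c.program r w 1 (startConfig n m) (s.at 1) := by
    refine .one rfl ⟨fun x => ?_, hm⟩ (hs.bounded 1)
    simp only [startConfig, Function.update_apply]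
    split_ifs <;> omega
  have hc : CodeAt c.program 1 (c.code 1) := fun i hi => by
    simp [Cmd.program, add_comm 1 i]
  have := h0.trans (h1.reach hs hc)
  refine ⟨this.1, ?_, this.2⟩
  simp [Cmd.program, Cmd.length_code, St.at, add_comm]

/-! ### Pieces cut out by breadth-first searches -/

/-- Adjacency of natural numbers naming vertices. -/
def NAdj {n : ℕ} (G : SimpleGraph (Fin n)) (v w : ℕ) : Prop :=
  ∃ (hv : v < n) (hw : w < n), G.Adj ⟨v, hv⟩ ⟨w, hw⟩

theorem NAdj.symm {n : ℕ} {G : SimpleGraph (Fin n)} {v w : ℕ} (h : NAdj G v w) : NAdj G w v :=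
  ⟨h.2.1, h.1, h.2.2.symm⟩

/-- The search from the vertex `u - 1` with levels `g` and set `x` of adjacent earlier pieces; the
piece is the set of vertices `v` with `pc v = u`, and `lab` tells the path through which a vertex
entered it. The vertices satisfying `z` are about to enter the piece. -/
structure Row (adj : ℕ → ℕ → Prop) (u : ℕ) (pc lab g x : ℕ → ℕ) (z : ℕ → Prop) : Prop where
  root : ∀ v, 0 < g v → 0 < u ∧ pc (u - 1) = u ∧ g (u - 1) = 1
  g_pc : ∀ v, 0 < g v → pc v = 0 ∨ u ≤ pc v
  pc_g : ∀ v, 0 < u → pc v = u → 0 < g v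
  g_par : ∀ v, 0 < g v → v = u - 1 ∨ ∃ w, adj v w ∧ 0 < g w ∧ g w + 1 = g v
  pc_par : ∀ v, 0 < u → pc v = u → v = u - 1 ∨ ∃ w, adj v w ∧ (pc w = u ∨ z w) ∧ g w + 1 = g v
  x_lt : ∀ q, x q ≠ 0 → 0 < q ∧ q < u
  x_adj : ∀ q, x q ≠ 0 → ∃ a b, adj a b ∧ (pc a = u ∨ z a) ∧ pc b = q
  lab_x : ∀ v, 0 < u → pc v = u → v = u - 1 ∨ x (lab v) ≠ 0
  lab_inj : ∀ v w, 0 < u → pc v = u → pc w = u → v ≠ u - 1 → w ≠ u - 1 → lab v = lab w →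
    g v = g w → v = w

/-- Every neighbor of a vertex of the search satisfying `P` belongs to the search, at most one level
further, or to an earlier piece listed in `x`. -/
def Closed (adj : ℕ → ℕ → Prop) (u : ℕ) (pc g x : ℕ → ℕ) (P : ℕ → Prop) : Prop :=
  ∀ v w, P v → 0 < g v → adj v w →
    (0 < g w ∧ g w ≤ g v + 1) ∨ (0 < pc w ∧ pc w < u ∧ x (pc w) ≠ 0)

/-- The searches with roots up to `m - 1` are complete. -/
structure Rows (adj : ℕ → ℕ → Prop) (m : ℕ) (pc lab : ℕ → ℕ) (gd xt : ℕ → ℕ → ℕ) : Prop where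
  row : ∀ u ≤ m, Row adj u pc lab (gd u) (xt u) fun _ => False
  closed : ∀ u ≤ m, Closed adj u pc (gd u) (xt u) fun _ => True

/-- The earlier pieces adjacent to a search. -/
def nbrPieces (x : ℕ → ℕ) (u : ℕ) : Finset ℕ := (Finset.range u).filter (x · ≠ 0)

theorem Row.mem_nbrPieces {adj : ℕ → ℕ → Prop} {u : ℕ} {pc lab g x : ℕ → ℕ} {z : ℕ → Prop}
    (h : Row adj u pc lab g x z) (q : ℕ) : q ∈ nbrPieces x u ↔ x q ≠ 0 := by
  simp only [nbrPieces, Finset.mem_filter, Finset.mem_range, and_iff_right_iff_imp]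
  exact fun hq => (h.x_lt q hq).2

/-- By `lab_inj` a vertex of the piece other than the root is determined by its label and level. The
root gets the label `0`, which is free since pieces are numbered from `1`. -/
theorem Row.card_levels {adj : ℕ → ℕ → Prop} {u : ℕ} {pc lab g x : ℕ → ℕ} {z : ℕ → Prop}
    (h : Row adj u pc lab g x z) (hu : 0 < u) (n : ℕ) (J : Finset ℕ) :
    ((Finset.range n).filter fun v => pc v = u ∧ g v ∈ J).card ≤
      ((nbrPieces x u).card + 1) * J.card := by
  classical
  calc _ ≤ ((insert 0 (nbrPieces x u)) ×ˢ J).card := by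
        refine Finset.card_le_card_of_injOn (fun v => (if v = u - 1 then 0 else lab v, g v)) ?_ ?_
        · intro v hv
          simp only [Finset.coe_filter, Set.mem_ofPred_eq] at hv
          simp only [Finset.coe_product, Set.mem_prod, Finset.mem_coe, hv.2.2, and_true]
          split_ifs with h1
          · simp
          · exact Finset.mem_insert_of_mem ((h.mem_nbrPieces _).2
              ((h.lab_x v hu hv.2.1).resolve_left h1))
        · intro v hv w hw hvw
          simp only [Finset.coe_filter, Set.mem_ofPred_eq] at hv hw
          simp only [Prod.mk.injEq] at hvw
          obtain ⟨hl, hg⟩ := hvw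
          by_cases h1 : v = u - 1 <;> by_cases h2 : w = u - 1
          · omega
          · have := (h.x_lt _ ((h.lab_x w hu hw.2.1).resolve_left h2)).1
            simp [h1, h2] at hl
            omega
          · have := (h.x_lt _ ((h.lab_x v hu hv.2.1).resolve_left h1)).1
            simp [h1, h2] at hl
            omega
          · simp only [h1, h2, if_false] at hl
            exact h.lab_inj v w hu hv.2.1 hw.2.1 h1 h2 hl hg
    _ ≤ _ := by
        rw [Finset.card_product]
        exact Nat.mul_le_mul_right _ (Finset.card_insert_le _ _)

section Rows

variable {adj : ℕ → ℕ → Prop} {m : ℕ} {pc lab : ℕ → ℕ} {gd xt : ℕ → ℕ → ℕ}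

/-- The second case of `Closed` would put `w` into a piece before `q`, but the vertices of the
search `p` lie in no piece or in one numbered at least `p`. -/
theorem Rows.step (h : Rows adj m pc lab gd xt) {p q v w : ℕ} (hp : p ≤ m) (hqp : q < p)
    (hq : q ≤ m) (hv : 0 < gd q v) (hw : 0 < gd p w) (hvw : adj v w) : 0 < gd q w := by
  rcases h.closed q hq v w trivial hv hvw with h1 | h1
  · exact h1.1
  · rcases (h.row p hp).g_pc w hw with h2 | h2 <;> omega

/-- The region of a search lies in that of every earlier search whose piece it touches. An edge
between the two pieces brings one vertex of `p` into the search `q`; membership then spreads up to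
the root `p - 1` and from there down to the whole search. -/
theorem Rows.sub (h : Rows adj m pc lab gd xt) (hadj : ∀ v w, adj v w → adj w v) {p q v : ℕ}
    (hp : p ≤ m) (hpq : xt p q ≠ 0) (hv : 0 < gd p v) : 0 < gd q v := by
  obtain ⟨hq0, hqp⟩ := (h.row p hp).x_lt q hpq
  have hq : q ≤ m := by omega
  have R := h.row p hp
  obtain ⟨a, b, hab, ha, hb⟩ := R.x_adj q hpq
  replace ha : pc a = p := by simpa using ha
  have up : ∀ l a, gd p a ≤ l → 0 < gd p a → 0 < gd q a → 0 < gd q (p - 1) := by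
    intro l
    induction l with
    | zero => intros; omega
    | succ l ih =>
      intro a hl h1 h2
      rcases R.g_par a h1 with rfl | ⟨w, hw, h3, h4⟩
      · exact h2
      · exact ih w (by omega) h3 (h.step hp hqp hq h2 h3 hw)
  have hb' : 0 < gd q b := (h.row q hq).pc_g b hq0 hb
  have hga := R.pc_g a (by omega) ha
  have hroot := up _ a le_rfl hga (h.step hp hqp hq hb' hga (hadj _ _ hab))
  have down : ∀ l a, gd p a ≤ l → 0 < gd p a → 0 < gd q a := by
    intro l
    induction l with
    | zero => intros; omega
    | succ l ih =>
      intro a hl h1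
      rcases R.g_par a h1 with rfl | ⟨w, hw, h3, h4⟩
      · exact hroot
      · exact h.step hp hqp hq (ih w (by omega) h3) h1 (hadj _ _ hw)
  exact down _ v le_rfl hv

/-- By `Rows.sub` the piece `p` lies inside the search of `q'`, and some vertex of it has a neighbor
in the piece `q`. As `q < q'`, that neighbor is outside this search, so closedness forces `q'` to
list `q`. -/
theorem Rows.chord (h : Rows adj m pc lab gd xt) (hadj : ∀ v w, adj v w → adj w v) {p q q' : ℕ}
    (hp : p ≤ m) (hq : xt p q ≠ 0) (hq' : xt p q' ≠ 0) (hlt : q < q') : xt q' q ≠ 0 := by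
  obtain ⟨hq0, hqp⟩ := (h.row p hp).x_lt q' hq'
  obtain ⟨a, b, hab, ha, rfl⟩ := (h.row p hp).x_adj q hq
  replace ha : pc a = p := by simpa using ha
  have hga := h.sub hadj hp hq' ((h.row p hp).pc_g a (by omega) ha)
  rcases h.closed q' (by omega) a b trivial hga hab with h1 | h1
  · have := ((h.row p hp).x_lt _ hq).1
    rcases (h.row q' (by omega)).g_pc b h1.1 with h2 | h2 <;> omega
  · exact h1.2.2

theorem Rows.edge (h : Rows adj m pc lab gd xt) {v w : ℕ} (hv : pc v ≤ m) (hw : 0 < pc w)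
    (hvw : adj v w) (hlt : pc w < pc v) : xt (pc v) (pc w) ≠ 0 := by
  rcases h.closed (pc v) hv v w trivial ((h.row _ hv).pc_g v (by omega) rfl) hvw with h1 | h1
  · rcases (h.row _ hv).g_pc w h1.1 with h2 | h2 <;> omega
  · exact h1.2.2

end Rows

/-- With nothing pending, a vertex other than the root has a neighbor in the piece one level lower;
induction on the level leads to the root. -/
theorem Row.connected {n : ℕ} {G : SimpleGraph (Fin n)} {u : ℕ} {pc lab g x : ℕ → ℕ}
    (h : Row (NAdj G) u pc lab g x fun _ => False) (hu : 0 < u) (hun : u ≤ n)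
    (hpc : pc (u - 1) = u) : (G.induce {v : Fin n | pc v = u}).Connected := by
  rw [SimpleGraph.connected_iff_exists_forall_reachable]
  have hr : (⟨u - 1, by omega⟩ : Fin n) ∈ {v : Fin n | pc v = u} := hpc
  refine ⟨⟨_, hr⟩, ?_⟩
  suffices H : ∀ l (v : Fin n) (hv : v ∈ {v : Fin n | pc v = u}), g v ≤ l →
      (G.induce {v : Fin n | pc v = u}).Reachable ⟨_, hr⟩ ⟨v, hv⟩ from
    fun ⟨v, hv⟩ => H _ v hv le_rfl
  intro l
  induction l with
  | zero => intro v hv hl; have := h.pc_g v hu hv; omega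
  | succ l ih =>
    intro v hv hl
    rcases h.pc_par v hu hv with h1 | ⟨w, ⟨_, hw, hvw⟩, h1, h2⟩
    · have e : (⟨⟨u - 1, by omega⟩, hr⟩ : {v : Fin n | pc v = u}) = ⟨v, hv⟩ :=
        Subtype.ext (Fin.ext h1.symm)
      exact e ▸ .refl _
    · have hw' : (⟨w, hw⟩ : Fin n) ∈ {v : Fin n | pc v = u} := by simpa using h1
      refine (ih ⟨w, hw⟩ hw' (by show g w ≤ l; omega)).trans (SimpleGraph.Adj.reachable ?_)
      exact SimpleGraph.comap_adj.2 hvw.symm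

/-- The piece `p` and its listed pieces are disjoint, connected and, by `Rows.chord`, pairwise
adjacent, so they can serve as the branch sets of a clique. -/
theorem Rows.card_nbrPieces_lt {n k m : ℕ} {G : SimpleGraph (Fin n)} {pc lab : ℕ → ℕ}
    {gd xt : ℕ → ℕ → ℕ} (h : Rows (NAdj G) m pc lab gd xt)
    (hG : ¬ IsMinor (⊤ : SimpleGraph (Fin k)) G) {p : ℕ} (hp : p ≤ m) (hpn : p ≤ n) (hp0 : 0 < p)
    (hpc : pc (p - 1) = p) : (nbrPieces (xt p) p).card + 1 < k := by
  by_contra hk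
  refine hG ?_
  have hroot : ∀ q ∈ insert p (nbrPieces (xt p) p), 0 < q ∧ q ≤ p ∧ pc (q - 1) = q := by
    intro q hq
    rcases Finset.mem_insert.1 hq with rfl | hq
    · exact ⟨hp0, le_rfl, hpc⟩
    · have hx := ((h.row p hp).mem_nbrPieces q).1 hq
      obtain ⟨h1, h2⟩ := (h.row p hp).x_lt q hx
      obtain ⟨a, b, -, -, hb⟩ := (h.row p hp).x_adj q hx
      exact ⟨h1, h2.le, ((h.row q (by omega)).root b ((h.row q (by omega)).pc_g b h1 hb)).2.1⟩
  have hadj : ∀ q ∈ insert p (nbrPieces (xt p) p), ∀ q' ∈ insert p (nbrPieces (xt p) p), q < q' →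
      xt q' q ≠ 0 := by
    intro q hq q' hq' hlt
    have hq1 : q ∈ nbrPieces (xt p) p := by
      rcases Finset.mem_insert.1 hq with rfl | hq
      · have := (hroot q' hq').2.1; omega
      · exact hq
    rw [(h.row p hp).mem_nbrPieces] at hq1
    rcases Finset.mem_insert.1 hq' with rfl | hq'
    · exact hq1
    · rw [(h.row p hp).mem_nbrPieces] at hq'
      exact h.chord (fun _ _ => NAdj.symm) hp hq1 hq' hlt
  have hcard : k ≤ (insert p (nbrPieces (xt p) p)).card := by
    rw [Finset.card_insert_of_notMem (by simp [nbrPieces])]; omega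
  have hcard' : Fintype.card (Fin k) ≤ Fintype.card (insert p (nbrPieces (xt p) p) : Finset ℕ) := by
    simpa using hcard
  obtain ⟨e⟩ := Function.Embedding.nonempty_of_card_le hcard'
  refine ⟨fun i => {v : Fin n | pc v = (e i : ℕ)}, fun i => ?_, fun i j hij => ?_,
    fun i j hij => ?_⟩
  · obtain ⟨h1, h2, h3⟩ := hroot _ (e i).2
    exact (h.row _ (h2.trans hp)).connected h1 (h2.trans hpn) h3
  · refine Set.disjoint_left.2 fun v hv hv' => hij (e.injective (Subtype.ext ?_))
    rw [← show pc v = (e i : ℕ) from hv, ← show pc v = (e j : ℕ) from hv']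
  · have key : ∀ i j : Fin k, (e i : ℕ) < e j → ∃ a b : Fin n, pc a = (e j : ℕ) ∧ pc b = (e i : ℕ)
        ∧ G.Adj a b := by
      intro i j hlt
      obtain ⟨h1, h2, h3⟩ := hroot _ (e j).2
      obtain ⟨a, b, ⟨ha, hb, hab⟩, h4, h5⟩ :=
        (h.row _ (h2.trans hp)).x_adj _ (hadj _ (e i).2 _ (e j).2 hlt)
      exact ⟨⟨a, ha⟩, ⟨b, hb⟩, by simpa using h4, h5, hab⟩
    rcases lt_trichotomy (e i : ℕ) (e j) with hlt | heq | hlt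
    · obtain ⟨a, b, h1, h2, h3⟩ := key i j hlt
      exact ⟨b, h2, a, h1, h3.symm⟩
    · exact absurd (e.injective (Subtype.ext heq)) hij.ne
    · obtain ⟨a, b, h1, h2, h3⟩ := key j i hlt
      exact ⟨a, h1, b, h2, h3⟩

/-! ### The tree of pieces -/

/-- The table `hd` of levels in the tree of pieces with adjacencies `xt`, and the parents `par`. -/
structure Tree (N : ℕ) (xt hd : ℕ → ℕ → ℕ) (par : ℕ → ℕ) : Prop where
  xt_lt : ∀ p q, xt p q ≠ 0 → 0 < q ∧ q < p
  hd_pos : ∀ u p, hd u p ≠ 0 → 0 < u ∧ u ≤ p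
  hd_ge : ∀ u p q, xt p q ≠ 0 → hd u q ≤ hd u p + 1
  hd_eq : ∀ u p, hd u p ≠ 0 → (u = p ∧ hd u p = N) ∨ ∃ q, xt p q ≠ 0 ∧ hd u p + 1 = hd u q
  par_ge : ∀ p q, xt p q ≠ 0 → q ≤ par p
  par_eq : ∀ p, par p ≠ 0 → xt p (par p) ≠ 0

/-- The decomposition of a graph into pieces, with everything the strategy needs. -/
structure Dec {n : ℕ} (G : SimpleGraph (Fin n)) (k : ℕ) (pc par : ℕ → ℕ) (gd xt hd : ℕ → ℕ → ℕ) :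
    Prop extends Tree (n + 1) xt hd par where
  pc_pos : ∀ v < n, 0 < pc v ∧ pc v ≤ n
  xt_le : ∀ p q, xt p q ≠ 0 → p ≤ n
  chord : ∀ p q q', xt p q ≠ 0 → xt p q' ≠ 0 → q < q' → xt q' q ≠ 0
  edge : ∀ v w, NAdj G v w → pc w < pc v → xt (pc v) (pc w) ≠ 0
  card_lt : ∀ p, (nbrPieces (xt p) p).card < k
  gd_lip : ∀ u v w, NAdj G v w → 0 < gd u v → 0 < gd u w → gd u w ≤ gd u v + 1
  gd_mono : ∀ p q v, xt p q ≠ 0 → 0 < gd p v → 0 < gd q v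
  gd_self : ∀ v < n, 0 < gd (pc v) v
  levels : ∀ u (J : Finset ℕ), 0 < u →
    ((Finset.range n).filter fun v => pc v = u ∧ gd u v ∈ J).card ≤ k * J.card
  hd_self : ∀ v < n, hd (pc v) (pc v) = n + 1
  gd_le : ∀ u v, gd u v ≤ n + 1
  hd_le : ∀ u v, hd u v ≤ n + 1

namespace Dec

variable {n k : ℕ} {G : SimpleGraph (Fin n)} {pc par : ℕ → ℕ} {gd xt hd : ℕ → ℕ → ℕ}

theorem mem_nbrPieces (D : Dec G k pc par gd xt hd) (p q : ℕ) :
    q ∈ nbrPieces (xt p) p ↔ xt p q ≠ 0 := by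
  simp only [nbrPieces, Finset.mem_filter, Finset.mem_range, and_iff_right_iff_imp]
  exact fun hq => (D.xt_lt p q hq).2

/-- A step towards `u` raises the level by one and lowers the number of the piece by at least one.
Since adjacent pieces are numbered up to `n`, the levels of descendants never sink to `0`, the value
for non-descendants. -/
theorem hd_add_ge (D : Dec G k pc par gd xt hd) {u p : ℕ} (h : 0 < hd u p) :
    n + 1 + u ≤ hd u p + p := by
  induction p using Nat.strong_induction_on with
  | _ p ih =>
    rcases D.hd_eq u p h.ne' with ⟨rfl, h1⟩ | ⟨q, hq, h1⟩
    · omega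
    · have := (D.xt_lt p q hq).2
      have := ih q this (by omega)
      omega

/-- Descendants: a piece adjacent to a descendant is a descendant. -/
theorem hd_up (D : Dec G k pc par gd xt hd) {u p q : ℕ} (hpq : xt p q ≠ 0) (h : 0 < hd u q) :
    0 < hd u p := by
  have h1 := D.hd_add_ge h
  have h2 := D.hd_ge u p q hpq
  have h3 := (D.xt_lt p q hpq).2
  have h4 := D.xt_le p q hpq
  have h5 := (D.hd_pos u q h.ne').1
  omega

/-- Both `q` and the next piece `q'` from `p` towards `u` are adjacent to `p`, hence equal or
adjacent to each other. Being below `u` then passes from `q'` to `q`, by induction or by `hd_up`. -/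
theorem hd_down (D : Dec G k pc par gd xt hd) {u p q : ℕ} (h : 0 < hd u p) (hpq : xt p q ≠ 0)
    (huq : u ≤ q) : 0 < hd u q := by
  induction p using Nat.strong_induction_on with
  | _ p ih =>
    have hq := (D.xt_lt p q hpq).2
    rcases D.hd_eq u p h.ne' with ⟨rfl, h1⟩ | ⟨q', hq', h1⟩
    · omega
    · have h2 : 0 < hd u q' := by omega
      rcases lt_trichotomy q q' with hlt | rfl | hlt
      · exact ih q' (D.xt_lt p q' hq').2 h2 (D.chord p q q' hpq hq' hlt)
      · exact h2
      · exact D.hd_up (D.chord p q' q hq' hpq hlt) h2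

/-- The separator property of the tree: chordality passes the adjacency with `q` along the steps
from `p` to `u`. -/
theorem xt_of_hd (D : Dec G k pc par gd xt hd) {u p q : ℕ} (h : 0 < hd u p) (hpq : xt p q ≠ 0)
    (huq : q < u) : xt u q ≠ 0 := by
  induction p using Nat.strong_induction_on with
  | _ p ih =>
    rcases D.hd_eq u p h.ne' with ⟨rfl, h1⟩ | ⟨q', hq', h1⟩
    · exact hpq
    · have h2 : 0 < hd u q' := by omega
      have h3 := (D.hd_pos u q' h2.ne').2
      exact ih q' (D.xt_lt p q' hq').2 h2 (D.chord p q q' hpq hq' (by omega))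

/-- The first step of a shortest way from `w` to `u` either stays below `v`, or leads to a piece
before `v`, which is adjacent to `v` too by `xt_of_hd`. So `w` is no closer to `u` than `v` is. -/
theorem hd_anti (D : Dec G k pc par gd xt hd) {u v w : ℕ} (huv : 0 < hd u v) (hvw : 0 < hd v w) :
    hd u w ≤ hd u v := by
  induction w using Nat.strong_induction_on with
  | _ w ih =>
    have h0 := (D.hd_pos v w hvw.ne').2
    have h0' := (D.hd_pos u v huv.ne').2
    by_cases hvw' : w = v
    · rw [hvw']
    rcases Nat.eq_zero_or_pos (hd u w) with hz | hz
    · omega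
    rcases D.hd_eq u w hz.ne' with ⟨rfl, h1⟩ | ⟨q, hq, h1⟩
    · omega
    rcases lt_or_ge q v with hlt | hge
    · have := D.hd_ge u v q (D.xt_of_hd hvw hq hlt)
      omega
    · have := ih q (D.xt_lt w q hq).2 (D.hd_down hvw hq hge)
      omega

theorem hd_lip (D : Dec G k pc par gd xt hd) {t p q : ℕ} (hpq : xt p q ≠ 0)
    (hq : hd q q = n + 1) (htq : 0 < hd t q) : hd t p ≤ hd t q ∧ hd t q ≤ hd t p + 1 :=
  ⟨D.hd_anti htq (D.hd_up hpq (by omega)), D.hd_ge t p q hpq⟩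

end Dec

/-! ### Descending chains in windows of given widths have bounded length. -/

/-- A chain of pieces, each deeper in the tree, whose levels stay in windows of widths `R i`. -/
def Chain (hd : ℕ → ℕ → ℕ) (R u a : ℕ → ℕ) (p m : ℕ) : Prop :=
  ∀ i j, p ≤ i → i < j → j ≤ m →
    0 < hd (u i) (u j) ∧ u i < u j ∧ a i ≤ hd (u i) (u j) ∧ hd (u i) (u j) < a i + R i

/-- Downward induction on `c`, a lower bound for the number of neighbors in `Z` of every `u j`; `c ≥
k` is impossible. The level of `u j` below `u p` never increases and stays in a window of width `R
p`. On a stretch from `M` on where it is constant, each `u j` has a neighbor one level higher. All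
these neighbors are adjacent to `u M` and outside `Z`, so adding them to `Z` raises `c`. Only the
sizes of the intersections with `Z` are tracked, since different `u j` may use different pieces. -/
theorem exists_chain_bound_aux (k : ℕ) (R : ℕ → ℕ) (d : ℕ) :
    ∀ c p, k ≤ c + d → ∃ N, p ≤ N ∧ ∀ {n : ℕ} {G : SimpleGraph (Fin n)} {pc par : ℕ → ℕ}
      {gd xt hd : ℕ → ℕ → ℕ}, Dec G k pc par gd xt hd → ∀ (u a : ℕ → ℕ) (Z : Finset ℕ),
      Chain hd R u a p N → (∀ z ∈ Z, z < u p) →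
      ¬ ∀ j, p ≤ j → j ≤ N → c ≤ (Z ∩ nbrPieces (xt (u j)) (u j)).card := by
  induction d with
  | zero =>
    intro c p hc
    refine ⟨p, le_rfl, fun {n G pc par gd xt hd} D u a Z _ _ h => ?_⟩
    have h1 := h p le_rfl le_rfl
    have h2 := D.card_lt (u p)
    have h3 := Finset.card_le_card (Finset.inter_subset_right (s₁ := Z)
      (s₂ := nbrPieces (xt (u p)) (u p)))
    omega
  | succ d ihd =>
    intro c p hc
    -- By the index `M` the level has sunk more than `b` below the upper end of the window; `b = R
    -- p` is absurd.
    have key : ∀ b, ∃ M, p < M ∧ ∀ {n : ℕ} {G : SimpleGraph (Fin n)} {pc par : ℕ → ℕ}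
        {gd xt hd : ℕ → ℕ → ℕ}, Dec G k pc par gd xt hd → ∀ (u a : ℕ → ℕ) (Z : Finset ℕ),
        Chain hd R u a p M → (∀ z ∈ Z, z < u p) →
        (∀ j, p ≤ j → j ≤ M → c ≤ (Z ∩ nbrPieces (xt (u j)) (u j)).card) →
        hd (u p) (u M) + b < a p + R p := by
      intro b
      induction b with
      | zero =>
        exact ⟨p + 1, by omega, fun D u a Z hch _ _ => (hch p (p + 1) le_rfl (by omega) le_rfl).2.2.2⟩
      | succ b ihb =>
        obtain ⟨M, hpM, hM⟩ := ihb
        -- This `N` limits how long the level can stay constant after `M`.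
        obtain ⟨N, hMN, hN⟩ := ihd (c + 1) M (by omega)
        refine ⟨N + 1, by omega, fun {n G pc par gd xt hd} D u a Z hch hZ hc => ?_⟩
        have h1 := hM D u a Z (fun i j hi hij hj => hch i j hi hij (by omega)) hZ
          (fun j h1 h2 => hc j h1 (by omega))
        have hanti : ∀ i j, p < i → i < j → j ≤ N + 1 →
            hd (u p) (u j) ≤ hd (u p) (u i) := fun i j hi hij hj =>
          D.hd_anti (hch p i le_rfl hi (by omega)).1 (hch i j (by omega) hij hj).1
        have h2 := hanti M (N + 1) hpM (by omega) le_rfl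
        by_contra hcon
        have heq : hd (u p) (u (N + 1)) = hd (u p) (u M) := by omega
        have hconst : ∀ j, M ≤ j → j ≤ N + 1 → hd (u p) (u j) = hd (u p) (u M) := by
          intro j hj hj'
          rcases hj.eq_or_lt with rfl | hj
          · rfl
          · have h3 := hanti M j hpM hj hj'
            rcases hj'.eq_or_lt with rfl | hj'
            · exact heq
            · have := hanti j (N + 1) (by omega) hj' le_rfl
              omega
        obtain ⟨hpos, hlt, -, -⟩ := hch p M le_rfl hpM (by omega)
        have hne : ∀ j, M ≤ j → j ≤ N → c + 1 ≤ ((Z ∪ (nbrPieces (xt (u M)) (u M)).filter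
            fun z => hd (u p) z = hd (u p) (u M) + 1) ∩ nbrPieces (xt (u j)) (u j)).card := by
          intro j hj hj'
          have hj0 := hconst j hj (by omega)
          have hltj := (hch p j le_rfl (by omega) (by omega)).2.1
          rcases D.hd_eq (u p) (u j) (by omega) with ⟨h3, -⟩ | ⟨z, hz, h3⟩
          · omega
          have hzp : u p ≤ z := (D.hd_pos (u p) z (by omega)).2
          -- Were `z` not before `u M`, it would be a descendant of `u M`, and `hd_anti` would
          -- forbid its larger level.
          have hzM : xt (u M) z ≠ 0 := by
            rcases hj.eq_or_lt with rfl | hj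
            · exact hz
            have hMj := (hch M j (by omega) hj (by omega)).1
            refine D.xt_of_hd hMj hz ?_
            by_contra hge
            have := D.hd_anti hpos (D.hd_down hMj hz (by omega))
            omega
          have hzZ : z ∉ Z := fun h => by have := hZ z h; omega
          have hsub : insert z (Z ∩ nbrPieces (xt (u j)) (u j)) ⊆
              ((Z ∪ (nbrPieces (xt (u M)) (u M)).filter
              fun z => hd (u p) z = hd (u p) (u M) + 1) ∩ nbrPieces (xt (u j)) (u j)) := by
            intro y hy
            rcases Finset.mem_insert.1 hy with rfl | hy
            · refine Finset.mem_inter.2 ⟨Finset.mem_union_right _ (Finset.mem_filter.2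
                ⟨(D.mem_nbrPieces _ _).2 hzM, by omega⟩), (D.mem_nbrPieces _ _).2 hz⟩
            · exact Finset.mem_inter.2 ⟨Finset.mem_union_left _ (Finset.mem_inter.1 hy).1,
                (Finset.mem_inter.1 hy).2⟩
          have h4 := Finset.card_le_card hsub
          rw [Finset.card_insert_of_notMem (by simp [hzZ])] at h4
          have := hc j (by omega) (by omega)
          omega
        refine hN D u a _ (fun i j hi hij hj => hch i j (by omega) hij (by omega)) ?_ hne
        intro z hz
        rcases Finset.mem_union.1 hz with hz | hz
        · have := hZ z hz; omega
        · exact (D.xt_lt _ _ ((D.mem_nbrPieces _ _).1 (Finset.mem_filter.1 hz).1)).2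
    obtain ⟨M, hpM, hM⟩ := key (R p)
    refine ⟨M, hpM.le, fun D u a Z hch hZ hc => ?_⟩
    have h1 := hM D u a Z hch hZ hc
    have h2 := (hch p M le_rfl hpM le_rfl).2.2.1
    omega

theorem exists_chain_bound (k : ℕ) (R : ℕ → ℕ) : ∃ N, ∀ {n : ℕ} {G : SimpleGraph (Fin n)}
    {pc par : ℕ → ℕ} {gd xt hd : ℕ → ℕ → ℕ}, Dec G k pc par gd xt hd → ∀ u a : ℕ → ℕ,
    ¬ Chain hd R u a 0 N := by
  obtain ⟨N, -, h⟩ := exists_chain_bound_aux k R k 0 0 (by omega)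
  exact ⟨N, fun D u a hch => h D u a ∅ hch (by simp) (by simp)⟩

/-! ### Sparsity -/

-- An edge is charged to its end `v` in the later piece. The other end is in the piece of `v` or in
-- one of fewer than `k` adjacent pieces, on one of three levels of that piece's search, and each
-- level has at most `k` vertices of the piece. The factor `6` is `3` for the levels times `2` for
-- the orientations.
open Classical in
theorem Dec.card_adj_le {n k : ℕ} {G : SimpleGraph (Fin n)} {pc par : ℕ → ℕ}
    {gd xt hd : ℕ → ℕ → ℕ} (D : Dec G k pc par gd xt hd) :
    ((Finset.univ : Finset (Fin n × Fin n)).filter fun e : Fin n × Fin n => G.Adj e.1 e.2).card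
      ≤ 6 * (k * k) * n := by
  set A := (Finset.univ : Finset (Fin n × Fin n)).filter fun e : Fin n × Fin n => G.Adj e.1 e.2
  set B := A.filter fun e : Fin n × Fin n => pc e.2 ≤ pc e.1
  have hback : ∀ v : Fin n, ((Finset.range n).filter fun w => NAdj G v w ∧ pc w ≤ pc v).card
      ≤ 3 * (k * k) := by
    intro v
    have hsub : ((Finset.range n).filter fun w => NAdj G v w ∧ pc w ≤ pc v) ⊆
        (insert (pc v) (nbrPieces (xt (pc v)) (pc v))).biUnion fun q =>
          (Finset.range n).filter fun w => pc w = q ∧ gd q w ∈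
            Finset.Icc (gd q v - 1) (gd q v + 1) := by
      intro w hw
      simp only [Finset.mem_filter, Finset.mem_range] at hw
      obtain ⟨hwn, hadj, hle⟩ := hw
      have hgw := D.gd_self w hwn
      have hgv : 0 < gd (pc w) v := by
        rcases hle.eq_or_lt with h | h
        · rw [h]; exact D.gd_self v v.2
        · exact D.gd_mono _ _ _ (D.edge _ _ hadj h) (D.gd_self v v.2)
      have h1 := D.gd_lip _ _ _ hadj hgv hgw
      have h2 := D.gd_lip _ _ _ hadj.symm hgw hgv
      refine Finset.mem_biUnion.2 ⟨pc w, ?_, ?_⟩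
      · rcases hle.eq_or_lt with h | h
        · rw [h]; exact Finset.mem_insert_self _ _
        · exact Finset.mem_insert_of_mem ((D.mem_nbrPieces _ _).2 (D.edge _ _ hadj h))
      · simp only [Finset.mem_filter, Finset.mem_range, Finset.mem_Icc, true_and]
        exact ⟨hwn, by omega, h1⟩
    refine (Finset.card_le_card hsub).trans (Finset.card_biUnion_le.trans ?_)
    calc _ ≤ ∑ q ∈ insert (pc v) (nbrPieces (xt (pc v)) (pc v)), k * 3 := by
          refine Finset.sum_le_sum fun q hq => ?_
          have hq0 : 0 < q := by
            rcases Finset.mem_insert.1 hq with rfl | hq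
            · exact (D.pc_pos v v.2).1
            · exact (D.xt_lt _ _ ((D.mem_nbrPieces _ _).1 hq)).1
          refine (D.levels q _ hq0).trans (Nat.mul_le_mul_left _ ?_)
          rw [Nat.card_Icc]; omega
      _ ≤ _ := by
          rw [Finset.sum_const, smul_eq_mul]
          have h1 := Finset.card_insert_le (pc v) (nbrPieces (xt (pc v)) (pc v))
          have h2 := D.card_lt (pc v)
          nlinarith [Nat.mul_le_mul_right (k * 3) (show (insert (pc v)
            (nbrPieces (xt (pc v)) (pc v))).card ≤ k by omega)]
  have hB : B.card ≤ 3 * (k * k) * n := by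
    have : B ⊆ (Finset.univ : Finset (Fin n)).biUnion fun v =>
        ((Finset.univ : Finset (Fin n)).filter fun w : Fin n => NAdj G v w ∧ pc w ≤ pc v).image
          fun w => (v, w) := by
      intro e he
      simp only [B, A, Finset.mem_filter, Finset.mem_univ, true_and] at he
      simp only [Finset.mem_biUnion, Finset.mem_univ, true_and, Finset.mem_image,
        Finset.mem_filter]
      exact ⟨e.1, e.2, ⟨⟨e.1.2, e.2.2, he.1⟩, he.2⟩, rfl⟩
    refine (Finset.card_le_card this).trans (Finset.card_biUnion_le.trans ?_)
    calc _ ≤ ∑ _v : Fin n, 3 * (k * k) := by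
          refine Finset.sum_le_sum fun v _ => Finset.card_image_le.trans (le_trans ?_ (hback v))
          refine Finset.card_le_card_of_injOn Fin.val ?_ Fin.val_injective.injOn
          intro w hw
          simpa using hw
      _ = _ := by simp [mul_comm]
  have hAB : A ⊆ B ∪ B.image Prod.swap := by
    intro e he
    simp only [A, Finset.mem_filter, Finset.mem_univ, true_and] at he
    simp only [Finset.mem_union, Finset.mem_image, B, A, Finset.mem_filter, Finset.mem_univ,
      true_and]
    rcases le_total (pc e.2) (pc e.1) with h | h
    · exact .inl ⟨he, h⟩
    · exact .inr ⟨e.swap, ⟨he.symm, h⟩, by simp⟩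
  have h1 := (Finset.card_le_card hAB).trans (Finset.card_union_le _ _)
  have h2 : (B.image Prod.swap).card ≤ B.card := Finset.card_image_le
  calc A.card ≤ 3 * (k * k) * n + 3 * (k * k) * n := by omega
    _ = _ := by ring

/-! ### The strategy of Destroyer -/

/-- Clear the array `14`. -/
def clearLoop : Cmd := .loop 9 4 (.seqs [.op (.store 14 9 2), .op (.add 9 9 3)])

/-- Mark in the array `14` the pieces met by the current graph. -/
def markLoop : Cmd := .loop 9 0 (.seqs [.op (.load 10 3 9),
  .ite 2 10 (.seqs [.op (.load 10 7 9), .op (.store 14 10 3)]) .nop, .op (.add 9 9 3)])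

/-- Compute in the array `15` the topmost ancestors met by the current graph. -/
def topLoop : Cmd := .loop 9 4 (.seqs [.op (.load 10 5 9), .op (.load 11 15 10),
  .ite 2 11 (.op (.store 15 9 11))
    (.seqs [.op (.load 11 14 9), .op (.mul 11 11 9), .op (.store 15 9 11)]),
  .op (.add 9 9 3)])

/-- Write the layering. -/
def layerLoop : Cmd := .loop 9 0 (.seqs [.op (.load 10 7 9), .op (.load 11 15 10),
  .op (.mul 12 11 4),
  .ite 2 8 (.seqs [.op (.add 12 12 9), .op (.load 12 8 12)])
    (.seqs [.op (.add 12 12 10), .op (.load 12 10 12)]),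
  .op (.mul 13 11 7), .op (.add 13 13 12), .op (.store 4 9 13), .op (.add 9 9 3)])

/-- The move of Destroyer. -/
def moveCmd (k : ℕ) : Cmd := .seqs [.op (.load 5 6 2),
  .ite 2 5 (.seqs [.op (.sub 5 5 3), .op (.store 6 2 5)])
    (.seqs [.op (.add 4 0 3), .op (.ask 6 2), .op (.add 7 4 6), .op (.load 8 6 3),
      .op (.add 9 2 2), clearLoop, .op (.add 9 2 2), markLoop, .op (.store 15 2 2),
      .op (.add 9 3 2), topLoop, .op (.add 9 2 2), layerLoop,
      .ite 2 8 (.seqs [.op (.const 10 k), .op (.mul 10 10 6), .op (.store 6 2 10),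
        .op (.store 6 3 2)]) (.op (.store 6 3 3)),
      .op (.add 1 3 2)])]

/-- Lower registers and the arrays other than `b` agree. -/
def Same (m b : ℕ) (s s' : St) : Prop :=
  (∀ x < m, s'.reg x = s.reg x) ∧ ∀ a ≠ b, s'.arr a = s.arr a

theorem Same.refl (m b : ℕ) (s : St) : Same m b s s := ⟨fun _ _ => rfl, fun _ _ => rfl⟩

theorem Same.setReg {m b : ℕ} {s s' : St} (h : Same m b s s') {x v : ℕ} (hx : m ≤ x) :
    Same m b s (s'.setReg x v) :=
  ⟨fun y hy => by rw [St.setReg_reg, if_neg (by omega), h.1 y hy], h.2⟩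

theorem Same.setArr {m b : ℕ} {s s' : St} (h : Same m b s s') {i v : ℕ} :
    Same m b s (s'.setArr b i v) :=
  ⟨h.1, fun a ha => by rw [St.setArr_arr, if_neg ha, h.2 a ha]⟩

section

variable {r : ℕ → ℕ} {w n : ℕ} {s : St}

theorem clearLoop_wp (hs : Ok w s) (h4 : s.reg 4 = n + 1) (hw : n + 1 ≤ w) (h9 : s.reg 9 = 0) :
    Wp r w clearLoop s fun t s' => t ≤ 3 * (n + 1) + 2 ∧ Same 9 14 s s' ∧
      ∀ i ≤ n, s'.arr 14 i = 0 := by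
  refine Wp.loop (fun s' => Same 9 14 s s' ∧ s'.reg 9 ≤ n + 1 ∧ ∀ i < s'.reg 9, s'.arr 14 i = 0)
    (fun s' => 3 * (n + 1 - s'.reg 9)) hs ⟨.refl _ _ _, by omega, by simp [h9]⟩ ?_ ?_
  · rintro s' hs' ⟨hS, hle, h⟩ hlt
    have e4 := hS.1 4 (by omega)
    have h1 := hs'.one
    have h2 := hs'.zero
    refine .seqs_cons (.store hs' fun hs' => .seqs_cons
      (.add hs' (by decide) ?_ fun hs' => .seqs_nil hs' ?_))
    · simp [h1]; omega
    · refine ⟨⟨(hS.setArr).setReg le_rfl, ?_, ?_⟩, ?_⟩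
      · simp [h1]; omega
      · intro i hi
        simp [h1, h2, Function.update_apply] at hi ⊢
        intro hne
        exact h i (by omega)
      · simp [h1]; omega
  · rintro t s' hs' ⟨hS, hle, h⟩ hge hφ
    have e4 := hS.1 4 (by omega)
    exact ⟨by omega, hS, fun i hi => h i (by omega)⟩

theorem markLoop_wp {pc : ℕ → ℕ} {P : ℕ → Prop} (hs : Ok w s) (h0 : s.reg 0 = n) (hw : n + 1 ≤ w)
    (h9 : s.reg 9 = 0) (hpc : s.arr 7 = pc) (hP : ∀ v < n, 0 < s.arr 3 v ↔ P v)
    (h14 : ∀ i ≤ n, s.arr 14 i = 0) :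
    Wp r w markLoop s fun t s' => t ≤ 8 * n + 2 ∧ Same 9 14 s s' ∧
      ∀ i ≤ n, s'.arr 14 i ≤ 1 ∧ (0 < s'.arr 14 i ↔ ∃ v < n, P v ∧ pc v = i) := by
  refine Wp.loop (fun s' => Same 9 14 s s' ∧ s'.reg 9 ≤ n ∧ ∀ i ≤ n, s'.arr 14 i ≤ 1 ∧
      (0 < s'.arr 14 i ↔ ∃ v < s'.reg 9, P v ∧ pc v = i))
    (fun s' => 8 * (n - s'.reg 9)) hs
    ⟨.refl _ _ _, by omega, fun i hi => by simp [h14 i hi, h9]⟩ ?_ ?_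
  · rintro s' hs' ⟨hS, hle, h⟩ hlt
    have e0 := hS.1 0 (by omega)
    have e3 := hS.2 3 (by omega)
    have e7 := hS.2 7 (by omega)
    have h1 := hs'.one
    have h2 := hs'.zero
    have hv : s'.reg 9 < n := by omega
    refine .seqs_cons (.load hs' (by decide) fun hs' => .seqs_cons (.ite ?_ ?_))
    · intro hlt
      refine .seqs_cons (.load hs' (by decide) fun hs' => .seqs_cons (.store hs' fun hs' =>
        .seqs_nil hs' (.seqs_cons (.add hs' (by decide) ?_ fun hs' => .seqs_nil hs' ?_))))
      · simp [h1]; omega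
      · simp [h2, e3, hP _ hv] at hlt
        refine ⟨⟨((((hS.setReg ?_).setReg ?_).setArr).setReg ?_), ?_, ?_⟩, ?_⟩
        · omega
        · omega
        · omega
        · simp [h1]; omega
        · intro i hi
          simp only [h1, e7, hpc, St.setReg_reg, St.setReg_arr, St.setArr_arr, St.setArr_reg,
            Function.update_apply, if_true, Nat.reduceEqDiff, if_false, reduceIte]
          by_cases hi' : i = pc (s'.reg 9)
          · simp only [hi', if_true]
            exact ⟨le_rfl, iff_of_true one_pos ⟨_, Nat.lt_succ_self _, hlt, rfl⟩⟩
          · simp only [hi', if_false]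
            refine ⟨(h i hi).1, (h i hi).2.trans ⟨fun ⟨v, h3, h4⟩ => ⟨v, by omega, h4⟩,
              fun ⟨v, h3, h4, h5⟩ => ⟨v, ?_, h4, h5⟩⟩⟩
            have : v ≠ s'.reg 9 := by rintro rfl; exact hi' h5.symm
            omega
        · simp [h1]; omega
    · intro hge
      refine .nop hs' (.seqs_cons (.add hs' (by decide) ?_ fun hs' => .seqs_nil hs' ?_))
      · simp [h1]; omega
      · simp [h2, e3] at hge
        have hnP : ¬ P (s'.reg 9) := by rw [← hP _ hv]; omega
        refine ⟨⟨((hS.setReg ?_).setReg ?_), ?_, ?_⟩, ?_⟩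
        · omega
        · omega
        · simp [h1]; omega
        · intro i hi
          simp only [h1, St.setReg_reg, St.setReg_arr, reduceIte, Nat.reduceEqDiff]
          refine ⟨(h i hi).1, (h i hi).2.trans ⟨fun ⟨v, h3, h4⟩ => ⟨v, by omega, h4⟩,
            fun ⟨v, h3, h4, h5⟩ => ⟨v, ?_, h4, h5⟩⟩⟩
          have : v ≠ s'.reg 9 := by rintro rfl; exact hnP h4
          omega
        · simp [h1]; omega
  · rintro t s' hs' ⟨hS, hle, h⟩ hge hφ
    have e0 := hS.1 0 (by omega)
    have : s'.reg 9 = n := by omega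
    rw [this] at h
    exact ⟨by omega, hS, h⟩

/-- `top p` is the topmost ancestor of the piece `p` satisfying `H` (or `0`). -/
def IsTop (n : ℕ) (par : ℕ → ℕ) (H : ℕ → Prop) (top : ℕ → ℕ) : Prop :=
  top 0 = 0 ∧ ∀ p, 0 < p → p ≤ n →
    (0 < top (par p) → top p = top (par p)) ∧
    (top (par p) = 0 → (H p → top p = p) ∧ (¬ H p → top p = 0))

/-- Pieces are treated in increasing order and `par p < p`, so the entry of the parent is final when
it is read. Entry `0`, cleared beforehand, serves pieces without a parent. -/
theorem topLoop_wp {par : ℕ → ℕ} {H : ℕ → Prop} (hs : Ok w s) (h4 : s.reg 4 = n + 1)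
    (hw : n + 1 ≤ w) (h9 : s.reg 9 = 1) (hpar : s.arr 5 = par)
    (hparlt : ∀ p, 0 < p → par p < p)
    (h14 : ∀ i ≤ n, s.arr 14 i ≤ 1 ∧ (0 < s.arr 14 i ↔ H i)) (h15 : s.arr 15 0 = 0) :
    Wp r w topLoop s fun t s' => t ≤ 12 * (n + 1) + 2 ∧ Same 9 15 s s' ∧
      IsTop n par H (s'.arr 15) := by
  refine Wp.loop (fun s' => Same 9 15 s s' ∧ 0 < s'.reg 9 ∧ s'.reg 9 ≤ n + 1 ∧
      IsTop (s'.reg 9 - 1) par H (s'.arr 15))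
    (fun s' => 12 * (n + 1 - s'.reg 9)) hs
    ⟨.refl _ _ _, by omega, by omega, h15, by intros; omega⟩ ?_ ?_
  · rintro s' hs' ⟨hS, hpos, hle, hT⟩ hlt
    have e4 := hS.1 4 (by omega)
    have e5 := hS.2 5 (by omega)
    have e14 := hS.2 14 (by omega)
    have h1 := hs'.one
    have h2 := hs'.zero
    have hv : s'.reg 9 ≤ n := by omega
    have hext : ∀ x, ((0 < s'.arr 15 (par (s'.reg 9)) → x = s'.arr 15 (par (s'.reg 9))) ∧
        (s'.arr 15 (par (s'.reg 9)) = 0 → (H (s'.reg 9) → x = s'.reg 9) ∧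
          (¬ H (s'.reg 9) → x = 0))) →
        IsTop (s'.reg 9) par H (Function.update (s'.arr 15) (s'.reg 9) x) := by
      intro x hx
      refine ⟨by rw [Function.update_of_ne (by omega), hT.1], fun p hp hpn => ?_⟩
      have hlt' := hparlt p hp
      rw [Function.update_of_ne (show par p ≠ s'.reg 9 by omega)]
      rcases hpn.eq_or_lt with rfl | hpn
      · rw [Function.update_self]; exact hx
      · rw [Function.update_of_ne (by omega)]; exact hT.2 p hp (by omega)
    refine .seqs_cons (.load hs' (by decide) fun hs' => .seqs_cons (.load hs' (by decide)
      fun hs' => .seqs_cons (.ite ?_ ?_)))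
    · intro hlt
      simp [h2, e5, hpar] at hlt
      refine .store hs' fun hs' => .seqs_cons (.add hs' (by decide) ?_ fun hs' =>
        .seqs_nil hs' ?_)
      · simp [h1]; omega
      · refine ⟨⟨(((hS.setReg ?_).setReg ?_).setArr).setReg ?_, ?_, ?_, ?_⟩, ?_⟩
        · omega
        · omega
        · omega
        · simp [h1]
        · simp [h1]; omega
        · simpa [h1, e5, hpar] using hext _ ⟨fun _ => rfl, fun h => by omega⟩
        · simp [h1]; omega
    · intro hge
      simp [h2, e5, hpar] at hge
      obtain ⟨h14a, h14b⟩ := h14 _ hv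
      rw [← e14] at h14a h14b
      refine .seqs_cons (.load hs' (by decide) fun hs' => .seqs_cons (.mul hs' (by decide) ?_
        fun hs' => .seqs_cons (.store hs' fun hs' => .seqs_nil hs' (.seqs_cons
          (.add hs' (by decide) ?_ fun hs' => .seqs_nil hs' ?_)))))
      · simp; nlinarith
      · simp [h1]; omega
      · refine ⟨⟨(((((hS.setReg ?_).setReg ?_).setReg ?_).setReg ?_).setArr).setReg ?_, ?_, ?_, ?_⟩,
          ?_⟩
        · omega
        · omega
        · omega
        · omega
        · omega
        · simp [h1]
        · simp [h1]; omega
        -- Marks are `0` or `1`, so multiplying by the number of the piece replaces a case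
        -- distinction.
        · have := hext (s'.arr 14 (s'.reg 9) * s'.reg 9) ⟨fun h => by omega, fun _ =>
            ⟨fun h => ?_, fun h => ?_⟩⟩
          · simpa [h1, e5, hpar] using this
          · have h3 := h14b.2 h
            rw [show s'.arr 14 (s'.reg 9) = 1 by omega, one_mul]
          · have h3 := mt h14b.1 h
            rw [show s'.arr 14 (s'.reg 9) = 0 by omega, zero_mul]
        · simp [h1]; omega
  · rintro t s' hs' ⟨hS, hpos, hle, hT⟩ hge hφ
    have e4 := hS.1 4 (by omega)
    have : s'.reg 9 - 1 = n := by omega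
    rw [this] at hT
    exact ⟨by omega, hS, hT⟩

/-- The level of the vertex `v` in the search or in the tree below the piece `t`. -/
def levelOf (mode : ℕ) (pc : ℕ → ℕ) (gd hd : ℕ → ℕ → ℕ) (t v : ℕ) : ℕ :=
  if 0 < mode then gd t v else hd t (pc v)

/-- Row `u` of a table with `N` columns. -/
def tab (N : ℕ) (A : ℕ → ℕ) (u v : ℕ) : ℕ := if v < N then A (u * N + v) else 0

theorem tab_of_lt {N : ℕ} {A : ℕ → ℕ} {u v : ℕ} (h : v < N) : A (u * N + v) = tab N A u v := by
  rw [tab, if_pos h]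

-- The bound on `w` covers both the flat index into a table with rows of length `n + 1` and the
-- largest layer, at most `n * M + (n + 1)`.
set_option maxHeartbeats 800000 in
theorem layerLoop_wp {pc top : ℕ → ℕ} {gd hd : ℕ → ℕ → ℕ} {M : ℕ} (hs : Ok w s)
    (h0 : s.reg 0 = n) (h4 : s.reg 4 = n + 1) (h7 : s.reg 7 = M)
    (hw : n * M + (n + 1) * (n + 1) ≤ w) (h9 : s.reg 9 = 0) (hpc : s.arr 7 = pc)
    (hgd : tab (n + 1) (s.arr 8) = gd) (hhd : tab (n + 1) (s.arr 10) = hd) (htop : s.arr 15 = top)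
    (hgd_le : ∀ u v, gd u v ≤ n + 1) (hhd_le : ∀ u v, hd u v ≤ n + 1)
    (hpcn : ∀ v < n, pc v ≤ n) (htopn : ∀ p ≤ n, top p ≤ n) :
    Wp r w layerLoop s fun t s' => t ≤ 12 * n + 2 ∧ Same 9 4 s s' ∧
      ∀ v < n, s'.arr 4 v = top (pc v) * M + levelOf (s.reg 8) pc gd hd (top (pc v)) v := by
  refine Wp.loop (fun s' => Same 9 4 s s' ∧ s'.reg 9 ≤ n ∧ ∀ v < s'.reg 9,
      s'.arr 4 v = top (pc v) * M + levelOf (s.reg 8) pc gd hd (top (pc v)) v)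
    (fun s' => 12 * (n - s'.reg 9)) hs ⟨.refl _ _ _, by omega, by simp [h9]⟩ ?_ ?_
  · rintro s' hs' ⟨hS, hle, h⟩ hlt
    have e0 := hS.1 0 (by omega)
    have e4 := hS.1 4 (by omega)
    have e7 := hS.1 7 (by omega)
    have e8 := hS.1 8 (by omega)
    have a7 := hS.2 7 (by omega)
    have a8 := hS.2 8 (by omega)
    have a10 := hS.2 10 (by omega)
    have a15 := hS.2 15 (by omega)
    have h1 := hs'.one
    have h2 := hs'.zero
    have hv : s'.reg 9 < n := by omega
    set v := s'.reg 9 with hvdef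
    have hpv := hpcn v hv
    have htv := htopn _ hpv
    have htN : top (pc v) * (n + 1) ≤ n * (n + 1) := Nat.mul_le_mul_right _ htv
    have htM : top (pc v) * M ≤ n * M := Nat.mul_le_mul_right _ htv
    have hNN : (n + 1) * (n + 1) = n * (n + 1) + (n + 1) := by ring
    have hN1 : n + 1 ≤ (n + 1) * (n + 1) := Nat.le_mul_of_pos_left _ n.succ_pos
    have hext : ∀ x, x = top (pc v) * M + levelOf (s.reg 8) pc gd hd (top (pc v)) v →
        ∀ i ≤ v, Function.update (s'.arr 4) v x i =
          top (pc i) * M + levelOf (s.reg 8) pc gd hd (top (pc i)) i := by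
      rintro x rfl i hi
      rcases hi.lt_or_eq with hi | rfl
      · rw [Function.update_of_ne hi.ne, h i hi]
      · rw [Function.update_self]
    refine .seqs_cons (.load hs' (by decide) fun hs' => .seqs_cons (.load hs' (by decide)
      fun hs' => .seqs_cons (.mul hs' (by decide) ?_ fun hs' => .seqs_cons (.ite ?_ ?_))))
    · simp [a7, hpc, a15, htop, e4, h4, ← hvdef]; omega
    · intro hlt
      simp [h2, e8] at hlt
      refine .seqs_cons (.add hs' (by decide) ?_ fun hs' => .seqs_cons (.load hs' (by decide)
        fun hs' => .seqs_nil hs' (.seqs_cons (.mul hs' (by decide) ?_ fun hs' => .seqs_cons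
        (.add hs' (by decide) ?_ fun hs' => .seqs_cons (.store hs' fun hs' => .seqs_cons
        (.add hs' (by decide) ?_ fun hs' => .seqs_nil hs' ?_)))))))
      · simp [a7, hpc, a15, htop, e4, h4, ← hvdef]; omega
      · simp [a7, hpc, a15, htop, e7, h7, ← hvdef]; omega
      · simp [a7, hpc, a15, htop, e7, h7, e4, h4, a8, ← hvdef]
        rw [tab_of_lt (A := s.arr 8) (show v < n + 1 by omega), hgd]
        have := hgd_le (top (pc v)) v
        omega
      · simp [h1, ← hvdef]; omega
      · refine ⟨⟨?_, ?_, ?_⟩, ?_⟩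
        · refine Same.setReg (.setArr (.setReg (.setReg (.setReg (.setReg (.setReg (.setReg
            (.setReg hS ?_) ?_) ?_) ?_) ?_) ?_) ?_)) ?_ <;> omega
        · simp [h1, ← hvdef]; omega
        · simp [h1, a7, hpc, a15, htop, e7, h7, e4, h4, a8, ← hvdef]
          refine hext _ ?_
          rw [tab_of_lt (A := s.arr 8) (show v < n + 1 by omega), hgd, levelOf, if_pos hlt]
        · simp [h1, ← hvdef]; omega
    · intro hge
      simp [h2, e8] at hge
      refine .seqs_cons (.add hs' (by decide) ?_ fun hs' => .seqs_cons (.load hs' (by decide)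
        fun hs' => .seqs_nil hs' (.seqs_cons (.mul hs' (by decide) ?_ fun hs' => .seqs_cons
        (.add hs' (by decide) ?_ fun hs' => .seqs_cons (.store hs' fun hs' => .seqs_cons
        (.add hs' (by decide) ?_ fun hs' => .seqs_nil hs' ?_)))))))
      · simp [a7, hpc, a15, htop, e4, h4, ← hvdef]; omega
      · simp [a7, hpc, a15, htop, e7, h7, ← hvdef]; omega
      · simp [a7, hpc, a15, htop, e7, h7, e4, h4, a10, ← hvdef]
        rw [tab_of_lt (A := s.arr 10) (show pc v < n + 1 by omega), hhd]
        have := hhd_le (top (pc v)) (pc v)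
        omega
      · simp [h1, ← hvdef]; omega
      · refine ⟨⟨?_, ?_, ?_⟩, ?_⟩
        · refine Same.setReg (.setArr (.setReg (.setReg (.setReg (.setReg (.setReg (.setReg
            (.setReg hS ?_) ?_) ?_) ?_) ?_) ?_) ?_)) ?_ <;> omega
        · simp [h1, ← hvdef]; omega
        · simp [h1, a7, hpc, a15, htop, e7, h7, e4, h4, a10, ← hvdef]
          refine hext _ ?_
          rw [tab_of_lt (A := s.arr 10) (show pc v < n + 1 by omega), hhd, levelOf, if_neg (by omega)]
        · simp [h1, ← hvdef]; omega
  · rintro t s' hs' ⟨hS, hle, h⟩ hge hφ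
    have e0 := hS.1 0 (by omega)
    have : s'.reg 9 = n := by omega
    rw [this] at h
    exact ⟨by omega, hS, h⟩

/-- The tables of the decomposition are in the memory. -/
structure Holds (n : ℕ) (pc par : ℕ → ℕ) (gd hd : ℕ → ℕ → ℕ) (m : Memory) : Prop where
  par : m 5 = par
  pc : m 7 = pc
  gd : tab (n + 1) (m 8) = gd
  hd : tab (n + 1) (m 10) = hd

theorem Holds.congr {pc par : ℕ → ℕ} {gd hd : ℕ → ℕ → ℕ} {m m' : Memory}
    (h : Holds n pc par gd hd m) (h5 : m' 5 = m 5) (h7 : m' 7 = m 7) (h8 : m' 8 = m 8)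
    (h10 : m' 10 = m 10) : Holds n pc par gd hd m' :=
  ⟨h5.trans h.par, h7.trans h.pc, h8 ▸ h.gd, h10 ▸ h.hd⟩

/-- A positive counter means that deletions of the current phase are still due; register `1` is left
at `0`, the code of `delete`. -/
theorem moveCmd_wp_delete {k : ℕ} {pc par : ℕ → ℕ} {gd hd : ℕ → ℕ → ℕ} (hs : Ok w s)
    (h1 : s.reg 1 = 0) (hm : Holds n pc par gd hd s.arr) (hc : 0 < s.arr 6 0) :
    Wp r w (moveCmd k) s fun t s' => t ≤ 100 * (n + 1) ∧ Holds n pc par gd hd s'.arr ∧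
      s'.reg 1 = 0 ∧ s'.arr 6 0 = s.arr 6 0 - 1 ∧ s'.arr 6 1 = s.arr 6 1 := by
  have e1 := hs.one
  have e2 := hs.zero
  refine .seqs_cons (.load hs (by decide) fun hs' => .seqs_cons (.ite ?_ ?_))
  · intro _
    refine .seqs_cons (.sub hs' (by decide) fun hs' => .seqs_cons (.store hs' fun hs' =>
      .seqs_nil hs' (.seqs_nil hs' ?_)))
    refine ⟨by omega, hm.congr ?_ ?_ ?_ ?_, ?_, ?_, ?_⟩ <;> simp [e1, e2, h1]
  · intro h
    simp [e2] at h
    omega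

/-- The two kinds of restriction alternate: tree levels in mode `0`, search levels otherwise. After
the latter the counter becomes `k * r 0`, a bound for the vertices of one piece on `r 0` levels. -/
theorem moveCmd_wp_restrict {k : ℕ} {P : ℕ → Prop} {pc par : ℕ → ℕ} {gd hd : ℕ → ℕ → ℕ}
    (hs : Ok w s) (h0 : s.reg 0 = n) (hm : Holds n pc par gd hd s.arr) (hc : s.arr 6 0 = 0)
    (hP : ∀ v < n, 0 < s.arr 3 v ↔ P v) (hgd_le : ∀ u v, gd u v ≤ n + 1)
    (hhd_le : ∀ u v, hd u v ≤ n + 1) (hpcn : ∀ v < n, pc v ≤ n) (hpar : ∀ p, 0 < p → par p < p)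
    (hw : (n + 1) * (n + 1 + r 0) + (n + 1) * (n + 1) + k * r 0 + k ≤ w) :
    Wp r w (moveCmd k) s fun t s' => t ≤ 100 * (n + 1) ∧ Holds n pc par gd hd s'.arr ∧
      s'.reg 1 = 1 ∧ (s.arr 6 1 = 0 → s'.arr 6 0 = 0 ∧ s'.arr 6 1 = 1) ∧
      (0 < s.arr 6 1 → s'.arr 6 0 = k * r 0 ∧ s'.arr 6 1 = 0) ∧
      ∃ top, IsTop n par (fun p => ∃ v < n, P v ∧ pc v = p) top ∧ ∀ v < n,
        s'.arr 4 v = top (pc v) * (n + 1 + r 0) + levelOf (s.arr 6 1) pc gd hd (top (pc v)) v := by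
  have e1 := hs.one
  have e2 := hs.zero
  have hw1 : n + 1 + r 0 ≤ w := by nlinarith
  have hw2 : n + 1 ≤ w := by omega
  have hw3 : n * (n + 1 + r 0) + (n + 1) * (n + 1) ≤ w := by nlinarith
  generalize hMeq : n + 1 + r 0 = M at *
  refine .seqs_cons (.load hs (by decide) fun hs' => .seqs_cons (.ite ?_ ?_))
  · intro h
    simp [e2] at h
    omega
  intro _
  refine .seqs_cons (.add hs' (by decide) ?_ fun hs' => .seqs_cons (.ask hs' (by decide) ?_
    fun hs' => .seqs_cons (.add hs' (by decide) ?_ fun hs' => .seqs_cons (.load hs' (by decide)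
    fun hs' => .seqs_cons (.add hs' (by decide) ?_ fun hs' => .seqs_cons ?_)))))
  · simp [h0, e1]; omega
  · simp [e2]; omega
  · simp [h0, e1, e2]; omega
  · simp [e2]
  refine (clearLoop_wp (n := n) hs' (by simp [h0, e1]) hw2 (by simp [e2])).mono ?_
  rintro t1 s1 hs1 ⟨ht1, ⟨hr1, ha1⟩, h14⟩
  have r0 : s1.reg 0 = n := by rw [hr1 0 (by omega)]; simp [h0]
  have r4 : s1.reg 4 = n + 1 := by rw [hr1 4 (by omega)]; simp [h0, e1]
  have r6 : s1.reg 6 = r 0 := by rw [hr1 6 (by omega)]; simp [e2]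
  have r7 : s1.reg 7 = M := by rw [hr1 7 (by omega)]; simp [h0, e1, e2, hMeq]
  have r8 : s1.reg 8 = s.arr 6 1 := by rw [hr1 8 (by omega)]; simp [e1]
  have o1 := hs1.one
  have z1 := hs1.zero
  simp only [St.setReg_arr] at ha1
  refine .seqs_cons (.add hs1 (by decide) ?_ fun hs' => .seqs_cons ?_)
  · simp [z1]
  refine (markLoop_wp (n := n) (pc := pc) (P := P) hs' (by simp [r0]) hw2 (by simp [z1])
    (by simp [ha1, hm.pc]) (by simpa [ha1] using hP) (by simpa using h14)).mono ?_
  rintro t2 s2 hs2 ⟨ht2, ⟨hr2, ha2⟩, h14⟩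
  have o2 := hs2.one
  have z2 := hs2.zero
  simp only [St.setReg_arr] at ha2
  refine .seqs_cons (.store hs2 fun hs' => .seqs_cons (.add hs' (by decide) ?_ fun hs' =>
    .seqs_cons ?_))
  · simp [o2, z2]; omega
  refine (topLoop_wp (n := n) (par := par) (H := fun p => ∃ v < n, P v ∧ pc v = p) hs'
    (by simp [hr2, r4]) hw2 (by simp [o2, z2]) (by simp [ha2, ha1, hm.par]) hpar
    (by simpa using h14) (by simp [z2])).mono ?_
  rintro t3 s3 hs3 ⟨ht3, ⟨hr3, ha3⟩, htop⟩
  have o3 := hs3.one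
  have z3 := hs3.zero
  refine .seqs_cons (.add hs3 (by decide) ?_ fun hs' => .seqs_cons ?_)
  · simp [z3]
  have hm3 : Holds n pc par gd hd s3.arr := by
    refine hm.congr ?_ ?_ ?_ ?_ <;> · rw [ha3 _ (by decide)]; simp [ha2, ha1]
  have htopn : ∀ p ≤ n, s3.arr 15 p ≤ n := by
    intro p
    induction p using Nat.strong_induction_on with
    | _ p ih =>
      intro hp
      rcases Nat.eq_zero_or_pos p with rfl | hp0
      · rw [htop.1]; omega
      · have h3 := hpar p hp0
        have h4 := ih _ h3 (by omega)
        obtain ⟨h5, h6⟩ := htop.2 p hp0 hp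
        rcases Nat.eq_zero_or_pos (s3.arr 15 (par p)) with hz | hz
        · by_cases h7 : ∃ v < n, P v ∧ pc v = p
          · rw [(h6 hz).1 h7]; exact hp
          · rw [(h6 hz).2 h7]; omega
        · rw [h5 hz]; exact h4
  refine (layerLoop_wp (n := n) (M := M) (pc := pc) (gd := gd) (hd := hd) (top := s3.arr 15) hs'
    (by simp [hr3, hr2, r0]) (by simp [hr3, hr2, r4]) (by simp [hr3, hr2, r7]) hw3
    (by simp [z3]) (by simp [hm3.pc]) (by simp [hm3.gd]) (by simp [hm3.hd]) (by simp)
    hgd_le hhd_le hpcn htopn).mono ?_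
  rintro t4 s4 hs4 ⟨ht4, ⟨hr4, ha4⟩, hlam⟩
  have o4 := hs4.one
  have z4 := hs4.zero
  have hm4 : Holds n pc par gd hd s4.arr := by
    refine hm3.congr ?_ ?_ ?_ ?_ <;> · rw [ha4 _ (by decide)]; simp
  have r86 : s4.reg 8 = s.arr 6 1 := by simp [hr4, hr3, hr2, r8]
  have r66 : s4.reg 6 = r 0 := by simp [hr4, hr3, hr2, r6]
  have a6 : s4.arr 6 = s.arr 6 := by
    rw [ha4 _ (by decide)]; simp [ha3, ha2, ha1]
  have hlam' : ∀ v < n, s4.arr 4 v = s3.arr 15 (pc v) * M +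
      levelOf (s.arr 6 1) pc gd hd (s3.arr 15 (pc v)) v := by
    intro v hv
    rw [hlam v hv]; simp [hr3, hr2, r8]
  refine .seqs_cons (.ite ?_ ?_)
  · intro hlt
    simp only [z4, r86] at hlt
    refine .seqs_cons (.const hs4 (by decide) ?_ fun hs' => .seqs_cons (.mul hs' (by decide) ?_
      fun hs' => .seqs_cons (.store hs' fun hs' => .seqs_cons (.store hs' fun hs' =>
      .seqs_nil hs' (.seqs_cons (.add hs' (by decide) ?_ fun hs' => .seqs_nil hs'
      (.seqs_nil hs' ?_)))))))
    · omega
    · simp [r66]; omega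
    · simp [o4, z4]; omega
    refine ⟨by omega, hm4.congr ?_ ?_ ?_ ?_, ?_, ?_, ?_, s3.arr 15, htop, ?_⟩
    all_goals simp [o4, z4, r66]
    · omega
    · exact hlam'
  · intro hge
    simp only [z4, r86] at hge
    refine .store hs4 fun hs' => .seqs_cons (.add hs' (by decide) ?_ fun hs' =>
      .seqs_nil hs' (.seqs_nil hs' ?_))
    · simp [o4, z4]; omega
    refine ⟨by omega, hm4.congr ?_ ?_ ?_ ?_, ?_, ?_, ?_, s3.arr 15, htop, ?_⟩
    all_goals simp [o4, z4, a6, hc]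
    · omega
    · exact hlam'

end

/-! ### The strategy wins -/

section top

variable {n k : ℕ} {G : SimpleGraph (Fin n)} {pc par : ℕ → ℕ} {gd xt hd : ℕ → ℕ → ℕ}

theorem Dec.par_lt (D : Dec G k pc par gd xt hd) {p : ℕ} (hp : 0 < p) : par p < p := by
  rcases Nat.eq_zero_or_pos (par p) with h | h
  · omega
  · exact (D.xt_lt _ _ (D.par_eq p h.ne')).2

theorem Dec.gd_of_hd (D : Dec G k pc par gd xt hd) {u p v : ℕ} (h : 0 < hd u p)
    (hv : 0 < gd p v) : 0 < gd u v := by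
  induction p using Nat.strong_induction_on with
  | _ p ih =>
    rcases D.hd_eq u p h.ne' with ⟨rfl, h1⟩ | ⟨q, hq, h1⟩
    · exact hv
    · exact ih q (D.xt_lt p q hq).2 (by omega) (D.gd_mono p q v hq hv)

theorem IsTop.pos {H : ℕ → Prop} {top : ℕ → ℕ} (ht : IsTop n par H top) {p : ℕ} (hp : 0 < p)
    (hpn : p ≤ n) (h : H p) : 0 < top p := by
  obtain ⟨h1, h2⟩ := ht.2 p hp hpn
  rcases Nat.eq_zero_or_pos (top (par p)) with hz | hz
  · rw [(h2 hz).1 h]; exact hp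
  · rw [h1 hz]; exact hz

theorem IsTop.hd_pos {H : ℕ → Prop} {top : ℕ → ℕ} (ht : IsTop n par H top)
    (D : Dec G k pc par gd xt hd) (hH : ∀ p, H p → hd p p = n + 1) {p : ℕ} (hpn : p ≤ n)
    (h : 0 < top p) : H (top p) ∧ 0 < hd (top p) p := by
  induction p using Nat.strong_induction_on with
  | _ p ih =>
    rcases Nat.eq_zero_or_pos p with rfl | hp
    · rw [ht.1] at h; omega
    obtain ⟨h1, h2⟩ := ht.2 p hp hpn
    have hlt := D.par_lt hp
    rcases Nat.eq_zero_or_pos (top (par p)) with hz | hz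
    · by_cases hHp : H p
      · have h3 := (h2 hz).1 hHp
        rw [h3]
        exact ⟨hHp, by rw [hH p hHp]; omega⟩
      · rw [(h2 hz).2 hHp] at h; omega
    · obtain ⟨h3, h4⟩ := ih _ hlt (by omega) hz
      rw [h1 hz]
      have hne : par p ≠ 0 := fun h0 => by rw [h0, ht.1] at hz; omega
      exact ⟨h3, D.hd_up (D.par_eq p hne) h4⟩

/-- Either `q` is the parent of `p`, or chordality makes it adjacent to the parent, and induction
applies there; `p` inherits a positive `top` from its parent. -/
theorem IsTop.eq_of_xt {H : ℕ → Prop} {top : ℕ → ℕ} (ht : IsTop n par H top)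
    (D : Dec G k pc par gd xt hd) {p q : ℕ} (hpq : xt p q ≠ 0) (h : 0 < top q) :
    top p = top q := by
  induction p using Nat.strong_induction_on with
  | _ p ih =>
    obtain ⟨hq0, hqp⟩ := D.xt_lt p q hpq
    have hpn := D.xt_le p q hpq
    have hle := D.par_ge p q hpq
    obtain ⟨h1, -⟩ := ht.2 p (by omega) hpn
    rcases hle.eq_or_lt with heq | hlt
    · rw [heq] at h ⊢; exact h1 h
    · have h3 := ih _ (D.par_lt (by omega)) (D.chord p q _ hpq (D.par_eq p (by omega)) hlt)
      rw [h1 (by omega), h3]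

theorem Dec.level_lip (D : Dec G k pc par gd xt hd) {mode t : ℕ} {v w : ℕ} (hvw : NAdj G v w)
    (hv : 0 < hd t (pc v)) (hw : 0 < hd t (pc w)) :
    levelOf mode pc gd hd t w ≤ levelOf mode pc gd hd t v + 1 := by
  have hvn := hvw.1
  have hwn := hvw.2.1
  unfold levelOf
  split_ifs
  · exact D.gd_lip _ _ _ hvw (D.gd_of_hd hv (D.gd_self v hvn)) (D.gd_of_hd hw (D.gd_self w hwn))
  · rcases lt_trichotomy (pc v) (pc w) with h | h | h
    · have := D.hd_lip (D.edge w v hvw.symm h) (D.hd_self v hvn) hv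
      omega
    · rw [h]; omega
    · have := D.hd_lip (D.edge v w hvw h) (D.hd_self w hwn) hw
      omega

/-- Hence parts of the current graph with different topmost pieces may be shifted independently in a
layering. -/
theorem IsTop.eq_of_adj {H : ℕ → Prop} {top : ℕ → ℕ} (ht : IsTop n par H top)
    (D : Dec G k pc par gd xt hd) {v w : ℕ} (hvw : NAdj G v w) (hv : H (pc v)) (hw : H (pc w)) :
    top (pc v) = top (pc w) := by
  obtain ⟨h1, h2⟩ := D.pc_pos v hvw.1
  obtain ⟨h3, h4⟩ := D.pc_pos w hvw.2.1
  rcases lt_trichotomy (pc v) (pc w) with h | h | h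
  · exact (ht.eq_of_xt D (D.edge w v hvw.symm h) (ht.pos h1 h2 hv)).symm
  · rw [h]
  · exact ht.eq_of_xt D (D.edge v w hvw h) (ht.pos h3 h4 hw)

end top

/-- The memory of Destroyer between rounds: tables, counter `c` and mode `μ`. -/
structure Mem (n : ℕ) (pc par : ℕ → ℕ) (gd hd : ℕ → ℕ → ℕ) (w : ℕ) (m : Memory) (c μ : ℕ) :
    Prop where
  holds : Holds n pc par gd hd m
  ctr : m 6 0 = c
  mode : m 6 1 = μ
  le : ∀ a i, m a i ≤ w

theorem WinsWith.empty {P : Program} {T w n : ℕ} {G : OrderedGraph n} {t : ℕ} {r : ℕ → ℕ}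
    {m : Memory} : WinsWith P T w G t r ∅ m := by
  cases t with
  | zero => rfl
  | succ t => exact .inl rfl

theorem present_le {n w : ℕ} {S : Finset (Fin n)} {m : Memory} (hw : 1 ≤ w)
    (hm : ∀ a i, m a i ≤ w) (a i : ℕ) : present S m a i ≤ w := by
  simp only [present, Function.update_apply]
  split_ifs
  · simp only; split_ifs <;> omega
  · exact hm a i

theorem present_pos {n : ℕ} {S : Finset (Fin n)} {m : Memory} (i : ℕ) :
    0 < present S m 3 i ↔ ∃ v ∈ S, (v : ℕ) = i := by
  simp only [present, Function.update_self]
  split_ifs with h <;> simp [h]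

section rounds

variable {n k : ℕ} {G : SimpleGraph (Fin n)} {σ : Equiv.Perm (Fin n)} {pc par : ℕ → ℕ}
  {gd xt hd : ℕ → ℕ → ℕ} {w t : ℕ} {r : ℕ → ℕ} {S : Finset (Fin n)} {m : Memory}

theorem Holds.present {m : Memory} (h : Holds n pc par gd hd m) :
    Holds n pc par gd hd (present S m) :=
  h.congr rfl rfl rfl rfl

theorem wins_delete {c μ : ℕ} (hm : Mem n pc par gd hd w m (c + 1) μ)
    (hw : 1 ≤ w) (hn : n ≤ w)
    (h : ∀ v ∈ S, (∀ u ∈ S, σ.symm v ≤ σ.symm u) → ∀ m', Mem n pc par gd hd w m' c μ →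
      WinsWith (moveCmd k).program (100 * (n + 1) + 1) w ⟨G, σ⟩ t (tail r) (S.erase v) m') :
    WinsWith (moveCmd k).program (100 * (n + 1) + 1) w ⟨G, σ⟩ (t + 1) r S m := by
  right
  have hc : 0 < (present S m) 6 0 := by
    show 0 < m 6 0
    rw [hm.ctr]; omega
  obtain ⟨s', t', pc', hok, ⟨-, h1, h2, h3, h4⟩, h5⟩ := Cmd.program_runsTo (r := r) (n := n)
    (T := 100 * (n + 1) + 1) hw hn (present_le (S := S) hw hm.le)
    (fun hs => moveCmd_wp_delete (n := n) (k := k) hs (by simp)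
      hm.holds.present hc) (fun t s' h => by omega)
  have hact : (s'.at pc').action n = .delete := by
    simp only [Config.action, St.at, h2, if_true]
  refine ⟨_, h5, by rw [hact]; trivial, fun S' hS' => ?_⟩
  rw [hact] at hS'
  obtain ⟨v, hv, hmin, rfl⟩ := hS'
  refine h v hv hmin _ ⟨h1, ?_, ?_, hok.arr_le⟩
  · exact h3.trans (by show m 6 0 - 1 = c; rw [hm.ctr]; rfl)
  · exact h4.trans hm.mode

/-- The layer of a vertex is its topmost piece times `n + 1 + r 0`, plus a level of at most `n + 1`.
Different topmost pieces are therefore at least `r 0` layers apart and cannot share Preserver's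
interval. That `p` contains a vertex of `S` matters later: the windows of earlier phases then apply
to `p` itself. -/
theorem wins_restrict {μ : ℕ} (D : Dec G k pc par gd xt hd)
    (hm : Mem n pc par gd hd w m 0 μ)
    (hw : (n + 1) * (n + 1 + r 0) + (n + 1) * (n + 1) + k * r 0 + k ≤ w)
    (h : ∀ S' : Finset (Fin n), ∀ p a, S' ⊆ S → (∃ v ∈ S, pc v = p) →
      (∀ v ∈ S', 0 < hd p (pc v) ∧ a ≤ levelOf μ pc gd hd p v ∧
        levelOf μ pc gd hd p v < a + r 0) →
      ∀ m', Mem n pc par gd hd w m' (if μ = 0 then 0 else k * r 0) (if μ = 0 then 1 else 0) →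
      WinsWith (moveCmd k).program (100 * (n + 1) + 1) w ⟨G, σ⟩ t (tail r) S' m') :
    WinsWith (moveCmd k).program (100 * (n + 1) + 1) w ⟨G, σ⟩ (t + 1) r S m := by
  right
  have hw1 : 1 ≤ w := by nlinarith
  have hwn : n ≤ w := by nlinarith
  have hμ : (present S m) 6 1 = μ := hm.mode
  obtain ⟨s', t', pc', hok, ⟨-, h1, h2, h3, h4, top, htop, hlam⟩, h5⟩ := Cmd.program_runsTo
    (r := r) (n := n)
    (T := 100 * (n + 1) + 1) hw1 hwn (present_le (S := S) hw1 hm.le)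
    (fun hs => moveCmd_wp_restrict (n := n) (k := k) hs (by simp)
      hm.holds.present hm.ctr (fun v _ => present_pos (m := m) v) D.gd_le D.hd_le
      (fun v hv => (D.pc_pos v hv).2) (fun p hp => D.par_lt hp) hw) (fun t s' h => by omega)
  simp only at h3 h4 hlam
  rw [hμ] at h3 h4
  have hact : (s'.at pc').action n = .restrict (fun v => (s'.arr 4 v : ℤ)) := by
    simp only [Config.action, St.at, h2, one_ne_zero, if_false]
  have hHS : ∀ v ∈ S, ∃ v' < n, (∃ u ∈ S, (u : ℕ) = v') ∧ pc v' = pc v :=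
    fun v hv => ⟨v, v.2, ⟨v, hv, rfl⟩, rfl⟩
  have hH : ∀ p, (∃ v' < n, (∃ u ∈ S, (u : ℕ) = v') ∧ pc v' = p) → hd p p = n + 1 := by
    rintro _ ⟨v, hv, -, rfl⟩
    exact D.hd_self v hv
  have htopS : ∀ v ∈ S, (∃ u ∈ S, pc u = top (pc v)) ∧ 0 < hd (top (pc v)) (pc v) := by
    intro v hv
    obtain ⟨h6, h7⟩ := D.pc_pos v v.2
    obtain ⟨⟨v', -, ⟨u, hu, rfl⟩, h8⟩, h9⟩ := htop.hd_pos D hH h7 (htop.pos h6 h7 (hHS v hv))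
    exact ⟨⟨u, hu, h8⟩, h9⟩
  have hlam' : ∀ v : Fin n, s'.arr 4 v =
      top (pc v) * (n + 1 + r 0) + levelOf μ pc gd hd (top (pc v)) v := by
    intro v
    rw [hlam v v.2, hμ]
  have hlev : ∀ u v, levelOf μ pc gd hd u v ≤ n + 1 := by
    intro u v
    unfold levelOf
    split_ifs
    exacts [D.gd_le _ _, D.hd_le _ _]
  refine ⟨_, h5, ?_, fun S' hS' => ?_⟩
  · rw [hact]
    rintro ⟨v, hv⟩ ⟨u, hu⟩ hvu
    have hvu' : NAdj G v u := ⟨v.2, u.2, hvu⟩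
    have ht := htop.eq_of_adj D hvu' (hHS v hv) (hHS u hu)
    have h6 := (htopS v hv).2
    have h7 := (htopS u hu).2
    rw [← ht] at h7
    have h8 := D.level_lip (mode := μ) hvu' h6 h7
    have h9 := D.level_lip (mode := μ) hvu'.symm h7 h6
    simp only [hlam']
    rw [← ht, abs_le]
    push_cast
    constructor <;> linarith [(Nat.cast_le (α := ℤ)).2 h8, (Nat.cast_le (α := ℤ)).2 h9]
  · rw [hact] at hS'
    obtain ⟨a, l, hl, hS'⟩ := hS'
    have hmem' : Mem n pc par gd hd w (s'.at pc').arr (if μ = 0 then 0 else k * r 0)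
        (if μ = 0 then 1 else 0) := by
      refine ⟨h1, ?_, ?_, hok.arr_le⟩
      · split_ifs with h0
        · exact (h3 h0).1
        · exact (h4 (by omega)).1
      · split_ifs with h0
        · exact (h3 h0).2
        · exact (h4 (by omega)).2
    rcases S'.eq_empty_or_nonempty with rfl | hne
    · exact .empty
    -- The window is taken to start at the least surviving level instead of at the end of
    -- Preserver's interval.
    obtain ⟨v₀, hv₀, hmin⟩ := S'.exists_min_image
      (fun v => levelOf μ pc gd hd (top (pc v)) v) hne
    have hsub : S' ⊆ S := by rw [hS']; exact Finset.filter_subset _ _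
    have hdiff : ∀ u ∈ S', ∀ v ∈ S', s'.arr 4 u < s'.arr 4 v + r 0 := by
      intro u hu v hv
      rw [hS', Finset.mem_filter] at hu hv
      have h6 := hu.2.2
      have h7 := hv.2.1
      simp only at h6 h7
      omega
    have hnlt : ∀ u ∈ S', ∀ v ∈ S', ¬ top (pc u) < top (pc v) := by
      intro u hu v hv hlt
      have h6 := hdiff v hv u hu
      rw [hlam', hlam'] at h6
      have h7 := hlev (top (pc u)) u
      have h8 : (top (pc u) + 1) * (n + 1 + r 0) ≤ top (pc v) * (n + 1 + r 0) :=
        Nat.mul_le_mul_right _ hlt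
      have h9 : (top (pc u) + 1) * (n + 1 + r 0) =
        top (pc u) * (n + 1 + r 0) + (n + 1 + r 0) := by ring
      omega
    have heq : ∀ v ∈ S', top (pc v) = top (pc v₀) := fun v hv =>
      le_antisymm (not_lt.1 (hnlt _ hv₀ _ hv)) (not_lt.1 (hnlt _ hv _ hv₀))
    refine h S' (top (pc v₀)) (levelOf μ pc gd hd (top (pc v₀)) v₀) hsub
      (htopS v₀ (hsub hv₀)).1 (fun v hv => ?_) _ hmem'
    have h6 := hmin v hv
    have h7 := hdiff v hv v₀ hv₀
    have h8 := (htopS v (hsub hv)).2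
    rw [hlam', hlam', heq v hv] at h7
    rw [heq v hv] at h6 h8
    exact ⟨h8, h6, by omega⟩

/-- The ordering respects the pieces, so the vertices of the first piece `p` are deleted before all
others. Surplus deletions hit later vertices and do no harm. Writing the sequence as a shift of a
fixed `r₀` lets successive tails compose. -/
theorem wins_deletes (p : ℕ) (hσ : ∀ u v, σ.symm u ≤ σ.symm v → pc u ≤ pc v) (hw : 1 ≤ w)
    (hn : n ≤ w) (r₀ : ℕ → ℕ) (c : ℕ) :
    ∀ (j : ℕ) (S : Finset (Fin n)) (m : Memory), Mem n pc par gd hd w m c 0 →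
    (∀ v ∈ S, p ≤ pc v) → (S.filter fun v : Fin n => pc v = p).card ≤ c →
    (∀ S' ⊆ S, (∀ v ∈ S', p < pc v) → ∀ m', Mem n pc par gd hd w m' 0 0 →
      WinsWith (moveCmd k).program (100 * (n + 1) + 1) w ⟨G, σ⟩ t (fun i => r₀ (j + c + i)) S' m') →
    WinsWith (moveCmd k).program (100 * (n + 1) + 1) w ⟨G, σ⟩ (t + c) (fun i => r₀ (j + i)) S m := by
  induction c with
  | zero =>
    intro j S m hm hp hc h
    refine h S subset_rfl (fun v hv => lt_of_le_of_ne (hp v hv) fun hpv => ?_) m hm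
    have : v ∈ S.filter fun v : Fin n => pc v = p := Finset.mem_filter.2 ⟨hv, hpv.symm⟩
    rw [Finset.card_eq_zero.1 (Nat.le_zero.1 hc)] at this
    simp at this
  | succ c ih =>
    intro j S m hm hp hc h
    refine wins_delete hm hw hn fun v hv hmin m' hm' => ?_
    have e : tail (fun i => r₀ (j + i)) = fun i => r₀ (j + 1 + i) := by
      funext i
      show r₀ (j + (i + 1)) = _
      congr 1; ring
    rw [e]
    refine ih (j + 1) _ m' hm' (fun u hu => hp u (Finset.mem_of_mem_erase hu)) ?_ ?_
    · by_cases hpv : pc v = p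
      · rw [Finset.filter_erase, Finset.card_erase_of_mem (Finset.mem_filter.2 ⟨hv, hpv⟩)]
        omega
      -- The smallest vertex lies beyond `p`, so the piece `p` is already used up.
      · have : (S.erase v).filter (fun v : Fin n => pc v = p) = ∅ := by
          refine Finset.filter_eq_empty_iff.2 fun u hu hup => hpv ?_
          have := hσ v u (hmin u (Finset.mem_of_mem_erase hu))
          have := hp v hv
          omega
        rw [this]; simp
    · intro S' hS' hp' m'' hm''
      have := h S' (hS'.trans (Finset.erase_subset _ _)) hp' m'' hm''
      rwa [show j + 1 + c = j + (c + 1) by ring]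

/-- The rounds at which Destroyer restricts to levels of the tree. -/
def phaseStart (k : ℕ) (r : ℕ → ℕ) : ℕ → ℕ
  | 0 => 0
  | i + 1 => phaseStart k r i + 2 + k * r (phaseStart k r i + 1)

/-- Induction on the number `d` of phases left, carrying the pieces `u j` and window starts `a j` of
the finished phases. -/
theorem wins_from (D : Dec G k pc par gd xt hd)
    (hσ : ∀ u v, σ.symm u ≤ σ.symm v → pc u ≤ pc v) (hw0 : 1 ≤ w) (hn : n ≤ w) {N : ℕ}
    (hN : ∀ u a : ℕ → ℕ, ¬ Chain hd (fun i => r (phaseStart k r i)) u a 0 N)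
    (hw : ∀ i < phaseStart k r N, (n + 1) * (n + 1 + r i) + (n + 1) * (n + 1) + k * r i + k ≤ w)
    (d : ℕ) : ∀ (i t : ℕ) (S : Finset (Fin n)) (m : Memory) (u a : ℕ → ℕ), i + d = N →
    phaseStart k r i + t = phaseStart k r N →
    Mem n pc par gd hd w m 0 0 →
    (∀ j j', j < j' → j' < i → 0 < hd (u j) (u j') ∧ u j < u j' ∧ a j ≤ hd (u j) (u j') ∧
      hd (u j) (u j') < a j + r (phaseStart k r j)) →
    (∀ j < i, ∀ v ∈ S, 0 < hd (u j) (pc v) ∧ u j < pc v ∧ a j ≤ hd (u j) (pc v) ∧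
      hd (u j) (pc v) < a j + r (phaseStart k r j)) →
    WinsWith (moveCmd k).program (100 * (n + 1) + 1) w ⟨G, σ⟩ t
      (fun j => r (phaseStart k r i + j)) S m := by
  induction d with
  | zero =>
    intro i t S m u a hi ht hm hu hS
    rcases S.eq_empty_or_nonempty with rfl | ⟨v, hv⟩
    · exact .empty
    -- The piece of a surviving vertex would complete a chain of the forbidden length.
    refine (hN (Function.update u i (pc v)) a fun j j' _ hjj' hj' => ?_).elim
    rw [Function.update_of_ne (by omega)]
    rcases hj'.eq_or_lt with rfl | hj'
    · rw [show i = j' by omega, Function.update_self]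
      exact hS j (by omega) v hv
    · rw [Function.update_of_ne (by omega)]
      exact hu j j' hjj' (by omega)
  | succ d ih =>
    intro i t S m u a hi ht hm hu hS
    have hmono : Monotone (phaseStart k r) := monotone_nat_of_le_succ fun i => by
      simp only [phaseStart]; omega
    have h1 : phaseStart k r (i + 1) ≤ phaseStart k r N := hmono (by omega)
    have h1' := h1
    set q := phaseStart k r i with hq
    have hq1 : phaseStart k r (i + 1) = q + 2 + k * r (q + 1) := by rw [phaseStart]
    obtain ⟨t', rfl⟩ : ∃ t', t = t' + k * r (q + 1) + 1 + 1 :=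
      ⟨t - (k * r (q + 1) + 1 + 1), by omega⟩
    -- Tree levels: `p` and `b` become the piece and window start recorded for this phase.
    refine wins_restrict D hm (hw q (by omega)) fun S₁ p b hS₁ hp hlev m₁ hm₁ => ?_
    have e : tail (fun i => r (q + i)) = fun i => r (q + 1 + i) := by
      funext i
      show r (q + (i + 1)) = _
      congr 1; ring
    rw [e]
    simp only [if_true] at hm₁
    -- Search levels of `p'`, a topmost piece of what remains: this leaves at most `k * r (q + 1)`
    -- of its vertices.
    refine wins_restrict D hm₁ (hw (q + 1) (by omega)) fun S₂ p' b' hS₂ hp' hlev' m₂ hm₂ => ?_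
    have e : tail (fun i => r (q + 1 + i)) = fun i => r (q + 2 + i) := by
      funext i
      show r (q + 1 + (i + 1)) = _
      congr 1; ring
    rw [e]
    simp only [one_ne_zero, if_false, add_zero] at hm₂
    obtain ⟨v, hv, rfl⟩ := hp
    obtain ⟨v', hv', rfl⟩ := hp'
    simp only [levelOf, lt_irrefl, if_false, if_true, add_zero, zero_lt_one] at hlev hlev'
    refine wins_deletes (pc v') hσ hw0 hn r _ _ _ _ hm₂ ?_ ?_ ?_
    · exact fun u hu => (D.hd_pos _ _ (hlev' u hu).1.ne').2
    · have h2 := D.levels (pc v') (Finset.Ico b' (b' + r (q + 1))) (D.pc_pos v' v'.2).1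
      rw [Nat.card_Ico, Nat.add_sub_cancel_left] at h2
      refine le_trans ?_ h2
      refine Finset.card_le_card_of_injOn Fin.val ?_ Fin.val_injective.injOn
      intro u hu
      simp only [Finset.coe_filter, Set.mem_ofPred_eq] at hu
      have := hlev' u hu.1
      simp only [Finset.coe_filter, Set.mem_ofPred_eq, Finset.mem_range, Finset.mem_Ico]
      exact ⟨u.2, hu.2, this.2⟩
    · intro S₃ hS₃ hpc₃ m₃ hm₃
      have hpp' := (D.hd_pos _ _ (hlev v' hv').1.ne').2
      rw [← hq1]
      refine ih (i + 1) t' S₃ m₃ (Function.update u i (pc v)) (Function.update a i b)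
        (by omega) (by omega) hm₃ ?_ ?_
      · intro j j' hjj' hj'
        rw [Function.update_of_ne (show j ≠ i by omega), Function.update_of_ne (show j ≠ i by omega)]
        rcases (Nat.lt_succ_iff.1 hj').eq_or_lt with rfl | hj'
        · rw [Function.update_self]
          -- The piece recorded now contains the vertex `v` of `S`, so it obeys the earlier windows.
          exact hS j hjj' v hv
        · rw [Function.update_of_ne (by omega)]
          exact hu j j' hjj' hj'
      · intro j hj x hx
        have hx2 := hS₃ hx
        have hx1 := hS₂ hx2
        rcases (Nat.lt_succ_iff.1 hj).eq_or_lt with rfl | hj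
        · rw [Function.update_self, Function.update_self]
          have h3 := hlev x hx1
          have h4 := hpc₃ x hx
          exact ⟨h3.1, by omega, h3.2⟩
        · rw [Function.update_of_ne hj.ne, Function.update_of_ne hj.ne]
          exact hS j hj x (hS₁ hx1)

end rounds

/-- Destroyer wins in a number of rounds depending only on `k` and `r`. -/
theorem exists_wins (k : ℕ) (r : ℕ → ℕ) : ∃ t : ℕ, ∀ {n : ℕ} {G : SimpleGraph (Fin n)}
    {σ : Equiv.Perm (Fin n)} {pc par : ℕ → ℕ} {gd xt hd : ℕ → ℕ → ℕ} {w : ℕ} {m : Memory},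
    Dec G k pc par gd xt hd → (∀ u v, σ.symm u ≤ σ.symm v → pc u ≤ pc v) → 1 ≤ w → n ≤ w →
    (∀ i < t, (n + 1) * (n + 1 + r i) + (n + 1) * (n + 1) + k * r i + k ≤ w) →
    Mem n pc par gd hd w m 0 0 →
    WinsWith (moveCmd k).program (100 * (n + 1) + 1) w ⟨G, σ⟩ t r Finset.univ m := by
  obtain ⟨N, hN⟩ := exists_chain_bound k fun i => r (phaseStart k r i)
  refine ⟨phaseStart k r N, fun {n G σ pc par gd xt hd w m} D hσ h1 hn hw hm => ?_⟩
  have := wins_from D hσ h1 hn (hN D) hw N 0 (phaseStart k r N) Finset.univ m 0 0 (by omega)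
    (by simp [phaseStart]) hm (by intros; omega) (by intros; omega)
  simpa [phaseStart] using this

/-! ### Building the decomposition -/

/-- The data computed by the first algorithm. -/
structure Data where
  pc : ℕ → ℕ
  par : ℕ → ℕ
  lab : ℕ → ℕ
  que : ℕ → ℕ
  bp : ℕ → ℕ
  ord : ℕ → ℕ
  gd : ℕ → ℕ → ℕ
  xt : ℕ → ℕ → ℕ
  hd : ℕ → ℕ → ℕ
  cnt : ℕ
  tail : ℕ

/-- Change one entry of a table. -/
def setEntry (A : ℕ → ℕ → ℕ) (p y c : ℕ) : ℕ → ℕ → ℕ := fun u v => if u = p ∧ v = y then c else A u v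

theorem setEntry_self (A : ℕ → ℕ → ℕ) (p y c : ℕ) : setEntry A p y c p y = c := by simp [setEntry]

theorem setEntry_row (A : ℕ → ℕ → ℕ) (p y c : ℕ) :
    setEntry A p y c p = Function.update (A p) y c := by
  funext v; simp [setEntry, Function.update_apply]

theorem setEntry_of_ne (A : ℕ → ℕ → ℕ) {p u : ℕ} (y c : ℕ) (h : u ≠ p) :
    setEntry A p y c u = A u := by
  funext v; simp [setEntry, h]

/-- The search from `p - 1` reaches `y` from `x`. -/
def Data.push (p x y : ℕ) (D : Data) : Data :=
  { D with
    gd := setEntry D.gd p y (D.gd p x + 1)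
    bp := Function.update D.bp y x
    que := Function.update D.que D.tail y
    tail := D.tail + 1 }

/-- The search from `p - 1` meets the piece `q`. -/
def Data.link (p q : ℕ) (D : Data) : Data :=
  { D with
    xt := setEntry D.xt p q 1
    par := Function.update D.par p (max (D.par p) q)
    hd := fun u v => if v = p then max (D.hd u p) (D.hd u q - 1) else D.hd u v }

/-- The vertex `z` enters the piece `p` with the label `q`. -/
def Data.take (p q z : ℕ) (D : Data) : Data :=
  { D with
    pc := Function.update D.pc z p
    lab := Function.update D.lab z q
    ord := Function.update D.ord D.cnt z
    cnt := D.cnt + 1 }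

/-- The search from `p - 1` starts. -/
def Data.start (n p : ℕ) (D : Data) : Data :=
  { D with
    pc := Function.update D.pc (p - 1) p
    ord := Function.update D.ord D.cnt (p - 1)
    cnt := D.cnt + 1
    gd := setEntry D.gd p (p - 1) 1
    hd := setEntry D.hd p p (n + 1)
    que := Function.update D.que 0 (p - 1)
    tail := 1 }

/-- The invariants when the searches up to `m` are complete and that of `p` has begun. -/
structure Base {n : ℕ} (G : SimpleGraph (Fin n)) (m p : ℕ) (D : Data) : Prop where
  rows : Rows (NAdj G) m D.pc D.lab D.gd D.xt
  tree : Tree (n + 1) D.xt D.hd D.par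
  pc_le : ∀ v, D.pc v ≤ p
  pc_pos : ∀ v < m, 0 < D.pc v
  ord_lt : ∀ i < D.cnt, D.ord i < n ∧ 0 < D.pc (D.ord i)
  ord_inj : ∀ i j, i < D.cnt → j < D.cnt → D.ord i = D.ord j → i = j
  ord_surj : ∀ v, 0 < D.pc v → ∃ i < D.cnt, D.ord i = v
  ord_mono : ∀ i j, i ≤ j → j < D.cnt → D.pc (D.ord i) ≤ D.pc (D.ord j)
  hd_self : ∀ v, 0 < D.pc v → D.hd (D.pc v) (D.pc v) = n + 1
  hd_le : ∀ u v, D.hd u v ≤ n + 1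
  gd_le : ∀ u v, D.gd u v ≤ n + 1
  gd_zero : ∀ u v, p < u → D.gd u v = 0
  xt_zero : ∀ u v, p < u → D.xt u v = 0
  hd_zero : ∀ u v, p < v → D.hd u v = 0

/-- The invariants of the search from `p - 1`, with pending vertices `z`. -/
structure Search {n : ℕ} (G : SimpleGraph (Fin n)) (p : ℕ) (D : Data) (z : ℕ → Prop) : Prop where
  row : Row (NAdj G) p D.pc D.lab (D.gd p) (D.xt p) z
  p_pos : 0 < p
  root : D.pc (p - 1) = p
  que_lt : ∀ j < D.tail, D.que j < n ∧ 0 < D.gd p (D.que j)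
  que_inj : ∀ i j, i < D.tail → j < D.tail → D.que i = D.que j → i = j
  que_surj : ∀ v, 0 < D.gd p v → ∃ j < D.tail, D.que j = v
  que_mono : ∀ i j, i ≤ j → j < D.tail → D.gd p (D.que i) ≤ D.gd p (D.que j)
  gd_que : ∀ j < D.tail, D.gd p (D.que j) ≤ j + 1
  bp : ∀ v, 0 < D.gd p v → v ≠ p - 1 →
    NAdj G v (D.bp v) ∧ 0 < D.gd p (D.bp v) ∧ D.gd p (D.bp v) + 1 = D.gd p v

/-- The search from `p - 1` has taken care of the edge from `v` to `w`. -/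
def Data.Handled (p : ℕ) (D : Data) (v w : ℕ) : Prop :=
  (0 < D.gd p w ∧ D.gd p w ≤ D.gd p v + 1) ∨ (0 < D.pc w ∧ D.pc w < p ∧ D.xt p (D.pc w) ≠ 0)

theorem le_of_injOn {c n : ℕ} {f : ℕ → ℕ} (h : ∀ i < c, f i < n)
    (hinj : ∀ i j, i < c → j < c → f i = f j → i = j) : c ≤ n := by
  have := Finset.card_le_card_of_injOn (s := Finset.range c) (t := Finset.range n) f
    (fun i hi => by simpa using h i (by simpa using hi))
    (fun i hi j hj => hinj i j (by simpa using hi) (by simpa using hj))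
  simpa using this

section invariants

variable {n m p : ℕ} {G : SimpleGraph (Fin n)} {D : Data} {z : ℕ → Prop}

theorem Base.cnt_le (h : Base G m p D) : D.cnt ≤ n :=
  le_of_injOn (fun i hi => (h.ord_lt i hi).1) h.ord_inj

theorem Search.tail_le (h : Search G p D z) : D.tail ≤ n :=
  le_of_injOn (fun i hi => (h.que_lt i hi).1) h.que_inj

theorem Search.gd_lt (h : Search G p D z) {v : ℕ} (hv : 0 < D.gd p v) : v < n := by
  obtain ⟨j, hj, rfl⟩ := h.que_surj v hv
  exact (h.que_lt j hj).1

/-- The conditions on complete searches concern pieces up to `m < p`, which do not notice a vertex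
passing from no piece to `p`. The entry `hd p p` is required because `y` may be the first vertex of
its piece. -/
theorem Base.take_aux (h : Base G m p D) {y : ℕ} (hy : D.pc y = 0) (hyn : y < n) (hp : 0 < p)
    (hmp : m < p) (hself : D.hd p p = n + 1) (q : ℕ) : Base G m p (D.take p q y) := by
  have hne : ∀ i < D.cnt, D.ord i ≠ y := fun i hi e => by
    have := (h.ord_lt i hi).2; rw [e] at this; omega
  have hpcne : ∀ v, 0 < D.pc v → v ≠ y := fun v hv e => by rw [e] at hv; omega
  refine ⟨⟨fun u hu => ?_, fun u hu => ?_⟩, h.tree, fun v => ?_, fun v hv => ?_, fun i hi => ?_,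
    fun i j hi hj hij => ?_, fun v hv => ?_, fun i j hij hj => ?_, fun v hv => ?_, h.hd_le, h.gd_le,
    h.gd_zero, h.xt_zero, h.hd_zero⟩
  · have R := h.rows.row u hu
    have hpc : ∀ v, Function.update D.pc y p v = u → 0 < u → D.pc v = u ∧ v ≠ y := by
      intro v hv hu0
      by_cases e : v = y
      · rw [e, Function.update_self] at hv; omega
      · rw [Function.update_of_ne e] at hv; exact ⟨hv, e⟩
    have hpc' : ∀ v, 0 < u → D.pc v = u → Function.update D.pc y p v = u := by
      intro v hu0 hv
      rw [Function.update_of_ne (hpcne v (by omega)), hv]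
    refine ⟨fun v hv => ?_, fun v hv => ?_, fun v hu0 hv => ?_, R.g_par, fun v hu0 hv => ?_,
      R.x_lt, fun a ha => ?_, fun v hu0 hv => ?_, fun v w hu0 hv hw h1 h2 h3 h4 => ?_⟩
    · obtain ⟨h1, h2, h3⟩ := R.root v hv
      exact ⟨h1, hpc' _ h1 h2, h3⟩
    · show Function.update D.pc y p v = 0 ∨ u ≤ Function.update D.pc y p v
      by_cases e : v = y
      · rw [e, Function.update_self]; omega
      · rw [Function.update_of_ne e]; exact R.g_pc v hv
    · exact R.pc_g v hu0 (hpc v hv hu0).1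
    · rcases R.pc_par v hu0 (hpc v hv hu0).1 with h1 | ⟨w, h1, h2, h3⟩
      · exact .inl h1
      · exact .inr ⟨w, h1, .inl (hpc' w hu0 (by simpa using h2)), h3⟩
    · obtain ⟨b, c, h1, h2, h3⟩ := R.x_adj a ha
      obtain ⟨h4, h5⟩ := R.x_lt a ha
      refine ⟨b, c, h1, .inl (hpc' b (by omega) (by simpa using h2)), ?_⟩
      show Function.update D.pc y p c = a
      rw [Function.update_of_ne (hpcne c (by omega)), h3]
    · obtain ⟨h1, h2⟩ := hpc v hv hu0
      show v = u - 1 ∨ D.xt u (Function.update D.lab y q v) ≠ 0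
      rw [Function.update_of_ne h2]
      exact R.lab_x v hu0 h1
    · obtain ⟨h5, h6⟩ := hpc v hv hu0
      obtain ⟨h7, h8⟩ := hpc w hw hu0
      simp only [Data.take, Function.update_of_ne h6, Function.update_of_ne h8] at h3
      exact R.lab_inj v w hu0 h5 h7 h1 h2 h3 h4
  · intro v w _ hv hvw
    rcases h.rows.closed u hu v w trivial hv hvw with h1 | h1
    · exact .inl h1
    · right
      simp only [Data.take, Function.update_of_ne (hpcne w h1.1)]
      exact h1
  · simp only [Data.take, Function.update_apply]
    split_ifs
    exacts [le_rfl, h.pc_le v]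
  · simp only [Data.take, Function.update_apply]
    split_ifs
    exacts [hp, h.pc_pos v hv]
  · simp only [Data.take] at hi ⊢
    by_cases e : i = D.cnt
    · rw [e, Function.update_self, Function.update_self]; exact ⟨hyn, hp⟩
    · have hi' : i < D.cnt := by omega
      rw [Function.update_of_ne e, Function.update_of_ne (hne i hi')]
      exact h.ord_lt i hi'
  · simp only [Data.take] at hi hj hij
    by_cases e : i = D.cnt <;> by_cases e' : j = D.cnt
    · omega
    · rw [e, Function.update_self, Function.update_of_ne e'] at hij
      exact absurd hij.symm (hne j (by omega))
    · rw [e', Function.update_self, Function.update_of_ne e] at hij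
      exact absurd hij (hne i (by omega))
    · rw [Function.update_of_ne e, Function.update_of_ne e'] at hij
      exact h.ord_inj i j (by omega) (by omega) hij
  · simp only [Data.take] at hv ⊢
    by_cases e : v = y
    · exact ⟨D.cnt, by omega, by rw [Function.update_self, e]⟩
    · rw [Function.update_of_ne e] at hv
      obtain ⟨i, hi, h1⟩ := h.ord_surj v hv
      exact ⟨i, by omega, by rw [Function.update_of_ne hi.ne, h1]⟩
  · simp only [Data.take] at hj ⊢
    by_cases e' : j = D.cnt
    · rw [e', Function.update_self, Function.update_self]
      rw [Function.update_apply]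
      split_ifs
      exacts [le_rfl, h.pc_le _]
    · rw [Function.update_of_ne e', Function.update_of_ne (show i ≠ D.cnt by omega),
        Function.update_of_ne (hne j (by omega)), Function.update_of_ne (hne i (by omega))]
      exact h.ord_mono i j hij (by omega)
  · simp only [Data.take] at hv ⊢
    by_cases e : v = y
    · rw [e, Function.update_self]; exact hself
    · rw [Function.update_of_ne e] at hv ⊢
      exact h.hd_self v hv

theorem Base.push (h : Base G m p D) (hmp : m < p) {x y : ℕ} (hx : D.gd p x ≤ n) :
    Base G m p (D.push p x y) := by
  refine ⟨⟨fun u hu => ?_, fun u hu => ?_⟩, h.tree, h.pc_le, h.pc_pos, h.ord_lt, h.ord_inj,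
    h.ord_surj, h.ord_mono, h.hd_self, h.hd_le, fun u v => ?_, fun u v hu => ?_, h.xt_zero,
    h.hd_zero⟩
  · simp only [Data.push, setEntry_of_ne _ _ _ (show u ≠ p by omega)]
    exact h.rows.row u hu
  · simp only [Data.push, setEntry_of_ne _ _ _ (show u ≠ p by omega)]
    exact h.rows.closed u hu
  · simp only [Data.push, setEntry]
    split_ifs
    exacts [by omega, h.gd_le u v]
  · simp only [Data.push, setEntry_of_ne _ _ _ (show u ≠ p by omega)]
    exact h.gd_zero u v hu

/-- Column `p` of `hd` is a running maximum over the adjacencies found so far. It may change freely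
since no piece lists `p` as an earlier one yet, and column `q` stays fixed because `q < p`. -/
theorem Base.link (h : Base G m p D) (hmp : m < p) {q : ℕ} (hq : 0 < q) (hqp : q < p) :
    Base G m p (D.link p q) := by
  have T := h.tree
  have hxp : ∀ u v, D.xt u v ≠ 0 → u ≠ p → u < p ∧ v < p := by
    intro u v huv hup
    have h1 := (T.xt_lt u v huv).2
    have : ¬ p < u := fun h2 => huv (h.xt_zero u v h2)
    omega
  have hxt : ∀ u v, setEntry D.xt p q 1 u v ≠ 0 → (u = p ∧ v = q) ∨ D.xt u v ≠ 0 := by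
    intro u v
    simp only [setEntry]
    split_ifs with h1
    exacts [fun _ => .inl h1, .inr]
  have hxt' : ∀ u v, D.xt u v ≠ 0 → setEntry D.xt p q 1 u v ≠ 0 := by
    intro u v h1
    simp only [setEntry]
    split_ifs
    exacts [one_ne_zero, h1]
  refine ⟨⟨fun u hu => ?_, fun u hu => ?_⟩, ⟨fun u v huv => ?_, fun u v huv => ?_,
    fun u v a hva => ?_, fun u v huv => ?_, fun u v huv => ?_, fun u hu => ?_⟩, h.pc_le, h.pc_pos,
    h.ord_lt, h.ord_inj, h.ord_surj, h.ord_mono, fun v hv => ?_, fun u v => ?_, h.gd_le, h.gd_zero,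
    fun u v hu => ?_, fun u v hv => ?_⟩
  · simp only [Data.link, setEntry_of_ne _ _ _ (show u ≠ p by omega)]
    exact h.rows.row u hu
  · simp only [Data.link, setEntry_of_ne _ _ _ (show u ≠ p by omega)]
    exact h.rows.closed u hu
  · rcases hxt u v huv with ⟨rfl, rfl⟩ | h1
    · exact ⟨hq, hqp⟩
    · exact T.xt_lt u v h1
  · simp only [Data.link] at huv
    split_ifs at huv with e
    · subst e
      by_cases h1 : D.hd u v = 0
      · have := T.hd_pos u q (by omega)
        omega
      · exact T.hd_pos u v h1
    · exact T.hd_pos u v huv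
  · simp only [Data.link]
    have hap : a ≠ p := by
      rintro rfl
      rcases hxt v a hva with ⟨_, h2⟩ | h1
      · omega
      · have h2 := (T.xt_lt v a h1).2
        have := (hxp v a h1 (by omega)).1
        omega
    rw [if_neg hap]
    split_ifs with e
    · rcases hxt v a hva with ⟨-, rfl⟩ | h1
      · omega
      · have := T.hd_ge u v a h1
        rw [e] at this
        omega
    · rcases hxt v a hva with ⟨h1, -⟩ | h1
      · exact absurd h1 e
      · exact T.hd_ge u v a h1
  · simp only [Data.link] at huv ⊢
    split_ifs at huv ⊢ with e
    · subst e
      rcases le_total (D.hd u q - 1) (D.hd u v) with hle | hle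
      · rw [max_eq_left hle] at huv ⊢
        rcases T.hd_eq u v huv with h1 | ⟨a, h1, h2⟩
        · exact .inl h1
        · refine .inr ⟨a, hxt' _ _ h1, ?_⟩
          rw [if_neg (T.xt_lt v a h1).2.ne, h2]
      · rw [max_eq_right hle] at huv ⊢
        refine .inr ⟨q, by rw [setEntry_self]; exact one_ne_zero, ?_⟩
        rw [if_neg hqp.ne]; omega
    · rcases T.hd_eq u v huv with h1 | ⟨a, h1, h2⟩
      · exact .inl h1
      · refine .inr ⟨a, hxt' _ _ h1, ?_⟩
        rw [if_neg (hxp v a h1 e).2.ne, h2]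
  · simp only [Data.link, Function.update_apply]
    rcases hxt u v huv with ⟨rfl, rfl⟩ | h1
    · rw [if_pos rfl]; exact le_max_right _ _
    · have := T.par_ge u v h1
      split_ifs with e
      · subst e; exact this.trans (le_max_left _ _)
      · exact this
  · simp only [Data.link, Function.update_apply] at hu ⊢
    split_ifs at hu ⊢ with e
    · subst e
      rcases le_total q (D.par u) with hle | hle
      · rw [max_eq_left hle] at hu ⊢; exact hxt' _ _ (T.par_eq u hu)
      · rw [max_eq_right hle, setEntry_self]; exact one_ne_zero
    · exact hxt' _ _ (T.par_eq u hu)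
  · have h1 := h.hd_self v hv
    simp only [Data.link]
    split_ifs with e
    · rw [e] at h1 ⊢
      have := h.hd_le p q
      omega
    · exact h1
  · simp only [Data.link]
    have h1 := h.hd_le u p
    have h2 := h.hd_le u q
    split_ifs
    exacts [by omega, h.hd_le u v]
  · simp only [Data.link, setEntry_of_ne _ _ _ (show u ≠ p by omega)]
    exact h.xt_zero u v hu
  · simp only [Data.link]
    rw [if_neg (by omega)]
    exact h.hd_zero u v hv

/-- By `hstep` no queued level exceeds that of `x` by more than one, so appending `y` keeps the
queue sorted. The bound by position in the queue keeps all levels small. -/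
theorem Search.push (h : Search G p D fun _ => False) {x y k : ℕ} (hk : k < D.tail)
    (hx : D.que k = x) (hstep : ∀ j < D.tail, D.gd p (D.que j) ≤ D.gd p x + 1)
    (hxy : NAdj G x y) (hy : D.gd p y = 0) (hpy : D.pc y = 0) :
    Search G p (D.push p x y) fun _ => False := by
  have R := h.row
  have hgx : 0 < D.gd p x := hx ▸ (h.que_lt k hk).2
  have hne : ∀ v, 0 < D.gd p v → v ≠ y := fun v hv e => by rw [e] at hv; omega
  have hg : ∀ v, 0 < D.gd p v → Function.update (D.gd p) y (D.gd p x + 1) v = D.gd p v :=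
    fun v hv => Function.update_of_ne (hne v hv) _ _
  have hg' : ∀ v, 0 < Function.update (D.gd p) y (D.gd p x + 1) v → v = y ∨ 0 < D.gd p v := by
    intro v hv
    by_cases e : v = y
    · exact .inl e
    · rw [Function.update_of_ne e] at hv; exact .inr hv
  have hpcg : ∀ v, D.pc v = p → Function.update (D.gd p) y (D.gd p x + 1) v = D.gd p v :=
    fun v hv => hg v (R.pc_g v h.p_pos hv)
  have hquene : ∀ j < D.tail, D.que j ≠ y := fun j hj => hne _ (h.que_lt j hj).2
  have hbp : ∀ v, 0 < Function.update (D.gd p) y (D.gd p x + 1) v → v ≠ p - 1 →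
      NAdj G v (Function.update D.bp y x v) ∧
      0 < Function.update (D.gd p) y (D.gd p x + 1) (Function.update D.bp y x v) ∧
      Function.update (D.gd p) y (D.gd p x + 1) (Function.update D.bp y x v) + 1 =
        Function.update (D.gd p) y (D.gd p x + 1) v := by
    intro v hv hvp
    rcases hg' v hv with rfl | hv
    · rw [Function.update_self, Function.update_self, hg x hgx]
      exact ⟨hxy.symm, hgx, rfl⟩
    · rw [Function.update_of_ne (hne v hv), hg v hv]
      obtain ⟨h1, h2, h3⟩ := h.bp v hv hvp
      rw [hg _ h2]
      exact ⟨h1, h2, h3⟩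
  refine ⟨⟨fun v hv => ?_, fun v hv => ?_, fun v hp hv => ?_, fun v hv => ?_, fun v hp hv => ?_,
    R.x_lt, R.x_adj, R.lab_x, fun v w hp hv hw h1 h2 h3 h4 => ?_⟩, h.p_pos, h.root, fun j hj => ?_,
    fun i j hi hj hij => ?_, fun v hv => ?_, fun i j hij hj => ?_, fun j hj => ?_, fun v hv hvp => ?_⟩
  all_goals simp only [Data.push, setEntry_row] at *
  · obtain ⟨h1, h2, h3⟩ := R.root x hgx
    exact ⟨h1, h2, by rw [hg _ (by omega), h3]⟩
  · rcases hg' v hv with rfl | hv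
    · exact .inl hpy
    · exact R.g_pc v hv
  · rw [hpcg v hv]; exact R.pc_g v hp hv
  · by_cases e : v = p - 1
    · exact .inl e
    · obtain ⟨h1, h2, h3⟩ := hbp v hv e
      exact .inr ⟨_, h1, h2, h3⟩
  · rcases R.pc_par v hp hv with h1 | ⟨w, h1, h2, h3⟩
    · exact .inl h1
    · refine .inr ⟨w, h1, h2, ?_⟩
      rw [hpcg v hv, hpcg w (by simpa using h2), h3]
  · rw [hpcg v hv, hpcg w hw] at h4
    exact R.lab_inj v w hp hv hw h1 h2 h3 h4
  · by_cases e : j = D.tail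
    · rw [e, Function.update_self, Function.update_self]; exact ⟨hxy.2.1, by omega⟩
    · have hj' : j < D.tail := by omega
      rw [Function.update_of_ne e, hg _ (h.que_lt j hj').2]
      exact h.que_lt j hj'
  · by_cases e : i = D.tail <;> by_cases e' : j = D.tail
    · omega
    · rw [e, Function.update_self, Function.update_of_ne e'] at hij
      exact absurd hij.symm (hquene j (by omega))
    · rw [e', Function.update_self, Function.update_of_ne e] at hij
      exact absurd hij (hquene i (by omega))
    · rw [Function.update_of_ne e, Function.update_of_ne e'] at hij
      exact h.que_inj i j (by omega) (by omega) hij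
  · rcases hg' v hv with rfl | hv
    · exact ⟨D.tail, by omega, Function.update_self ..⟩
    · obtain ⟨j, hj, h1⟩ := h.que_surj v hv
      exact ⟨j, by omega, by rw [Function.update_of_ne hj.ne, h1]⟩
  · by_cases e' : j = D.tail
    · rw [e', Function.update_self, Function.update_self]
      by_cases e : i = D.tail
      · rw [e, Function.update_self, Function.update_self]
      · have hi' : i < D.tail := by omega
        rw [Function.update_of_ne e, hg _ (h.que_lt i hi').2]
        exact hstep i hi'
    · have hj' : j < D.tail := by omega
      have hi' : i < D.tail := by omega
      rw [Function.update_of_ne e', Function.update_of_ne (show i ≠ D.tail by omega),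
        hg _ (h.que_lt i hi').2, hg _ (h.que_lt j hj').2]
      exact h.que_mono i j hij hj'
  · by_cases e : j = D.tail
    · rw [e, Function.update_self, Function.update_self]
      have := h.gd_que k hk
      rw [hx] at this
      omega
    · have hj' : j < D.tail := by omega
      rw [Function.update_of_ne e, hg _ (h.que_lt j hj').2]
      exact h.gd_que j hj'
  · exact hbp v hv hvp

/-- The point of contact `x` need not be in the piece yet, hence it becomes pending. -/
theorem Search.link (h : Search G p D fun _ => False) {x y : ℕ} (hxy : NAdj G x y)
    (hy : 0 < D.pc y) (hyp : D.pc y < p) :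
    Search G p (D.link p (D.pc y)) fun v => v = x := by
  have R := h.row
  have hxt : ∀ v, Function.update (D.xt p) (D.pc y) 1 v ≠ 0 → v = D.pc y ∨ D.xt p v ≠ 0 := by
    intro v hv
    by_cases e : v = D.pc y
    · exact .inl e
    · rw [Function.update_of_ne e] at hv; exact .inr hv
  refine ⟨⟨R.root, R.g_pc, R.pc_g, R.g_par, fun v hp hv => ?_, fun q hq => ?_, fun q hq => ?_,
    fun v hp hv => ?_, R.lab_inj⟩, h.p_pos, h.root, h.que_lt, h.que_inj, h.que_surj, h.que_mono,
    h.gd_que, h.bp⟩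
  all_goals simp only [Data.link, setEntry_row] at *
  · rcases R.pc_par v hp hv with h1 | ⟨w, h1, h2, h3⟩
    · exact .inl h1
    · exact .inr ⟨w, h1, .inl (by simpa using h2), h3⟩
  · rcases hxt q hq with rfl | hq
    · exact ⟨hy, hyp⟩
    · exact R.x_lt q hq
  · rcases hxt q hq with rfl | hq
    · exact ⟨x, y, hxy, .inr rfl, rfl⟩
    · obtain ⟨a, b, h1, h2, h3⟩ := R.x_adj q hq
      exact ⟨a, b, h1, .inl (by simpa using h2), h3⟩
  · rcases R.lab_x v hp hv with h1 | h1
    · exact .inl h1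
    · right
      rw [Function.update_apply]
      split_ifs
      exacts [one_ne_zero, h1]

/-- The search parent of `y` becomes pending in its place. As the walk moves towards the root,
vertices already labelled `q` are farther away; this is `hlab`, and it preserves `lab_inj`. -/
theorem Search.take {y q : ℕ} (h : Search G p D fun v => v = y) (hy : D.pc y = 0)
    (hg : 0 < D.gd p y) (hq : D.xt p q ≠ 0)
    (hlab : ∀ v, D.pc v = p → v ≠ p - 1 → D.lab v = q → D.gd p y < D.gd p v) :
    Search G p (D.take p q y) fun v => v = D.bp y := by
  have R := h.row
  have hp := h.p_pos
  have hyp : y ≠ p - 1 := by rintro rfl; rw [h.root] at hy; omega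
  have hpc : ∀ v, Function.update D.pc y p v = p → v = y ∨ (v ≠ y ∧ D.pc v = p) := by
    intro v hv
    by_cases e : v = y
    · exact .inl e
    · rw [Function.update_of_ne e] at hv; exact .inr ⟨e, hv⟩
  have hpc' : ∀ v, (D.pc v = p ∨ v = y) → Function.update D.pc y p v = p := by
    rintro v (hv | rfl)
    · rw [Function.update_of_ne, hv]; rintro rfl; omega
    · rw [Function.update_self]
  have hqlt := R.x_lt
  refine ⟨⟨fun v hv => ?_, fun v hv => ?_, fun v _ hv => ?_, R.g_par, fun v _ hv => ?_, R.x_lt,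
    fun a ha => ?_, fun v _ hv => ?_, fun v w _ hv hw h1 h2 h3 h4 => ?_⟩, hp, ?_, h.que_lt,
    h.que_inj, h.que_surj, h.que_mono, h.gd_que, h.bp⟩
  all_goals simp only [Data.take] at *
  · obtain ⟨h1, h2, h3⟩ := R.root v hv
    exact ⟨h1, hpc' _ (.inl h2), h3⟩
  · by_cases e : v = y
    · rw [e, Function.update_self]; exact .inr le_rfl
    · rw [Function.update_of_ne e]; exact R.g_pc v hv
  · rcases hpc v hv with rfl | ⟨-, hv⟩
    · exact hg
    · exact R.pc_g v hp hv
  · rcases hpc v hv with rfl | ⟨-, hv⟩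
    · obtain ⟨h1, -, h3⟩ := h.bp v hg hyp
      exact .inr ⟨_, h1, .inr rfl, h3⟩
    · rcases R.pc_par v hp hv with h1 | ⟨w, h1, h2, h3⟩
      · exact .inl h1
      · exact .inr ⟨w, h1, .inl (hpc' w h2), h3⟩
  · obtain ⟨b, c, h1, h2, h3⟩ := R.x_adj a ha
    refine ⟨b, c, h1, .inl (hpc' b h2), ?_⟩
    rw [Function.update_of_ne, h3]
    rintro rfl
    have := (hqlt a ha).1
    omega
  · rcases hpc v hv with rfl | ⟨e, hv⟩
    · right; rw [Function.update_self]; exact hq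
    · rw [Function.update_of_ne e]; exact R.lab_x v hp hv
  · rcases hpc v hv with rfl | ⟨e, hv'⟩ <;> rcases hpc w hw with rfl | ⟨e', hw'⟩
    · rfl
    · rw [Function.update_self, Function.update_of_ne e'] at h3
      have := hlab w hw' h2 h3.symm
      omega
    · rw [Function.update_self, Function.update_of_ne e] at h3
      have := hlab v hv' h1 h3
      omega
    · rw [Function.update_of_ne e, Function.update_of_ne e'] at h3
      exact R.lab_inj v w hp hv' hw' h1 h2 h3 h4
  · exact hpc' _ (.inl h.root)

theorem Search.finish {y : ℕ} (h : Search G p D fun v => v = y) (hy : D.pc y = p) :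
    Search G p D fun _ => False := by
  have R := h.row
  refine ⟨⟨R.root, R.g_pc, R.pc_g, R.g_par, fun v hp hv => ?_, R.x_lt, fun q hq => ?_, R.lab_x,
    R.lab_inj⟩, h.p_pos, h.root, h.que_lt, h.que_inj, h.que_surj, h.que_mono, h.gd_que, h.bp⟩
  · rcases R.pc_par v hp hv with h1 | ⟨w, h1, h2 | rfl, h3⟩
    · exact .inl h1
    · exact .inr ⟨w, h1, .inl h2, h3⟩
    · exact .inr ⟨w, h1, .inl hy, h3⟩
  · obtain ⟨a, b, h1, h2 | rfl, h3⟩ := R.x_adj q hq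
    · exact ⟨a, b, h1, .inl h2, h3⟩
    · exact ⟨a, b, h1, .inl hy, h3⟩

theorem Base.start (h : Base G (p - 1) (p - 1) D) (hp : 0 < p) (hpn : p ≤ n)
    (hv : D.pc (p - 1) = 0) : Base G (p - 1) p (D.start n p) := by
  have T := h.tree
  have hxt : ∀ u v, D.xt u v ≠ 0 → u < p ∧ v < p := by
    intro u v huv
    have h1 := (T.xt_lt u v huv).2
    have : ¬ p - 1 < u := fun h2 => huv (h.xt_zero u v h2)
    omega
  have hhd : ∀ u, D.hd u p = 0 := fun u => h.hd_zero u p (by omega)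
  have hhd' : ∀ u v, v < p → setEntry D.hd p p (n + 1) u v = D.hd u v := by
    intro u v hvp
    simp [setEntry, hvp.ne]
  have h1 : Base G (p - 1) p { D with
      gd := setEntry D.gd p (p - 1) 1
      hd := setEntry D.hd p p (n + 1)
      que := Function.update D.que 0 (p - 1)
      tail := 1 } := by
    refine ⟨⟨fun u hu => ?_, fun u hu => ?_⟩, ⟨T.xt_lt, fun u v huv => ?_,
      fun u v a hva => ?_, fun u v huv => ?_, T.par_ge, T.par_eq⟩, fun v => (h.pc_le v).trans
      (by omega), h.pc_pos, h.ord_lt, h.ord_inj, h.ord_surj, h.ord_mono, fun v hv => ?_,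
      fun u v => ?_, fun u v => ?_, fun u v hu => ?_, fun u v hu => h.xt_zero u v (by omega),
      fun u v hv => ?_⟩
    all_goals try simp only
    · simp only [setEntry_of_ne _ _ _ (show u ≠ p by omega)]
      exact h.rows.row u hu
    · simp only [setEntry_of_ne _ _ _ (show u ≠ p by omega)]
      exact h.rows.closed u hu
    · simp only [setEntry] at huv
      split_ifs at huv with e
      · omega
      · exact T.hd_pos u v huv
    · obtain ⟨h2, h3⟩ := hxt v a hva
      rw [hhd' _ _ h2, hhd' _ _ h3]
      exact T.hd_ge u v a hva
    · simp only [setEntry] at huv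
      split_ifs at huv with e
      · left
        rw [e.1, e.2, setEntry_self]; exact ⟨rfl, rfl⟩
      · rcases T.hd_eq u v huv with h2 | ⟨a, h2, h3⟩
        · left
          refine ⟨h2.1, ?_⟩
          rw [setEntry, if_neg e, h2.2]
        · right
          obtain ⟨h4, h5⟩ := hxt v a h2
          exact ⟨a, h2, by rw [hhd' _ _ h4, hhd' _ _ h5, h3]⟩
    · have := h.pc_le v
      rw [hhd' _ _ (by omega)]
      exact h.hd_self v hv
    · simp only [setEntry]
      split_ifs
      exacts [le_rfl, h.hd_le u v]
    · simp only [setEntry]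
      split_ifs
      exacts [by omega, h.gd_le u v]
    · simp only [setEntry_of_ne _ _ _ (show u ≠ p by omega)]
      exact h.gd_zero u v (by omega)
    · simp only [setEntry]
      rw [if_neg (by omega)]
      exact h.hd_zero u v (by omega)
  -- `take_aux` also writes a label; writing the present one changes nothing.
  have h2 := h1.take_aux (y := p - 1) hv (by omega) hp (by omega) (setEntry_self _ _ _ _)
    (D.lab (p - 1))
  convert h2 using 1
  simp [Data.take, Data.start]

theorem Search.start (h : Base G (p - 1) (p - 1) D) (hp : 0 < p) (hpn : p ≤ n) :
    Search G p (D.start n p) fun _ => False := by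
  have hg0 : ∀ v, D.gd p v = 0 := fun v => h.gd_zero p v (by omega)
  have hx0 : ∀ v, D.xt p v = 0 := fun v => h.xt_zero p v (by omega)
  have hpc : ∀ v, Function.update D.pc (p - 1) p v = p → v = p - 1 := by
    intro v hv
    by_contra e
    rw [Function.update_of_ne e] at hv
    have := h.pc_le v
    omega
  have hg : ∀ v, 0 < Function.update (D.gd p) (p - 1) 1 v → v = p - 1 := by
    intro v hv
    by_contra e
    rw [Function.update_of_ne e, hg0] at hv
    omega
  refine ⟨⟨fun v hv => ?_, fun v hv => ?_, fun v _ hv => ?_, fun v hv => ?_, fun v _ hv => ?_,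
    fun q hq => ?_, fun q hq => ?_, fun v _ hv => ?_, fun v w _ hv hw h1 h2 h3 h4 => ?_⟩, hp, ?_,
    fun j hj => ?_, fun i j hi hj hij => ?_, fun v hv => ?_, fun i j hij hj => ?_, fun j hj => ?_,
    fun v hv hvp => ?_⟩
  all_goals simp only [Data.start, setEntry_row] at *
  · exact ⟨hp, Function.update_self .., Function.update_self ..⟩
  · rw [hg v hv, Function.update_self]; exact .inr le_rfl
  · rw [hpc v hv, Function.update_self]; exact one_pos
  · exact .inl (hg v hv)
  · exact .inl (hpc v hv)
  · exact absurd (hx0 q) hq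
  · exact absurd (hx0 q) hq
  · exact .inl (hpc v hv)
  · exact absurd (hpc v hv) h1
  · exact Function.update_self ..
  · obtain rfl : j = 0 := by omega
    rw [Function.update_self, Function.update_self]; omega
  · omega
  · exact ⟨0, one_pos, by rw [hg v hv, Function.update_self]⟩
  · obtain rfl : j = 0 := by omega
    obtain rfl : i = 0 := by omega
    exact le_rfl
  · obtain rfl : j = 0 := by omega
    rw [Function.update_self, Function.update_self]
  · exact absurd (hg v hv) hvp

theorem Search.base (h : Search G p D fun _ => False) (hb : Base G (p - 1) p D)
    (hdone : ∀ j < D.tail, ∀ w, NAdj G (D.que j) w → D.Handled p (D.que j) w) : Base G p p D := by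
  have hp := h.p_pos
  refine { hb with
    rows := ⟨fun u hu => ?_, fun u hu => ?_⟩
    pc_pos := fun v hv => ?_ }
  · rcases hu.eq_or_lt with rfl | hu
    · exact h.row
    · exact hb.rows.row u (by omega)
  · rcases hu.eq_or_lt with rfl | hu
    · intro v w _ hv hvw
      obtain ⟨j, hj, rfl⟩ := h.que_surj v hv
      exact hdone j hj w hvw
    · exact hb.rows.closed u (by omega)
  · by_cases e : v = p - 1
    · rw [e, h.root]; exact hp
    · exact hb.pc_pos v (by omega)

/-- The vertex `p - 1` was absorbed by an earlier piece; there is no piece `p`, and its search is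
empty. -/
theorem Base.skip (h : Base G (p - 1) (p - 1) D) (hp : 0 < p) (hv : 0 < D.pc (p - 1)) :
    Base G p p D := by
  have hg0 : ∀ v, D.gd p v = 0 := fun v => h.gd_zero p v (by omega)
  have hx0 : ∀ v, D.xt p v = 0 := fun v => h.xt_zero p v (by omega)
  have hpc : ∀ v, D.pc v ≠ p := fun v e => by have := h.pc_le v; omega
  refine { h with
    rows := ⟨fun u hu => ?_, fun u hu => ?_⟩
    pc_le := fun v => (h.pc_le v).trans (by omega)
    pc_pos := fun v hvp => ?_
    gd_zero := fun u v hu => h.gd_zero u v (by omega)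
    xt_zero := fun u v hu => h.xt_zero u v (by omega)
    hd_zero := fun u v hu => h.hd_zero u v (by omega) }
  · rcases hu.eq_or_lt with rfl | hu
    · refine ⟨fun v hv => ?_, fun v hv => ?_, fun v _ hv => ?_, fun v hv => ?_, fun v _ hv => ?_,
        fun q hq => ?_, fun q hq => ?_, fun v _ hv => ?_, fun v w _ hv => ?_⟩
      all_goals first
        | exact absurd hv (hpc _)
        | exact absurd (hx0 _) hq
        | (rw [hg0] at hv; omega)
    · exact h.rows.row u (by omega)
  · rcases hu.eq_or_lt with rfl | hu
    · intro v w _ hv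
      rw [hg0] at hv; omega
    · exact h.rows.closed u (by omega)
  · by_cases e : v = p - 1
    · rw [e]; exact hv
    · exact h.pc_pos v (by omega)

theorem Data.Handled.push {v w x y : ℕ} (h : D.Handled p v w) (hv : D.gd p v ≠ 0)
    (hy : D.gd p y = 0) : (D.push p x y).Handled p v w := by
  have hvy : v ≠ y := by rintro rfl; exact hv hy
  unfold Data.Handled at h ⊢
  simp only [Data.push, setEntry_row, Function.update_of_ne hvy]
  rcases h with h | h
  · have hwy : w ≠ y := by rintro rfl; omega
    rw [Function.update_of_ne hwy]
    exact .inl h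
  · exact .inr h

theorem Data.Handled.link {v w q : ℕ} (h : D.Handled p v w) : (D.link p q).Handled p v w := by
  unfold Data.Handled at h ⊢
  simp only [Data.link, setEntry_row]
  rcases h with h | h
  · exact .inl h
  · refine .inr ⟨h.1, h.2.1, ?_⟩
    rw [Function.update_apply]
    split_ifs
    exacts [one_ne_zero, h.2.2]

theorem Data.Handled.take {v w q y : ℕ} (h : D.Handled p v w) (hy : D.pc y = 0) :
    (D.take p q y).Handled p v w := by
  unfold Data.Handled at h ⊢
  simp only [Data.take]
  rcases h with h | h
  · exact .inl h
  · have hwy : w ≠ y := by rintro rfl; omega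
    rw [Function.update_of_ne hwy]
    exact .inr h

end invariants

/-! ### The program building the decomposition -/

section rules

variable {r : ℕ → ℕ} {w : ℕ} {s : St} {Q : ℕ → St → Prop} {x y z a : ℕ}

/-- Naming the computed value keeps register contents in closed form instead of nested terms;
likewise in the following rules. -/
theorem Wp.add' (v : ℕ) (hs : Ok w s) (hx : x ≠ 2 ∧ x ≠ 3) (hv : s.reg y + s.reg z = v)
    (hw : v ≤ w) (h : Ok w (s.setReg x v) → Q 1 (s.setReg x v)) :
    Wp r w (.op (.add x y z)) s Q := by
  subst hv; exact .add hs hx hw h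

theorem Wp.mul' (v : ℕ) (hs : Ok w s) (hx : x ≠ 2 ∧ x ≠ 3) (hv : s.reg y * s.reg z = v)
    (hw : v ≤ w) (h : Ok w (s.setReg x v) → Q 1 (s.setReg x v)) :
    Wp r w (.op (.mul x y z)) s Q := by
  subst hv; exact .mul hs hx hw h

theorem Wp.sub' (v : ℕ) (hs : Ok w s) (hx : x ≠ 2 ∧ x ≠ 3) (hv : s.reg y - s.reg z = v)
    (h : Ok w (s.setReg x v) → Q 1 (s.setReg x v)) :
    Wp r w (.op (.sub x y z)) s Q := by
  subst hv; exact .sub hs hx h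

theorem Wp.load' (v : ℕ) (hs : Ok w s) (hx : x ≠ 2 ∧ x ≠ 3) (hv : s.arr a (s.reg y) = v)
    (h : Ok w (s.setReg x v) → Q 1 (s.setReg x v)) :
    Wp r w (.op (.load x a y)) s Q := by
  subst hv; exact .load hs hx h

theorem Wp.store' (i v : ℕ) (hs : Ok w s) (hi : s.reg x = i) (hv : s.reg y = v)
    (h : Ok w (s.setArr a i v) → Q 1 (s.setArr a i v)) :
    Wp r w (.op (.store a x y)) s Q := by
  subst hi hv; exact .store hs h

end rules

/-- Add the piece `reg 14` to the levels of the piece `reg 5`. -/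
def hdLoop : Cmd := .loop 15 4 (.seqs [.op (.mul 16 15 4), .op (.add 17 16 14),
  .op (.load 17 10 17), .op (.sub 17 17 3), .op (.add 16 16 5), .op (.load 18 10 16),
  .ite 18 17 (.op (.store 10 16 17)) .nop, .op (.add 15 15 3)])

/-- Add the path from `reg 15` to the piece `reg 5`. -/
def walkLoop : Cmd := .loop 16 3 (.seqs [.op (.store 7 15 5), .op (.store 13 15 14),
  .op (.store 2 9 15), .op (.add 9 9 3), .op (.load 15 12 15), .op (.load 16 7 15)])

/-- A new adjacent piece `reg 14` is found from the vertex `reg 10`. -/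
def newPiece : Cmd := .seqs [.op (.store 9 16 3), .op (.load 15 5 5),
  .ite 15 14 (.op (.store 5 5 14)) .nop, .op (.add 15 3 2), hdLoop, .op (.add 15 10 2),
  .op (.load 16 7 15), walkLoop]

/-- A new vertex `reg 13` is found from the vertex `reg 10`. -/
def pushCmd : Cmd := .seqs [.op (.add 15 6 10), .op (.load 15 8 15), .op (.add 15 15 3),
  .op (.store 8 16 15), .op (.store 12 13 10), .op (.store 11 8 13), .op (.add 8 8 3)]

/-- Treat the next neighbor of `reg 10`. -/
def scanBody : Cmd := .seqs [.op (.load 13 1 11), .op (.add 11 11 3), .op (.add 16 6 13),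
  .op (.load 15 8 16), .ite 15 3 (.seqs [.op (.load 14 7 13), .ite 14 3 pushCmd
    (.seqs [.op (.add 16 6 14), .op (.load 15 9 16), .ite 15 3 newPiece .nop])]) .nop]

/-- Treat the next vertex of the queue. -/
def bfsBody : Cmd := .seqs [.op (.load 10 11 7), .op (.add 7 7 3), .op (.load 11 0 10),
  .op (.add 15 10 3), .op (.load 12 0 15), .loop 11 12 scanBody]

/-- The search from the vertex `reg 15`. -/
def searchCmd : Cmd := .seqs [.op (.mul 6 5 4), .op (.store 7 15 5), .op (.store 2 9 15),
  .op (.add 9 9 3), .op (.add 16 6 15), .op (.store 8 16 3), .op (.add 16 6 5),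
  .op (.store 10 16 4), .op (.store 11 2 15), .op (.add 7 2 2), .op (.add 8 3 2),
  .loop 7 8 bfsBody]

/-- The first algorithm. -/
def buildCmd : Cmd := .seqs [.op (.add 4 0 3), .op (.add 5 3 2), .loop 5 4 (.seqs
  [.op (.sub 15 5 3), .op (.load 16 7 15), .ite 16 3 searchCmd .nop, .op (.add 5 5 3)])]

/-- The data `D` are in the memory, next to the adjacency lists. -/
structure View (n : ℕ) (off adj : ℕ → ℕ) (s : St) (D : Data) : Prop where
  r0 : s.reg 0 = n
  r4 : s.reg 4 = n + 1
  cnt : s.reg 9 = D.cnt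
  tail : s.reg 8 = D.tail
  off : s.arr 0 = off
  adj : s.arr 1 = adj
  ord : s.arr 2 = D.ord
  par : s.arr 5 = D.par
  ctr : s.arr 6 = fun _ => 0
  pc : s.arr 7 = D.pc
  gd : tab (n + 1) (s.arr 8) = D.gd
  xt : tab (n + 1) (s.arr 9) = D.xt
  hd : tab (n + 1) (s.arr 10) = D.hd
  que : s.arr 11 = D.que
  bp : s.arr 12 = D.bp
  lab : s.arr 13 = D.lab

theorem tab_update {N : ℕ} {A : ℕ → ℕ} {p y c : ℕ} (hy : y < N) :
    tab N (Function.update A (p * N + y) c) = setEntry (tab N A) p y c := by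
  funext u v
  simp only [tab, setEntry, Function.update_apply]
  by_cases hv : v < N
  · have : u * N + v = p * N + y ↔ u = p ∧ v = y := by
      constructor
      · intro h
        have h1 : (u * N + v) / N = (p * N + y) / N := by rw [h]
        have h2 : (u * N + v) % N = (p * N + y) % N := by rw [h]
        rw [mul_comm u, mul_comm p, Nat.mul_add_div (by omega), Nat.mul_add_div (by omega),
          Nat.div_eq_of_lt hv, Nat.div_eq_of_lt hy] at h1
        rw [mul_comm u, mul_comm p, Nat.mul_add_mod, Nat.mul_add_mod, Nat.mod_eq_of_lt hv,
          Nat.mod_eq_of_lt hy] at h2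
        exact ⟨by omega, h2⟩
      · rintro ⟨rfl, rfl⟩; rfl
    simp only [hv, if_true, this]
  · rw [if_neg hv, if_neg (by omega), if_neg hv]

theorem index_le {n u v : ℕ} (hu : u ≤ n) (hv : v ≤ n) :
    u * (n + 1) + v ≤ (n + 1) * (n + 1) := by
  have := Nat.mul_le_mul_right (n + 1) hu
  have : (n + 1) * (n + 1) = n * (n + 1) + (n + 1) := by ring
  omega

section

variable {r : ℕ → ℕ} {w n p q : ℕ} {s : St}

/-- Only the rows `1, …, n` are visited. In all others `hd u q` is `0` by `hpos`, since `q < p ≤ n`,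
so the maximum would change nothing. -/
theorem hdLoop_wp {hd : ℕ → ℕ → ℕ} (hs : Ok w s) (hw : (n + 1) * (n + 1) ≤ w)
    (h4 : s.reg 4 = n + 1) (h5 : s.reg 5 = p) (h14 : s.reg 14 = q) (h15 : s.reg 15 = 1)
    (hpn : p ≤ n) (hqp : q < p) (hhd : tab (n + 1) (s.arr 10) = hd)
    (hpos : ∀ u v, hd u v ≠ 0 → 0 < u ∧ u ≤ v) :
    Wp r w hdLoop s fun t s' => t ≤ 10 * n + 2 ∧ Same 15 10 s s' ∧
      tab (n + 1) (s'.arr 10) =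
        fun u v => if v = p then max (hd u p) (hd u q - 1) else hd u v := by
  refine Wp.loop (fun s' => Same 15 10 s s' ∧ 0 < s'.reg 15 ∧ s'.reg 15 ≤ n + 1 ∧
      tab (n + 1) (s'.arr 10) =
        fun u v => if v = p ∧ u < s'.reg 15 then max (hd u p) (hd u q - 1) else hd u v)
    (fun s' => 10 * (n + 1 - s'.reg 15)) hs ⟨.refl _ _ _, by omega, by omega, ?_⟩ ?_ ?_
  · rw [hhd]
    funext u v
    split_ifs with h
    · have h1 : hd u q = 0 := by
        by_contra h2
        have := hpos u q h2
        omega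
      rw [h.1, h1]
      simp
    · rfl
  · rintro s' hs' ⟨hS, hu0, hun, hT⟩ hlt
    have e4 := hS.1 4 (by omega)
    have e5 := hS.1 5 (by omega)
    have e14 := hS.1 14 (by omega)
    have h1 := hs'.one
    generalize hu : s'.reg 15 = u at *
    have hun' : u ≤ n := by omega
    have i1 := index_le hun' (show q ≤ n by omega)
    have i2 := index_le hun' hpn
    have hq : s'.arr 10 (u * (n + 1) + q) = hd u q := by
      rw [tab_of_lt (A := s'.arr 10) (show q < n + 1 by omega), hT]
      simp [hqp.ne]
    have hp : s'.arr 10 (u * (n + 1) + p) = hd u p := by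
      rw [tab_of_lt (A := s'.arr 10) (show p < n + 1 by omega), hT]
      simp
    refine .seqs_cons (.mul' (u * (n + 1)) hs' (by decide) (by rw [hu, e4, h4]) (by omega)
      fun hs' => .seqs_cons (.add' (u * (n + 1) + q) hs' (by decide) (by simp [e14, h14])
      (by omega) fun hs' => .seqs_cons (.load' (hd u q) hs' (by decide) (by simp [hq])
      fun hs' => .seqs_cons (.sub' (hd u q - 1) hs' (by decide) (by simp [h1])
      fun hs' => .seqs_cons (.add' (u * (n + 1) + p) hs' (by decide) (by simp [e5, h5])
      (by omega) fun hs' => .seqs_cons (.load' (hd u p) hs' (by decide) (by simp [hp])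
      fun hs' => .seqs_cons (.ite ?_ ?_)))))))
    · intro hlt'
      simp at hlt'
      refine .store' (u * (n + 1) + p) (hd u q - 1) hs' (by simp) (by simp) fun hs' =>
        .seqs_cons (.add' (u + 1) hs' (by decide) (by simp [hu, h1]) (by nlinarith) fun hs' =>
        .seqs_nil hs' ?_)
      refine ⟨⟨?_, by simp, by simp; omega, ?_⟩, by simp; omega⟩
      · exact .setReg (.setArr (.setReg (.setReg (.setReg (.setReg (.setReg (.setReg hS
          (by omega)) (by omega)) (by omega)) (by omega)) (by omega)) (by omega))) (by omega)
      · simp only [St.setReg_arr, St.setArr_arr, if_true, St.setReg_reg]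
        rw [tab_update (by omega), hT]
        funext u' v
        simp only [setEntry]
        by_cases hv : v = p
        · subst hv
          by_cases hu' : u' = u
          · subst hu'; simp; omega
          · by_cases hlt2 : u' < u
            · simp [hu', hlt2, Nat.lt_succ_of_lt hlt2]
            · simp [hu', hlt2, show ¬ u' < u + 1 by omega]
        · simp [hv]
    · intro hge
      simp at hge
      refine .nop hs' (.seqs_cons (.add' (u + 1) hs' (by decide) (by simp [hu, h1])
        (by nlinarith) fun hs' => .seqs_nil hs' ?_))
      refine ⟨⟨?_, by simp, by simp; omega, ?_⟩, by simp; omega⟩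
      · exact .setReg (.setReg (.setReg (.setReg (.setReg (.setReg (.setReg hS
          (by omega)) (by omega)) (by omega)) (by omega)) (by omega)) (by omega)) (by omega)
      · simp only [St.setReg_arr, if_true, St.setReg_reg]
        rw [hT]
        funext u' v
        by_cases hv : v = p
        · subst hv
          by_cases hu' : u' = u
          · subst hu'; simp; omega
          · by_cases hlt2 : u' < u
            · simp [hlt2, Nat.lt_succ_of_lt hlt2]
            · simp [hlt2, show ¬ u' < u + 1 by omega]
        · simp [hv]
  · rintro t s' hs' ⟨hS, hu0, hun, hT⟩ hge hφ
    have e4 := hS.1 4 (by omega)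
    have hu : s'.reg 15 = n + 1 := by omega
    refine ⟨by omega, hS, ?_⟩
    rw [hT]
    funext u v
    by_cases hv : v = p
    · subst hv
      simp only [true_and, if_true]
      split_ifs with h
      · rfl
      · have h1 : hd u q = 0 := by
          by_contra h2
          have := hpos u q h2
          omega
        rw [h1]; simp
    · simp [hv]

variable {G : SimpleGraph (Fin n)} {off adj : ℕ → ℕ} {D : Data}

/-- The search in the data `D` has progressed to `D'`. -/
structure Ext (p : ℕ) (D D' : Data) : Prop where
  tail_le : D.tail ≤ D'.tail
  que : ∀ j < D.tail, D'.que j = D.que j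
  gd : ∀ v, D.gd p v ≠ 0 → D'.gd p v = D.gd p v
  handled : ∀ v w, D.gd p v ≠ 0 → D.Handled p v w → D'.Handled p v w

/-- Vertices on the way to the root have positive level, so they lie in no piece or in `p`, and the
walk stops in `p`. The level falls at each step and pays for the time. -/
theorem walkLoop_wp {z : ℕ} (hs : Ok w s) (hw : (n + 1) * (n + 1) ≤ w) (hV : View n off adj s D)
    (h5 : s.reg 5 = p) (h14 : s.reg 14 = q) (h15 : s.reg 15 = z) (h16 : s.reg 16 = D.pc z)
    (hB : Base G (p - 1) p D) (hSe : Search G p D fun v => v = z)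
    (hz : 0 < D.gd p z) (hq : D.xt p q ≠ 0)
    (hlab : ∀ v, D.pc v = p → v ≠ p - 1 → D.lab v = q → D.gd p z < D.gd p v) :
    Wp r w walkLoop s fun t s' => t ≤ 7 * (n + 1) + 2 ∧
      (∀ x < 15, x ≠ 9 → s'.reg x = s.reg x) ∧ ∃ D', View n off adj s' D' ∧
      Base G (p - 1) p D' ∧ Search G p D' (fun _ => False) ∧ D'.gd = D.gd ∧ D'.xt = D.xt ∧
      D'.que = D.que ∧ D'.tail = D.tail ∧
      ∀ v w, D.Handled p v w → D'.Handled p v w := by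
  refine Wp.loop (fun s' => (∀ x < 15, x ≠ 9 → s'.reg x = s.reg x) ∧ ∃ D', View n off adj s' D' ∧
      Base G (p - 1) p D' ∧ Search G p D' (fun v => v = s'.reg 15) ∧ D'.gd = D.gd ∧ D'.xt = D.xt ∧
      D'.que = D.que ∧ D'.tail = D.tail ∧ (∀ v w, D.Handled p v w → D'.Handled p v w) ∧
      s'.reg 16 = D'.pc (s'.reg 15) ∧ 0 < D.gd p (s'.reg 15) ∧
      ∀ v, D'.pc v = p → v ≠ p - 1 → D'.lab v = q → D.gd p (s'.reg 15) < D.gd p v)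
    (fun s' => 7 * D.gd p (s'.reg 15)) hs ?_ ?_ ?_
  · exact ⟨fun _ _ _ => rfl, D, hV, hB, by rwa [h15], rfl, rfl, rfl, rfl, fun _ _ h => h,
      by rw [h16, h15], by rwa [h15], by rwa [h15]⟩
  · rintro s' hs' ⟨hR, D', hV', hB', hS', hgd, hxt, hque, htail, hH, e16, hg, hlab'⟩ hlt
    have h1 := hs'.one
    have e5 := hR 5 (by omega) (by omega)
    have e14 := hR 14 (by omega) (by omega)
    generalize hy : s'.reg 15 = y at *
    have hpy : D'.pc y = 0 := by omega
    have hg' : 0 < D'.gd p y := by rwa [hgd]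
    have hyn := hS'.gd_lt hg'
    have hcnt := hB'.cnt_le
    have hp0 := hS'.p_pos
    have hyp : y ≠ p - 1 := by rintro rfl; rw [hS'.root] at hpy; omega
    obtain ⟨-, hb1, hb2⟩ := hS'.bp y hg' hyp
    have hself : D'.hd p p = n + 1 := by
      have := hB'.hd_self (p - 1) (by rw [hS'.root]; omega)
      rwa [hS'.root] at this
    have hnn : n + 1 ≤ (n + 1) * (n + 1) := by nlinarith
    have hS2 := hS'.take (q := q) hpy hg' (by rwa [hxt]) (by
      intro v h2 h3 h4
      rw [hgd]; exact hlab' v h2 h3 h4)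
    have hB2 := hB'.take_aux hpy hyn hp0 (by omega) hself q
    refine .seqs_cons (.store' y p hs' hy (by rw [e5, h5])
      fun hs' => .seqs_cons (.store' y q hs' (by simp [hy]) (by simp [e14, h14])
      fun hs' => .seqs_cons (.store' D'.cnt y hs' (by simp [hV'.cnt]) (by simp [hy])
      fun hs' => .seqs_cons (.add' (D'.cnt + 1) hs' (by decide) (by simp [hV'.cnt, h1]) (by omega)
      fun hs' => .seqs_cons (.load' (D'.bp y) hs' (by decide) (by simp [hy, hV'.bp])
      fun hs' => .seqs_cons (.load' ((D'.take p q y).pc (D'.bp y)) hs' (by decide)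
        (by simp [hV'.pc, Data.take])
      fun hs' => .seqs_nil hs' ?_))))))
    refine ⟨⟨fun x hx hx9 => ?_, D'.take p q y, ?_, hB2, ?_, hgd, hxt, hque, htail,
      fun v w' h => (hH v w' h).take hpy, ?_, ?_, ?_⟩, ?_⟩
    · simp [hx9, show x ≠ 15 by omega, show x ≠ 16 by omega]
      exact hR x hx hx9
    · constructor <;> simp [hV'.r0, hV'.r4, hV'.tail, hV'.off, hV'.adj, hV'.ord, hV'.par,
        hV'.ctr, hV'.pc, hV'.gd, hV'.xt, hV'.hd, hV'.que, hV'.bp, hV'.lab, Data.take]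
    · simpa using hS2
    · simp
    · simp
      rw [← hgd]; exact hb1
    · intro v h2 h3 h4
      simp only [St.setReg_reg, if_true, Nat.reduceEqDiff, if_false]
      simp only [Data.take] at h2 h4
      rw [← hgd]
      by_cases e : v = y
      · rw [e]; omega
      · rw [Function.update_of_ne e] at h2 h4
        have := hlab' v h2 h3 h4
        rw [← hgd] at this
        omega
    · rw [← hgd]
      simp only [St.setReg_reg, if_true, Nat.reduceEqDiff, if_false]
      omega
  · rintro t s' hs' ⟨hR, D', hV', hB', hS', hgd, hxt, hque, htail, hH, e16, hg, hlab'⟩ hge hφ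
    have h1 := hs'.one
    have hg' : 0 < D'.gd p (s'.reg 15) := by rwa [hgd]
    have hpc : D'.pc (s'.reg 15) = p := by
      have := hB'.pc_le (s'.reg 15)
      rcases hS'.row.g_pc _ hg' with h | h <;> omega
    refine ⟨?_, hR, D', hV', hB', hS'.finish hpc, hgd, hxt, hque, htail, hH⟩
    have := hB.gd_le p (s.reg 15)
    omega

end

section

variable {r : ℕ → ℕ} {w n p q x y : ℕ} {s : St}
variable {G : SimpleGraph (Fin n)} {off adj : ℕ → ℕ} {D : Data}

theorem nbrPieces_setEntry {xt : ℕ → ℕ → ℕ} (hqp : q < p) (hq : xt p q = 0) :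
    (nbrPieces (setEntry xt p q 1 p) p).card = (nbrPieces (xt p) p).card + 1 := by
  have : nbrPieces (setEntry xt p q 1 p) p = insert q (nbrPieces (xt p) p) := by
    ext a
    simp only [nbrPieces, setEntry_row, Finset.mem_filter, Finset.mem_range, Finset.mem_insert,
      Function.update_apply]
    by_cases h : a = q
    · simp [h, hqp]
    · simp [h]
  rw [this, Finset.card_insert_of_notMem (by simp [nbrPieces, hq])]

/-- The linear cost is paid by the increase of the number of adjacent pieces. -/
theorem newPiece_wp (hs : Ok w s) (hw : (n + 1) * (n + 1) ≤ w) (hV : View n off adj s D)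
    (h5 : s.reg 5 = p) (h10 : s.reg 10 = x) (h14 : s.reg 14 = D.pc y)
    (h16 : s.reg 16 = p * (n + 1) + D.pc y) (hpn : p ≤ n) (hB : Base G (p - 1) p D)
    (hSe : Search G p D fun _ => False) (hx : 0 < D.gd p x) (hxy : NAdj G x y)
    (hy : 0 < D.pc y) (hyp : D.pc y < p) (hq : D.xt p (D.pc y) = 0) :
    Wp r w newPiece s fun t s' => t ≤ 17 * (n + 1) + 20 ∧
      (∀ a < 15, a ≠ 9 → s'.reg a = s.reg a) ∧ ∃ D', View n off adj s' D' ∧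
      Base G (p - 1) p D' ∧ Search G p D' (fun _ => False) ∧ Ext p D D' ∧ D'.gd = D.gd ∧
      D'.tail = D.tail ∧ D'.Handled p x y ∧
      (nbrPieces (D'.xt p) p).card = (nbrPieces (D.xt p) p).card + 1 := by
  have h1 := hs.one
  have h2 := hs.zero
  have hp0 := hSe.p_pos
  have hnn : n + 1 ≤ (n + 1) * (n + 1) := by nlinarith
  have hxn := hSe.gd_lt hx
  set q := D.pc y with hqdef
  refine .seqs_cons (.store' (p * (n + 1) + q) 1 hs h16 h1 fun hs' => .seqs_cons
    (.load' (D.par p) hs' (by decide) (by simp [h5, hV.par]) fun hs' => .seqs_cons ?_))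
  have key : ∀ s1 : St, Ok w s1 → (∀ a < 15, s1.reg a = s.reg a) →
      s1.arr 5 = Function.update D.par p (max (D.par p) q) →
      s1.arr 9 = Function.update (s.arr 9) (p * (n + 1) + q) 1 →
      (∀ a, a ≠ 5 → a ≠ 9 → s1.arr a = s.arr a) →
      Wp r w (Cmd.seqs [.op (.add 15 3 2), hdLoop, .op (.add 15 10 2), .op (.load 16 7 15),
        walkLoop]) s1 fun t s' => t ≤ 17 * (n + 1) + 14 ∧
      (∀ a < 15, a ≠ 9 → s'.reg a = s.reg a) ∧ ∃ D', View n off adj s' D' ∧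
      Base G (p - 1) p D' ∧ Search G p D' (fun _ => False) ∧ Ext p D D' ∧ D'.gd = D.gd ∧
      D'.tail = D.tail ∧ D'.Handled p x y ∧
      (nbrPieces (D'.xt p) p).card = (nbrPieces (D.xt p) p).card + 1 := by
    intro s1 hs1 hr ha5 ha9 ha
    have o1 := hs1.one
    have z1 := hs1.zero
    refine .seqs_cons (.add' 1 hs1 (by decide) (by rw [o1, z1]) (by omega) fun hs' =>
      .seqs_cons ?_)
    refine (hdLoop_wp (n := n) (p := p) (q := q) (hd := D.hd) hs' hw (by simp [hr, hV.r4])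
      (by simp [hr, h5]) (by simp [hr, h14]) (by simp) hpn hyp (by simp [ha, hV.hd])
      hB.tree.hd_pos).mono ?_
    rintro t2 s2 hs2 ⟨ht2, ⟨hr2, ha2⟩, hT⟩
    have z2 := hs2.zero
    have hr2' : ∀ a < 15, s2.reg a = s.reg a := fun a h => by
      rw [hr2 a h]; simp [hr a h, show a ≠ 15 by omega]
    have hV2 : View n off adj s2 (D.link p q) := by
      constructor
      · rw [hr2' 0 (by omega), hV.r0]
      · rw [hr2' 4 (by omega), hV.r4]
      · rw [hr2' 9 (by omega), hV.cnt]; rfl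
      · rw [hr2' 8 (by omega), hV.tail]; rfl
      · rw [ha2 _ (by decide)]; simp [ha, hV.off]
      · rw [ha2 _ (by decide)]; simp [ha, hV.adj]
      · rw [ha2 _ (by decide)]; simp [ha, hV.ord, Data.link]
      · rw [ha2 _ (by decide)]; simp [ha5, Data.link]
      · rw [ha2 _ (by decide)]; simp [ha, hV.ctr]
      · rw [ha2 _ (by decide)]; simp [ha, hV.pc, Data.link]
      · rw [ha2 _ (by decide)]; simp [ha, hV.gd, Data.link]
      · rw [ha2 _ (by decide)]; simp [ha9, Data.link, tab_update (show q < n + 1 by omega), hV.xt]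
      · exact hT
      · rw [ha2 _ (by decide)]; simp [ha, hV.que, Data.link]
      · rw [ha2 _ (by decide)]; simp [ha, hV.bp, Data.link]
      · rw [ha2 _ (by decide)]; simp [ha, hV.lab, Data.link]
    have hB2 := hB.link (by omega) hy hyp
    have hS2 := hSe.link hxy hy hyp
    refine .seqs_cons (.add' x hs2 (by decide) (by rw [hr2' 10 (by omega), h10, z2, add_zero])
      (by omega) fun hs' => .seqs_cons (.load' (D.pc x) hs' (by decide)
      (by simp [hV2.pc, Data.link]) fun hs' => .seqs_cons ?_))
    refine (walkLoop_wp (p := p) (q := q) (z := x) (D := D.link p q) (G := G) (off := off)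
      (adj := adj) hs' hw ?_ (by simp [hr2', h5]) (by simp [hr2', h14]) (by simp)
      (by simp [Data.link]) hB2 hS2 hx ?_ ?_).mono ?_
    · constructor <;> simp [hV2.r0, hV2.r4, hV2.cnt, hV2.tail, hV2.off, hV2.adj, hV2.ord, hV2.par,
        hV2.ctr, hV2.pc, hV2.gd, hV2.xt, hV2.hd, hV2.que, hV2.bp, hV2.lab]
    · simp [Data.link, setEntry_self]
    -- The piece `q` was not listed before, so by `lab_x` no vertex carries its label.
    · intro v h3 h4 h5
      rcases hSe.row.lab_x v hp0 h3 with h6 | h6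
      · exact absurd h6 h4
      · rw [show D.lab v = q from h5] at h6
        exact absurd hq h6
    · rintro t3 s3 hs3 ⟨ht3, hr3, D', hV3, hB3, hS3, hgd, hxt, hque, htail, hH⟩
      refine .seqs_nil hs3 ⟨by omega, fun a h9 h10 => ?_, D', hV3, hB3, hS3, ⟨htail.symm.le,
        fun j _ => congrFun hque j, fun v _ => congrFun (congrFun hgd p) v,
        fun v w _ h => hH v w h.link⟩, hgd, htail, hH _ _ (.inr ⟨hy, hyp, ?_⟩), ?_⟩
      · rw [hr3 a h9 h10]
        simp [hr2' a h9, show a ≠ 15 by omega, show a ≠ 16 by omega]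
      · simp [Data.link, ← hqdef, setEntry_self]
      · rw [hxt]; exact nbrPieces_setEntry hyp hq
  have hreg : ∀ a < 15, (if a = 15 then D.par p else s.reg a) = s.reg a :=
    fun a ha => if_neg (by omega)
  refine .ite ?_ ?_
  · intro hlt
    simp [h14] at hlt
    refine .store' p q hs' (by simp [h5]) (by simp [h14]) fun hs' => (key _ hs' ?_ ?_ ?_ ?_).mono ?_
    · intro a ha; simpa using hreg a ha
    · simp [hV.par, max_eq_right hlt.le]
    · simp
    · intro a h3 h4; simp [h3, h4]
    · rintro t s' _ ⟨h3, h4⟩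
      exact ⟨by omega, h4⟩
  · intro hge
    simp [h14] at hge
    refine .nop hs' ((key _ hs' ?_ ?_ ?_ ?_).mono ?_)
    · intro a ha; simpa using hreg a ha
    · simp [hV.par, max_eq_left hge]
    · simp
    · intro a h3 h4; simp [h4]
    · rintro t s' _ ⟨h3, h4⟩
      exact ⟨by omega, h4⟩

theorem pushCmd_wp (hs : Ok w s) (hw : (n + 1) * (n + 1) ≤ w) (hV : View n off adj s D)
    (h6 : s.reg 6 = p * (n + 1)) (h10 : s.reg 10 = x) (h13 : s.reg 13 = y)
    (h16 : s.reg 16 = p * (n + 1) + y) (hpn : p ≤ n) (hx : x < n) (hy : y < n)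
    (hgx : D.gd p x ≤ n) (htail : D.tail ≤ n) :
    Wp r w pushCmd s fun t s' => t = 7 ∧
      (∀ a < 15, a ≠ 8 → s'.reg a = s.reg a) ∧ View n off adj s' (D.push p x y) := by
  have h1 := hs.one
  have i1 := index_le hpn hx.le
  have hnn : n + 1 ≤ (n + 1) * (n + 1) := by nlinarith
  have hg : s.arr 8 (p * (n + 1) + x) = D.gd p x := by
    rw [tab_of_lt (A := s.arr 8) (show x < n + 1 by omega), hV.gd]
  refine .seqs_cons (.add' (p * (n + 1) + x) hs (by decide) (by rw [h6, h10]) (by omega)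
    fun hs' => .seqs_cons (.load' (D.gd p x) hs' (by decide) (by simp [hg])
    fun hs' => .seqs_cons (.add' (D.gd p x + 1) hs' (by decide) (by simp [h1]) (by omega)
    fun hs' => .seqs_cons (.store' (p * (n + 1) + y) (D.gd p x + 1) hs' (by simp [h16]) (by simp)
    fun hs' => .seqs_cons (.store' y x hs' (by simp [h13]) (by simp [h10])
    fun hs' => .seqs_cons (.store' D.tail y hs' (by simp [hV.tail]) (by simp [h13])
    fun hs' => .seqs_cons (.add' (D.tail + 1) hs' (by decide) (by simp [hV.tail, h1]) (by omega)
    fun hs' => .seqs_nil hs' ⟨by omega, fun a ha ha8 => ?_, ?_⟩)))))))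
  · simp [ha8, show a ≠ 15 by omega]
  · constructor <;> simp [hV.r0, hV.r4, hV.cnt, hV.off, hV.adj, hV.ord, hV.par,
      hV.ctr, hV.pc, hV.gd, hV.xt, hV.hd, hV.que, hV.bp, hV.lab, Data.push,
      tab_update (show y < n + 1 by omega)]

/-- The adjacency lists in the memory are those of `G`. -/
structure IsInput (G : SimpleGraph (Fin n)) (off adj : ℕ → ℕ) : Prop where
  nbr : ∀ v w, NAdj G v w ↔ v < n ∧ ∃ i, off v ≤ i ∧ i < off (v + 1) ∧ adj i = w
  mono : ∀ v < n, off v ≤ off (v + 1)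

/-- Amortized time: a constant for the list entry and a linear amount for each newly listed piece.
-/
theorem scanBody_wp (hI : IsInput G off adj) (hs : Ok w s) (hw : (n + 1) * (n + 1) ≤ w)
    (hV : View n off adj s D) (h5 : s.reg 5 = p) (h6 : s.reg 6 = p * (n + 1)) (h10 : s.reg 10 = x)
    {i k : ℕ} (h11 : s.reg 11 = i) (hi0 : off x ≤ i) (hi1 : i < off (x + 1)) (hpn : p ≤ n)
    (hB : Base G (p - 1) p D)
    (hSe : Search G p D fun _ => False) (hk : k < D.tail) (hx : D.que k = x)
    (hstep : ∀ j < D.tail, D.gd p (D.que j) ≤ D.gd p x + 1) :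
    Wp r w scanBody s fun t s' =>
      (∀ a < 13, a ≠ 8 → a ≠ 9 → a ≠ 11 → s'.reg a = s.reg a) ∧ s'.reg 11 = i + 1 ∧
      ∃ D', View n off adj s' D' ∧
      Base G (p - 1) p D' ∧ Search G p D' (fun _ => False) ∧ Ext p D D' ∧
      D'.Handled p x (adj i) ∧ (∀ j < D'.tail, D'.gd p (D'.que j) ≤ D'.gd p x + 1) ∧
      (nbrPieces (D.xt p) p).card ≤ (nbrPieces (D'.xt p) p).card ∧
      t ≤ 20 + 40 * (n + 1) * ((nbrPieces (D'.xt p) p).card - (nbrPieces (D.xt p) p).card) := by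
  have h1 := hs.one
  have hgx : 0 < D.gd p x := hx ▸ (hSe.que_lt k hk).2
  have hxn := hSe.gd_lt hgx
  have hxy : NAdj G x (adj i) := (hI.nbr _ _).2 ⟨hxn, i, hi0, hi1, rfl⟩
  have hyn := hxy.2.1
  have hoffw : off (x + 1) ≤ w := by rw [← hV.off]; exact hs.arr_le 0 (x + 1)
  have hnn : n + 1 ≤ (n + 1) * (n + 1) := by nlinarith
  generalize hy : adj i = y at *
  have i1 := index_le hpn hyn.le
  have hg : s.arr 8 (p * (n + 1) + y) = D.gd p y := by
    rw [tab_of_lt (A := s.arr 8) (show y < n + 1 by omega), hV.gd]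
  have hEr : Ext p D D := ⟨le_rfl, fun _ _ => rfl, fun _ _ => rfl, fun _ _ _ h => h⟩
  refine .seqs_cons (.load' y hs (by decide) (by rw [h11, hV.adj, hy]) fun hs' => .seqs_cons
    (.add' (i + 1) hs' (by decide) (by simp [h11, h1]) (by omega) fun hs' => .seqs_cons
    (.add' (p * (n + 1) + y) hs' (by decide) (by simp [h6]) (by omega) fun hs' => .seqs_cons
    (.load' (D.gd p y) hs' (by decide) (by simp [hg]) fun hs' => .seqs_cons (.ite ?_ ?_)))))
  · intro hlt
    simp [h1] at hlt
    refine .seqs_cons (.load' (D.pc y) hs' (by decide) (by simp [hV.pc]) fun hs' =>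
      .seqs_cons (.ite ?_ ?_))
    · intro hlt'
      simp [h1] at hlt'
      have hgk := hSe.gd_que k hk
      rw [hx] at hgk
      have htn := hSe.tail_le
      refine (pushCmd_wp (p := p) (x := x) (y := y) (D := D) (off := off) (adj := adj)
        hs' hw ?_ (by simp [h6])
        (by simp [h10]) (by simp) (by simp) hpn hxn hyn (by omega) htn).mono ?_
      · constructor <;> simp [hV.r0, hV.r4, hV.cnt, hV.tail, hV.off, hV.adj, hV.ord, hV.par,
          hV.ctr, hV.pc, hV.gd, hV.xt, hV.hd, hV.que, hV.bp, hV.lab]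
      · rintro t s' hs' ⟨rfl, hr, hV'⟩
        have hne : ∀ v, D.gd p v ≠ 0 → v ≠ y := fun v hv e => by rw [e] at hv; omega
        have hgd : ∀ v, D.gd p v ≠ 0 → (D.push p x y).gd p v = D.gd p v := by
          intro v hv
          simp only [Data.push, setEntry_row, Function.update_of_ne (hne v hv)]
        refine .seqs_nil hs' (.seqs_nil hs' ⟨fun a ha h8 h9 h11 => ?_, ?_, _, hV', hB.push
          (by have := hSe.p_pos; omega)
          (by omega), hSe.push hk hx hstep hxy hlt hlt', ⟨by simp [Data.push], fun j hj => ?_, hgd,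
          fun v w hv h => h.push hv hlt⟩, .inl ?_, fun j hj => ?_, le_rfl, le_add_right (by norm_num)⟩)
        · rw [hr a (by omega) h8]
          simp [show a ≠ 14 by omega, show a ≠ 15 by omega, show a ≠ 16 by omega, h11,
            show a ≠ 13 by omega]
        · rw [hr 11 (by omega) (by omega)]; simp
        · simp only [Data.push]
          exact Function.update_of_ne hj.ne _ _
        · rw [hgd x hgx.ne']
          simp [Data.push, setEntry_self]
        · rw [hgd x hgx.ne']
          by_cases e : j = D.tail
          · rw [e]
            simp [Data.push, setEntry_self]
          · simp only [Data.push] at hj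
            have hj' : j < D.tail := by omega
            have : (D.push p x y).que j = D.que j := Function.update_of_ne e _ _
            rw [this, hgd _ (hSe.que_lt j hj').2.ne']
            exact hstep j hj'
    · intro hge
      simp [h1] at hge
      have hyp : D.pc y < p := by
        refine lt_of_le_of_ne (hB.pc_le y) fun e => ?_
        have := hSe.row.pc_g y hSe.p_pos e
        omega
      have i2 := index_le hpn (show D.pc y ≤ n by omega)
      have hx9 : s.arr 9 (p * (n + 1) + D.pc y) = D.xt p (D.pc y) := by
        rw [tab_of_lt (A := s.arr 9) (show D.pc y < n + 1 by omega), hV.xt]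
      refine .seqs_cons (.add' (p * (n + 1) + D.pc y) hs' (by decide) (by simp [h6]) (by omega)
        fun hs' => .seqs_cons (.load' (D.xt p (D.pc y)) hs' (by decide) (by simp [hx9])
        fun hs' => .seqs_cons (.ite ?_ ?_)))
      · intro hlt''
        simp [h1] at hlt''
        refine (newPiece_wp (p := p) (x := x) (y := y) (D := D) (off := off) (adj := adj) hs' hw
          ?_ (by simp [h5]) (by simp [h10]) (by simp) (by simp) hpn hB hSe hgx hxy (by omega) hyp
          hlt'').mono ?_
        · constructor <;> simp [hV.r0, hV.r4, hV.cnt, hV.tail, hV.off, hV.adj, hV.ord, hV.par,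
            hV.ctr, hV.pc, hV.gd, hV.xt, hV.hd, hV.que, hV.bp, hV.lab]
        · rintro t s' hs' ⟨ht, hr, D', hV', hB', hS', hE, hgd, htl, hH, hcard⟩
          refine .seqs_nil hs' (.seqs_nil hs' (.seqs_nil hs' ⟨fun a ha h8 h9 h11 => ?_, ?_, D', hV',
            hB', hS', hE, hH, fun j hj => ?_, by omega, ?_⟩))
          · rw [hr a (by omega) h9]
            simp [show a ≠ 14 by omega, show a ≠ 15 by omega, show a ≠ 16 by omega, h11,
              show a ≠ 13 by omega]
          · rw [hr 11 (by omega) (by omega)]; simp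
          · rw [hgd, hE.que j (by omega)]
            exact hstep j (by omega)
          · rw [hcard, Nat.add_sub_cancel_left]
            omega
      · intro hge'
        simp [h1] at hge'
        refine .nop hs' (.seqs_nil hs' (.seqs_nil hs' (.seqs_nil hs' ⟨fun a ha h8 h9 h11 => ?_,
          by simp, D, ?_, hB, hSe, hEr, .inr ⟨hge, hyp, by omega⟩, hstep, le_rfl, by simp⟩)))
        · simp [show a ≠ 14 by omega, show a ≠ 15 by omega, show a ≠ 16 by omega, h11,
              show a ≠ 13 by omega]
        · constructor <;> simp [hV.r0, hV.r4, hV.cnt, hV.tail, hV.off, hV.adj, hV.ord, hV.par,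
            hV.ctr, hV.pc, hV.gd, hV.xt, hV.hd, hV.que, hV.bp, hV.lab]
  · intro hge
    simp [h1] at hge
    refine .nop hs' (.seqs_nil hs' ⟨fun a ha h8 h9 h11 => ?_,
      by simp, D, ?_, hB, hSe, hEr, .inl ⟨hge, ?_⟩, hstep, le_rfl, by simp⟩)
    · simp [show a ≠ 15 by omega, show a ≠ 16 by omega, h11, show a ≠ 13 by omega]
    · constructor <;> simp [hV.r0, hV.r4, hV.cnt, hV.tail, hV.off, hV.adj, hV.ord, hV.par,
        hV.ctr, hV.pc, hV.gd, hV.xt, hV.hd, hV.que, hV.bp, hV.lab]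
    · obtain ⟨j, hj, e⟩ := hSe.que_surj y hge
      rw [← e]
      exact hstep j hj

end

section

variable {r : ℕ → ℕ} {w n p : ℕ} {s : St}
variable {G : SimpleGraph (Fin n)} {off adj : ℕ → ℕ} {D : Data}

theorem Ext.refl (p : ℕ) (D : Data) : Ext p D D :=
  ⟨le_rfl, fun _ _ => rfl, fun _ _ => rfl, fun _ _ _ h => h⟩

theorem Ext.trans {D' D'' : Data} (h : Ext p D D') (h' : Ext p D' D'') : Ext p D D'' where
  tail_le := h.tail_le.trans h'.tail_le
  que j hj := by rw [h'.que j (hj.trans_le h.tail_le), h.que j hj]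
  gd v hv := by rw [h'.gd v (by rwa [h.gd v hv]), h.gd v hv]
  handled v w hv hH := h'.handled v w (by rwa [h.gd v hv]) (h.handled v w hv hH)

theorem card_nbrPieces_le (x : ℕ → ℕ) (p : ℕ) : (nbrPieces x p).card ≤ p := by
  have := Finset.card_filter_le (Finset.range p) (x · ≠ 0)
  simpa [nbrPieces] using this

theorem bfsBody_wp (hI : IsInput G off adj) (hs : Ok w s) (hw : (n + 1) * (n + 1) ≤ w)
    (hV : View n off adj s D) (h5 : s.reg 5 = p) (h6 : s.reg 6 = p * (n + 1)) {h : ℕ}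
    (h7 : s.reg 7 = h) (hpn : p ≤ n) (hB : Base G (p - 1) p D)
    (hSe : Search G p D fun _ => False) (hh : h < D.tail)
    (hstep : ∀ j < D.tail, D.gd p (D.que j) ≤ D.gd p (D.que h) + 1)
    (hdone : ∀ j < h, ∀ w, NAdj G (D.que j) w → D.Handled p (D.que j) w) :
    Wp r w bfsBody s fun t s' =>
      s'.reg 5 = p ∧ s'.reg 6 = p * (n + 1) ∧ s'.reg 7 = h + 1 ∧
      ∃ D', View n off adj s' D' ∧
      Base G (p - 1) p D' ∧ Search G p D' (fun _ => False) ∧ Ext p D D' ∧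
      (∀ j < D'.tail, D'.gd p (D'.que j) ≤ D'.gd p (D'.que h) + 1) ∧
      (∀ j < h + 1, ∀ w, NAdj G (D'.que j) w → D'.Handled p (D'.que j) w) ∧
      (nbrPieces (D.xt p) p).card ≤ (nbrPieces (D'.xt p) p).card ∧
      t ≤ 10 + 21 * (off (D.que h + 1) - off (D.que h)) +
        40 * (n + 1) * ((nbrPieces (D'.xt p) p).card - (nbrPieces (D.xt p) p).card) := by
  have h1 := hs.one
  obtain ⟨hxn, hgx⟩ := hSe.que_lt h hh
  have htn := hSe.tail_le
  have hnn : n + 1 ≤ (n + 1) * (n + 1) := by nlinarith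
  generalize hx : D.que h = x at *
  have hoff := hI.mono x hxn
  refine .seqs_cons (.load' x hs (by decide) (by rw [h7, hV.que, hx]) fun hs' => .seqs_cons
    (.add' (h + 1) hs' (by decide) (by simp [h7, h1]) (by omega) fun hs' => .seqs_cons
    (.load' (off x) hs' (by decide) (by simp [hV.off]) fun hs' => .seqs_cons
    (.add' (x + 1) hs' (by decide) (by simp [h1]) (by omega) fun hs' => .seqs_cons
    (.load' (off (x + 1)) hs' (by decide) (by simp [hV.off]) fun hs' => .seqs_cons ?_)))))
  refine Wp.loop (fun s' => s'.reg 5 = p ∧ s'.reg 6 = p * (n + 1) ∧ s'.reg 7 = h + 1 ∧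
      s'.reg 10 = x ∧ s'.reg 12 = off (x + 1) ∧ off x ≤ s'.reg 11 ∧ s'.reg 11 ≤ off (x + 1) ∧
      ∃ D', View n off adj s' D' ∧ Base G (p - 1) p D' ∧ Search G p D' (fun _ => False) ∧
      Ext p D D' ∧ (∀ i, off x ≤ i → i < s'.reg 11 → D'.Handled p x (adj i)) ∧
      (∀ j < D'.tail, D'.gd p (D'.que j) ≤ D'.gd p x + 1) ∧
      (nbrPieces (D.xt p) p).card ≤ (nbrPieces (D'.xt p) p).card)
    -- The potential depends on the machine state only, so the listed pieces are counted in the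
    -- stored table. Their crude bound `n + 1` cancels at the end.
    (fun s' => 21 * (off (x + 1) - s'.reg 11) +
      40 * (n + 1) * (n + 1 - (nbrPieces (tab (n + 1) (s'.arr 9) p) p).card)) hs' ?_ ?_ ?_
  · refine ⟨by simp [h5], by simp [h6], by simp, by simp, by simp, by simp, by simpa using hoff, D,
      ?_, hB, hSe, .refl p D, fun i h2 h3 => ?_, hstep, le_rfl⟩
    · constructor <;> simp [hV.r0, hV.r4, hV.cnt, hV.tail, hV.off, hV.adj, hV.ord, hV.par,
        hV.ctr, hV.pc, hV.gd, hV.xt, hV.hd, hV.que, hV.bp, hV.lab]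
    · simp at h3; omega
  · rintro s' hs' ⟨e5, e6, e7, e10, e12, hi0, -, D', hV', hB', hS', hE, hpart, hstep', hcard⟩ hlt
    rw [e12] at hlt
    refine (scanBody_wp (k := h) hI hs' hw hV' e5 e6 e10 rfl hi0 hlt hpn hB' hS'
      (hh.trans_le hE.tail_le) (by rw [hE.que h hh, hx]) hstep').mono ?_
    rintro t s2 hs2 ⟨hr, e11, D2, hV2, hB2, hS2, hE2, hH, hstep2, hcard2, ht⟩
    refine ⟨⟨?_, ?_, ?_, ?_, ?_, by omega, by omega, D2, hV2, hB2, hS2, hE.trans hE2,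
      fun i h2 h3 => ?_, hstep2, hcard.trans hcard2⟩, ?_⟩
    · rw [hr 5 (by omega) (by omega) (by omega) (by omega), e5]
    · rw [hr 6 (by omega) (by omega) (by omega) (by omega), e6]
    · rw [hr 7 (by omega) (by omega) (by omega) (by omega), e7]
    · rw [hr 10 (by omega) (by omega) (by omega) (by omega), e10]
    · rw [hr 12 (by omega) (by omega) (by omega) (by omega), e12]
    · rcases (show i < s'.reg 11 ∨ i = s'.reg 11 by omega) with h4 | rfl
      · exact hE2.handled _ _ (by rw [hE.gd x hgx.ne']; omega) (hpart i h2 h4)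
      · exact hH
    · rw [hV2.xt, hV'.xt, e11]
      have c1 := card_nbrPieces_le (D2.xt p) p
      obtain ⟨d, hd⟩ := Nat.exists_eq_add_of_le hcard2
      obtain ⟨f, hf⟩ := Nat.exists_eq_add_of_le (show (nbrPieces (D2.xt p) p).card ≤ n + 1 by omega)
      rw [hd, Nat.add_sub_cancel_left] at ht
      rw [show n + 1 - (nbrPieces (D2.xt p) p).card = f by omega,
        show n + 1 - (nbrPieces (D'.xt p) p).card = d + f by omega, mul_add (40 * (n + 1)) d f]
      omega
  · rintro t s' hs' ⟨e5, e6, e7, e10, e12, hi0, hi1, D', hV', hB', hS', hE, hpart, hstep', hcard⟩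
      hge hφ
    refine .seqs_nil hs' ⟨e5, e6, e7, D', hV', hB', hS', hE, by rwa [hE.que h hh, hx],
      fun j hj v hv => ?_, hcard, ?_⟩
    · rcases Nat.lt_succ_iff_lt_or_eq.1 hj with hj | rfl
      · rw [hE.que j (by omega)] at hv ⊢
        exact hE.handled _ _ (hSe.que_lt j (by omega)).2.ne' (hdone j hj v hv)
      · rw [hE.que _ hh, hx] at hv ⊢
        obtain ⟨-, i, h2, h3, rfl⟩ := (hI.nbr x v).1 hv
        exact hpart i h2 (by omega)
    · rw [hV'.xt] at hφ
      simp only [St.setReg_reg, St.setReg_arr, hV.xt, Nat.reduceEqDiff, if_true, if_false] at hφ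
      have c1 := card_nbrPieces_le (D'.xt p) p
      obtain ⟨d, hd⟩ := Nat.exists_eq_add_of_le hcard
      obtain ⟨f, hf⟩ := Nat.exists_eq_add_of_le (show (nbrPieces (D'.xt p) p).card ≤ n + 1 by omega)
      rw [show n + 1 - (nbrPieces (D'.xt p) p).card = f by omega,
        show n + 1 - (nbrPieces (D.xt p) p).card = d + f by omega, mul_add (40 * (n + 1)) d f] at hφ
      rw [hd, Nat.add_sub_cancel_left]
      omega

/-- The length of all adjacency lists. -/
def totalDeg (n : ℕ) (off : ℕ → ℕ) : ℕ := ∑ v ∈ Finset.range n, (off (v + 1) - off v)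

theorem sum_prefix_le {que : ℕ → ℕ} {h : ℕ} (hlt : ∀ j < h, que j < n)
    (hinj : ∀ i j, i < h → j < h → que i = que j → i = j) :
    ∑ j ∈ Finset.range h, (off (que j + 1) - off (que j)) ≤ totalDeg n off := by
  rw [← Finset.sum_image (f := fun v => off (v + 1) - off v) (g := que)]
  · refine Finset.sum_le_sum_of_subset fun v hv => ?_
    obtain ⟨j, hj, rfl⟩ := Finset.mem_image.1 hv
    simpa using hlt j (by simpa using hj)
  · intro i hi j hj
    exact hinj i j (by simpa using hi) (by simpa using hj)

theorem searchCmd_wp (hI : IsInput G off adj) (hs : Ok w s) (hw : (n + 1) * (n + 1) ≤ w)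
    (hV : View n off adj s D) (h5 : s.reg 5 = p) (h15 : s.reg 15 = p - 1) (hp : 0 < p)
    (hpn : p ≤ n) (hB : Base G (p - 1) (p - 1) D) (hpc : D.pc (p - 1) = 0) :
    Wp r w searchCmd s fun t s' => s'.reg 5 = p ∧ ∃ D', View n off adj s' D' ∧
      Base G p p D' ∧ D'.pc (p - 1) = p ∧
      t ≤ 31 * n + 31 * totalDeg n off + 40 * (n + 1) * (nbrPieces (D'.xt p) p).card + 20 := by
  have h1 := hs.one
  have h2 := hs.zero
  have hnn : n + 1 ≤ (n + 1) * (n + 1) := by nlinarith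
  have i1 := index_le hpn (show p - 1 ≤ n by omega)
  have i2 := index_le hpn hpn
  have hB1 := hB.start hp hpn hpc
  have hS1 := Search.start hB hp hpn
  have hcnt := hB.cnt_le
  refine .seqs_cons (.mul' (p * (n + 1)) hs (by decide) (by rw [h5, hV.r4]) (by omega) fun hs' =>
    .seqs_cons (.store' (p - 1) p hs' (by simp [h15]) (by simp [h5]) fun hs' =>
    .seqs_cons (.store' D.cnt (p - 1) hs' (by simp [hV.cnt]) (by simp [h15]) fun hs' =>
    .seqs_cons (.add' (D.cnt + 1) hs' (by decide) (by simp [hV.cnt, h1]) (by omega) fun hs' =>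
    .seqs_cons (.add' (p * (n + 1) + (p - 1)) hs' (by decide) (by simp [h15]) (by omega) fun hs' =>
    .seqs_cons (.store' (p * (n + 1) + (p - 1)) 1 hs' (by simp) (by simp [h1]) fun hs' =>
    .seqs_cons (.add' (p * (n + 1) + p) hs' (by decide) (by simp [h5]) (by omega) fun hs' =>
    .seqs_cons (.store' (p * (n + 1) + p) (n + 1) hs' (by simp) (by simp [hV.r4]) fun hs' =>
    .seqs_cons (.store' 0 (p - 1) hs' (by simp [h2]) (by simp [h15]) fun hs' =>
    .seqs_cons (.add' 0 hs' (by decide) (by simp [h2]) (by omega) fun hs' =>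
    .seqs_cons (.add' 1 hs' (by decide) (by simp [h1, h2]) (by omega) fun hs' =>
    .seqs_cons ?_)))))))))))
  refine Wp.loop (fun s' => s'.reg 5 = p ∧ s'.reg 6 = p * (n + 1) ∧
      ∃ D', View n off adj s' D' ∧ Base G (p - 1) p D' ∧ Search G p D' (fun _ => False) ∧
      s'.reg 7 ≤ D'.tail ∧ (s'.reg 7 < D'.tail →
        ∀ j < D'.tail, D'.gd p (D'.que j) ≤ D'.gd p (D'.que (s'.reg 7)) + 1) ∧
      ∀ j < s'.reg 7, ∀ w, NAdj G (D'.que j) w → D'.Handled p (D'.que j) w)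
    -- Vertices, list entries and adjacent pieces still to come. By `sum_prefix_le` the subtraction
    -- does not truncate, as no vertex is queued twice.
    (fun s' => 31 * (n - s'.reg 7) + 31 * (totalDeg n off - ∑ j ∈ Finset.range (s'.reg 7),
        (off (s'.arr 11 j + 1) - off (s'.arr 11 j))) +
      40 * (n + 1) * (n + 1 - (nbrPieces (tab (n + 1) (s'.arr 9) p) p).card)) hs' ?_ ?_ ?_
  · refine ⟨by simp [h5], by simp, D.start n p, ?_, hB1, hS1, by simp, fun _ j hj => ?_, ?_⟩
    · constructor <;> simp [hV.r0, hV.r4, hV.off, hV.adj, hV.ord, hV.par,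
        hV.ctr, hV.pc, hV.gd, hV.xt, hV.hd, hV.que, hV.bp, hV.lab, Data.start,
        tab_update (show p - 1 < n + 1 by omega), tab_update (show p < n + 1 by omega)]
    · obtain rfl : j = 0 := by simp [Data.start] at hj; exact hj
      simp
    · simp
  · rintro s' hs' ⟨e5, e6, D', hV', hB', hS', -, hstep, hdone⟩ hlt
    rw [hV'.tail] at hlt
    refine (bfsBody_wp hI hs' hw hV' e5 e6 rfl hpn hB' hS' hlt (hstep hlt) hdone).mono ?_
    rintro t s2 hs2 ⟨e5, e6, e7, D2, hV2, hB2, hS2, hE, hstep2, hdone2, hcard, ht⟩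
    have htl := hE.tail_le
    refine ⟨⟨e5, e6, D2, hV2, hB2, hS2, by omega, fun h3 j hj => ?_, by rwa [e7]⟩, ?_⟩
    · rw [e7] at h3 ⊢
      -- The bound relative to the old head passes to the next one because the queue is sorted by
      -- level.
      exact (hstep2 j hj).trans (Nat.add_le_add_right (hS2.que_mono _ _ (Nat.le_succ _) h3) 1)
    · rw [hV2.xt, hV'.xt, hV2.que, hV'.que, e7]
      have c1 := card_nbrPieces_le (D2.xt p) p
      have htn := hS'.tail_le
      obtain ⟨d, hd⟩ := Nat.exists_eq_add_of_le hcard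
      obtain ⟨f, hf⟩ := Nat.exists_eq_add_of_le (show (nbrPieces (D2.xt p) p).card ≤ n + 1 by omega)
      have hsum1 : ∑ j ∈ Finset.range (s'.reg 7 + 1), (off (D2.que j + 1) - off (D2.que j)) =
          ∑ j ∈ Finset.range (s'.reg 7), (off (D'.que j + 1) - off (D'.que j)) +
          (off (D'.que (s'.reg 7) + 1) - off (D'.que (s'.reg 7))) := by
        rw [← Finset.sum_range_succ (fun j => off (D'.que j + 1) - off (D'.que j))]
        refine Finset.sum_congr rfl fun j hj => ?_
        rw [hE.que j (by simp at hj; omega)]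
      have hsum2 := sum_prefix_le (n := n) (off := off) (que := D2.que) (h := s'.reg 7 + 1)
        (fun j hj => (hS2.que_lt j (by omega)).1)
        (fun i j hi hj => hS2.que_inj i j (by omega) (by omega))
      rw [hd, Nat.add_sub_cancel_left] at ht
      rw [show n + 1 - (nbrPieces (D2.xt p) p).card = f by omega,
        show n + 1 - (nbrPieces (D'.xt p) p).card = d + f by omega, mul_add (40 * (n + 1)) d f]
      omega
  · rintro t s' hs' ⟨e5, e6, D', hV', hB', hS', hle, hstep, hdone⟩ hge hφ
    rw [hV'.tail] at hge
    have hc0 : (nbrPieces (D.xt p) p).card = 0 := by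
      rw [Finset.card_eq_zero, nbrPieces, Finset.filter_eq_empty_iff]
      intro a _ h3
      exact h3 (hB.xt_zero p a (by omega))
    refine .seqs_nil hs' ⟨e5, D', hV', hS'.base hB' fun j hj => hdone j (by omega), hS'.root, ?_⟩
    rw [hV'.xt] at hφ
    simp only [St.setReg_reg, St.setReg_arr, St.setArr_arr, hV.xt, Nat.reduceEqDiff, if_true,
      if_false, hc0, Finset.range_zero, Finset.sum_empty] at hφ
    have c1 := card_nbrPieces_le (D'.xt p) p
    obtain ⟨f, hf⟩ := Nat.exists_eq_add_of_le (show (nbrPieces (D'.xt p) p).card ≤ n + 1 by omega)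
    simp only [Nat.sub_zero] at hφ
    rw [show n + 1 - (nbrPieces (D'.xt p) p).card = f by omega] at hφ
    have : 40 * (n + 1) * (n + 1) = 40 * (n + 1) * (nbrPieces (D'.xt p) p).card +
        40 * (n + 1) * f := by rw [← mul_add, ← hf]
    omega

theorem buildCmd_wp {k : ℕ} (hG : ¬ IsMinor (⊤ : SimpleGraph (Fin k)) G)
    (hI : IsInput G off adj) (hs : Ok w s) (hw : (n + 1) * (n + 1) ≤ w) (hr0 : s.reg 0 = n)
    (hr8 : s.reg 8 = 0) (hr9 : s.reg 9 = 0) (h0 : s.arr 0 = off) (h1 : s.arr 1 = adj)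
    (ha : ∀ a, 2 ≤ a → s.arr a = fun _ => 0) :
    Wp r w buildCmd s fun t s' => ∃ D, View n off adj s' D ∧ Base G n n D ∧
      t ≤ (31 * n + 31 * totalDeg n off + 40 * (n + 1) * k + 30) * n + 4 := by
  have o1 := hs.one
  have z1 := hs.zero
  have hnn : n + 1 ≤ (n + 1) * (n + 1) := by nlinarith
  set K := 31 * n + 31 * totalDeg n off + 40 * (n + 1) * k + 30 with hK
  refine .seqs_cons (.add' (n + 1) hs (by decide) (by rw [hr0, o1]) (by omega) fun hs' =>
    .seqs_cons (.add' 1 hs' (by decide) (by simp [o1, z1]) (by omega) fun hs' => .seqs_cons ?_))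
  refine Wp.loop (fun s' => 0 < s'.reg 5 ∧ s'.reg 5 ≤ n + 1 ∧ ∃ D, View n off adj s' D ∧
      Base G (s'.reg 5 - 1) (s'.reg 5 - 1) D)
    (fun s' => K * (n + 1 - s'.reg 5)) hs' ?_ ?_ ?_
  · refine ⟨by simp, by simp, ⟨fun _ => 0, fun _ => 0, fun _ => 0, fun _ => 0, fun _ => 0,
      fun _ => 0, fun _ _ => 0, fun _ _ => 0, fun _ _ => 0, 0, 0⟩, ?_, ?_⟩
    · have ht : tab (n + 1) (fun _ => 0) = fun _ _ => 0 := by funext u v; simp [tab]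
      constructor <;> simp [hr0, hr8, hr9, h0, h1, ha, ht]
    · simp only [St.setReg_reg, if_true]
      refine ⟨⟨fun u hu => ?_, fun u hu => ?_⟩, ?_, ?_, ?_, ?_, ?_, ?_, ?_, ?_, ?_, ?_, ?_, ?_, ?_⟩
      · constructor <;> intros <;> simp_all
      · intro v w _ hv
        simp at hv
      · constructor <;> intros <;> simp_all
      all_goals simp
  · rintro s' hs' ⟨hp0, -, D, hV, hB⟩ hlt
    have o1 := hs'.one
    rw [hV.r4] at hlt
    generalize hp : s'.reg 5 = p at *
    refine .seqs_cons (.sub' (p - 1) hs' (by decide) (by rw [hp, o1]) fun hs' => .seqs_cons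
      (.load' (D.pc (p - 1)) hs' (by decide) (by simp [hV.pc]) fun hs' => .seqs_cons (.ite ?_ ?_)))
    · intro hlt'
      simp [o1] at hlt'
      refine (searchCmd_wp (n := n) (off := off) (adj := adj) (D := D) (p := p) hI hs' hw ?_
        (by simp [hp]) (by simp) hp0 (by omega) hB hlt').mono ?_
      · constructor <;> simp [hV.r0, hV.r4, hV.cnt, hV.tail, hV.off, hV.adj, hV.ord, hV.par,
          hV.ctr, hV.pc, hV.gd, hV.xt, hV.hd, hV.que, hV.bp, hV.lab]
      · rintro t s2 hs2 ⟨e5, D', hV', hB', hpc', ht⟩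
        have o2 := hs2.one
        -- The excluded minor enters the running time: a search pays for fewer than `k` new pieces.
        have hcard := hB'.rows.card_nbrPieces_lt hG le_rfl (by omega) hp0 hpc'
        refine .seqs_cons (.add' (p + 1) hs2 (by decide) (by rw [e5, o2]) (by omega) fun hs' =>
          .seqs_nil hs' ⟨⟨by simp, by simp; omega, D', ?_, by simpa using hB'⟩, ?_⟩)
        · constructor <;> simp [hV'.r0, hV'.r4, hV'.cnt, hV'.tail, hV'.off, hV'.adj, hV'.ord,
            hV'.par, hV'.ctr, hV'.pc, hV'.gd, hV'.xt, hV'.hd, hV'.que, hV'.bp, hV'.lab]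
        · simp only [St.setReg_reg, if_true]
          have hle : 40 * (n + 1) * (nbrPieces (D'.xt p) p).card ≤ 40 * (n + 1) * k :=
            Nat.mul_le_mul_left _ (by omega)
          rw [show n + 1 - p = (n + 1 - (p + 1)) + 1 by omega, mul_add]
          omega
    · intro hge
      simp [o1] at hge
      refine .nop hs' (.seqs_cons (.add' (p + 1) hs' (by decide) (by simp [hp, o1]) (by omega)
        fun hs' => .seqs_nil hs' ⟨⟨by simp, by simp; omega, D, ?_,
          by simpa using hB.skip hp0 hge⟩, ?_⟩))
      · constructor <;> simp [hV.r0, hV.r4, hV.cnt, hV.tail, hV.off, hV.adj, hV.ord, hV.par,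
          hV.ctr, hV.pc, hV.gd, hV.xt, hV.hd, hV.que, hV.bp, hV.lab]
      · simp only [St.setReg_reg, if_true]
        rw [show n + 1 - p = (n + 1 - (p + 1)) + 1 by omega, mul_add]
        omega
  · rintro t s' hs' ⟨hp0, hp1, D, hV, hB⟩ hge hφ
    rw [hV.r4] at hge
    have e : s'.reg 5 - 1 = n := by omega
    rw [e] at hB
    refine .seqs_nil hs' ⟨D, hV, hB, ?_⟩
    simp at hφ
    omega

end

/-! ### Reading the adjacency lists -/

section input

variable {n : ℕ} {G : SimpleGraph (Fin n)} (L : AdjLists G)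

theorem AdjLists.memory_zero {i : ℕ} (hi : i ≤ n) :
    L.memory 0 i = ((List.ofFn L.nbrs).take i).flatten.length := by
  simp [memory, hi]

theorem AdjLists.take_succ (v : Fin n) :
    (List.ofFn L.nbrs).take (v + 1) = (List.ofFn L.nbrs).take v ++ [L.nbrs v] := by
  rw [List.take_add_one]
  simp

theorem AdjLists.memory_zero_succ (v : Fin n) :
    L.memory 0 (v + 1) = L.memory 0 v + (L.nbrs v).length := by
  rw [L.memory_zero v.2, L.memory_zero v.2.le, L.take_succ]
  simp

theorem AdjLists.memory_one (v : Fin n) {j : ℕ} (hj : j < (L.nbrs v).length) :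
    L.memory 1 (L.memory 0 v + j) = ((L.nbrs v)[j] : ℕ) := by
  have h : (List.ofFn L.nbrs).flatten = ((List.ofFn L.nbrs).take v).flatten ++
      (L.nbrs v ++ ((List.ofFn L.nbrs).drop (v + 1)).flatten) := by
    conv_lhs => rw [← List.take_append_drop (v + 1) (List.ofFn L.nbrs), L.take_succ]
    simp
  rw [L.memory_zero v.2.le]
  simp only [memory, one_ne_zero, if_true, if_false, h, List.map_append]
  rw [List.getD_append_right _ _ _ _ (by rw [List.length_map]; exact Nat.le_add_right _ _),
    List.length_map, Nat.add_sub_cancel_left,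
    List.getD_append _ _ _ _ (by simpa using hj)]
  simp [hj]

theorem AdjLists.isInput : IsInput G (L.memory 0) (L.memory 1) where
  mono v hv := by
    rw [L.memory_zero_succ ⟨v, hv⟩]
    exact Nat.le_add_right _ _
  nbr v w := by
    constructor
    · rintro ⟨hv, hw, h⟩
      obtain ⟨j, hj, e⟩ := List.getElem_of_mem ((L.mem_iff _ _).2 h)
      refine ⟨hv, L.memory 0 v + j, Nat.le_add_right _ _, ?_, ?_⟩
      · rw [L.memory_zero_succ ⟨v, hv⟩]
        exact Nat.add_lt_add_left hj _
      · rw [L.memory_one ⟨v, hv⟩ hj, e]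
    · rintro ⟨hv, i, h1, h2, rfl⟩
      obtain ⟨j, rfl⟩ := Nat.exists_eq_add_of_le h1
      rw [L.memory_zero_succ ⟨v, hv⟩] at h2
      have hj : j < (L.nbrs ⟨v, hv⟩).length := Nat.lt_of_add_lt_add_left h2
      have e := L.memory_one ⟨v, hv⟩ hj
      rw [show L.memory 1 (L.memory 0 v + j) = _ from e]
      exact ⟨hv, Fin.is_lt _, (L.mem_iff _ _).1 (List.getElem_mem hj)⟩

theorem AdjLists.length_nbrs_le (v : Fin n) : (L.nbrs v).length ≤ n := by
  simpa using (L.nodup v).length_le_card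

theorem AdjLists.memory_le (a i : ℕ) : L.memory a i ≤ n * n + n := by
  have h0 : ∀ i ≤ n, L.memory 0 i ≤ i * n := by
    intro i
    induction i with
    | zero => intro hi; simp [L.memory_zero]
    | succ i ih =>
      intro hi
      rw [L.memory_zero_succ ⟨i, hi⟩, Nat.succ_mul]
      exact Nat.add_le_add (ih (Nat.le_of_succ_le hi)) (L.length_nbrs_le _)
  by_cases ha : a = 0
  · subst ha
    by_cases hi : i ≤ n
    · exact ((h0 i hi).trans (Nat.mul_le_mul_right n hi)).trans (Nat.le_add_right _ _)
    · simp [memory, hi]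
  · simp only [memory, ha, if_false]
    split_ifs
    · rw [List.getD_eq_getElem?_getD, List.getElem?_map]
      rcases (List.ofFn L.nbrs).flatten[i]? with _ | v
      · simp
      · simp only [Option.map_some, Option.getD_some]
        omega
    · omega

open Classical in
theorem AdjLists.totalDeg_eq : totalDeg n (L.memory 0) =
    ((Finset.univ : Finset (Fin n × Fin n)).filter fun e : Fin n × Fin n => G.Adj e.1 e.2).card := by
  rw [totalDeg, Finset.sum_range, Finset.card_filter, Fintype.sum_prod_type]
  refine Finset.sum_congr rfl fun v _ => ?_
  rw [L.memory_zero_succ, Nat.add_sub_cancel_left, ← Finset.card_filter,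
    ← List.toFinset_card_of_nodup (L.nodup v)]
  congr 1
  ext u
  simp [L.mem_iff]

end input

/-! ### The result of the first algorithm -/

section result

variable {n k m : ℕ} {G : SimpleGraph (Fin n)} {D : Data}

/-- Extends the bound to numbers `p` without a piece, which list nothing. -/
theorem Base.card_nbrPieces_lt (h : Base G n n D) (hk : 1 ≤ k)
    (hG : ¬ IsMinor (⊤ : SimpleGraph (Fin k)) G) (p : ℕ) : (nbrPieces (D.xt p) p).card < k := by
  rcases Finset.eq_empty_or_nonempty (nbrPieces (D.xt p) p) with h0 | ⟨q, hq⟩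
  · rw [h0, Finset.card_empty]; exact hk
  · have hx : D.xt p q ≠ 0 := (Finset.mem_filter.1 hq).2
    have hp : p ≤ n := by
      by_contra hp
      exact hx (h.xt_zero p q (by omega))
    have R := h.rows.row p hp
    obtain ⟨h1, h2⟩ := R.x_lt q hx
    obtain ⟨a, -, -, ha, -⟩ := R.x_adj q hx
    have hroot := R.root a (R.pc_g a (by omega) (by simpa using ha))
    have := h.rows.card_nbrPieces_lt hG hp hp hroot.1 hroot.2.1
    omega

theorem Base.dec (h : Base G n n D) (hk : 1 ≤ k) (hG : ¬ IsMinor (⊤ : SimpleGraph (Fin k)) G) :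
    Dec G k D.pc D.par D.gd D.xt D.hd where
  toTree := h.tree
  pc_pos v hv := ⟨h.pc_pos v hv, h.pc_le v⟩
  xt_le p q hpq := by
    by_contra hp
    exact hpq (h.xt_zero p q (by omega))
  chord p q q' hq hq' hlt := by
    refine h.rows.chord (fun _ _ => NAdj.symm) ?_ hq hq' hlt
    by_contra hp
    exact hq (h.xt_zero p q (by omega))
  edge v w hvw hlt := h.rows.edge (h.pc_le v) (h.pc_pos w hvw.2.1) hvw hlt
  card_lt := h.card_nbrPieces_lt hk hG
  gd_lip u v w hvw hv hw := by
    have hu : u ≤ n := by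
      by_contra hu
      rw [h.gd_zero u v (by omega)] at hv
      omega
    rcases h.rows.closed u hu v w trivial hv hvw with h1 | h1
    · exact h1.2
    · rcases (h.rows.row u hu).g_pc w hw with h2 | h2 <;> omega
  gd_mono p q v hpq hv := by
    refine h.rows.sub (fun _ _ => NAdj.symm) ?_ hpq hv
    by_contra hp
    exact hpq (h.xt_zero p q (by omega))
  gd_self v hv := (h.rows.row _ (h.pc_le v)).pc_g v (h.pc_pos v hv) rfl
  levels u J hu := by
    rcases Finset.eq_empty_or_nonempty
      ((Finset.range n).filter fun v => D.pc v = u ∧ D.gd u v ∈ J) with h0 | ⟨v, hv⟩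
    · rw [h0, Finset.card_empty]; exact Nat.zero_le _
    · obtain ⟨-, rfl, -⟩ := Finset.mem_filter.1 hv
      exact ((h.rows.row _ (h.pc_le v)).card_levels hu n J).trans
        (Nat.mul_le_mul_right _ (h.card_nbrPieces_lt hk hG _))
  hd_self v hv := h.hd_self v (h.pc_pos v hv)
  gd_le := h.gd_le
  hd_le := h.hd_le

/-- `ord` lists each vertex once, in order of entry, and the pieces are filled one after another. -/
theorem Base.exists_order (h : Base G n n D) : ∃ σ : Equiv.Perm (Fin n),
    (∀ i : Fin n, D.ord i = (σ i : ℕ)) ∧ ∀ u v : Fin n, σ.symm u ≤ σ.symm v → D.pc u ≤ D.pc v := by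
  have hcnt : D.cnt = n := by
    refine h.cnt_le.antisymm ?_
    choose f hf using fun v : Fin n => h.ord_surj v (h.pc_pos v v.2)
    have := Fintype.card_le_of_injective (fun v : Fin n => (⟨f v, (hf v).1⟩ : Fin D.cnt))
      fun u v huv => Fin.ext (by rw [← (hf u).2, ← (hf v).2, Fin.mk.inj huv])
    simpa using this
  let g : Fin n → Fin n := fun i => ⟨D.ord i, (h.ord_lt i (by omega)).1⟩
  have hg : Function.Injective g := fun i j hij =>
    Fin.ext (h.ord_inj i j (by omega) (by omega) (congrArg Fin.val hij))
  have hb : Function.Bijective g := Finite.injective_iff_bijective.1 hg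
  refine ⟨Equiv.ofBijective g hb, fun i => rfl, fun u v huv => ?_⟩
  have hval : ∀ w : Fin n, D.ord ((Equiv.ofBijective g hb).symm w) = w := fun w =>
    congrArg Fin.val ((Equiv.ofBijective g hb).apply_symm_apply w)
  have := h.ord_mono _ _ (Fin.le_def.1 huv) (by omega)
  rwa [hval, hval] at this

end result

/-! ### Time and number sizes of the two programs. -/

theorem build_runsTo {k n : ℕ} {G : SimpleGraph (Fin n)} (hk : 1 ≤ k)
    (hG : ¬ IsMinor (⊤ : SimpleGraph (Fin k)) G) (L : AdjLists G) (r : ℕ → ℕ) :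
    ∃ (s : St) (pc : ℕ) (D : Data), buildCmd.program.RunsTo r
      ((31 * n + 31 * (6 * (k * k) * n) + 40 * (n + 1) * k + 30) * n + 5) ((n + 1) ^ 2)
      (startConfig n L.memory) (s.at pc) ∧ Ok ((n + 1) ^ 2) s ∧
      View n (L.memory 0) (L.memory 1) s D ∧ Base G n n D := by
  have hw : (n + 1) ^ 2 = n * n + n + (n + 1) := by ring
  obtain ⟨s, t, pc, hs, ⟨D, hV, hB, -⟩, hrun⟩ := Cmd.program_runsTo (r := r) (w := (n + 1) ^ 2)
    (n := n) (m := L.memory) (c := buildCmd)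
    (Q := fun t s' => ∃ D, View n (L.memory 0) (L.memory 1) s' D ∧ Base G n n D ∧
      t ≤ (31 * n + 31 * totalDeg n (L.memory 0) + 40 * (n + 1) * k + 30) * n + 4)
    (T := (31 * n + 31 * (6 * (k * k) * n) + 40 * (n + 1) * k + 30) * n + 5)
    (by omega) (by omega) (fun a i => (L.memory_le a i).trans (by omega))
    (fun hs => buildCmd_wp hG L.isInput hs (by rw [sq]) (by simp) (by simp) (by simp) rfl rfl
      fun a ha => by
        funext i
        simp [AdjLists.memory, show a ≠ 0 by omega, show a ≠ 1 by omega])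
    (by
      rintro t s' ⟨D, -, hB, ht⟩
      -- The length of the input is bounded through the decomposition that the run has produced.
      have := (hB.dec hk hG).card_adj_le
      rw [← L.totalDeg_eq] at this
      have h2 := Nat.mul_le_mul_right n (show 31 * n + 31 * totalDeg n (L.memory 0) +
        40 * (n + 1) * k + 30 ≤ 31 * n + 31 * (6 * (k * k) * n) + 40 * (n + 1) * k + 30 by omega)
      omega)
  exact ⟨s, pc, D, hrun, hs, hV, hB⟩

theorem efficientlyBaker_completeMinorFree (k : ℕ) (hk : 1 ≤ k) : EfficientlyBaker
    (fun n => (31 * n + 31 * (6 * (k * k) * n) + 40 * (n + 1) * k + 30) * n + 5)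
    (fun n => 100 * (n + 1) + 1) (completeMinorFree k) := by
  refine ⟨buildCmd.program, (moveCmd k).program, 2, 1, fun r => ?_⟩
  obtain ⟨t, ht⟩ := exists_wins k r
  -- Only the first `t` terms of the sequence are ever asked for, and each is at most their sum. Of
  -- the factor of `(n + 1) ^ 2`, the `2` covers two squares, and the rest covers `(n + 1) * r i`,
  -- `k * r i` and `k`.
  refine ⟨t, 2 + k + (k + 1) * ∑ i ∈ Finset.range t, r i, fun n G hG L => ?_⟩
  obtain ⟨s, pc, D, hrun, hs, hV, hB⟩ := build_runsTo hk hG L fun _ => 0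
  obtain ⟨σ, hσ, hmono⟩ := hB.exists_order
  refine ⟨s.at pc, σ, by rwa [one_mul], fun i => ?_, ?_⟩
  · rw [← hσ i, ← hV.ord]; rfl
  have h1 : n + 1 ≤ (n + 1) ^ 2 := Nat.le_self_pow two_ne_zero _
  have hle : (n + 1) ^ 2 ≤ (2 + k + (k + 1) * ∑ i ∈ Finset.range t, r i) * (n + 1) ^ 2 :=
    Nat.le_mul_of_pos_left _ (by omega)
  refine ht (hB.dec hk hG) hmono (by omega) (by omega) (fun i hi => ?_)
    ⟨⟨hV.par, hV.pc, hV.gd, hV.hd⟩, ?_, ?_, fun a i => (hs.arr_le a i).trans hle⟩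
  · have hr : r i ≤ ∑ i ∈ Finset.range t, r i :=
      Finset.single_le_sum (f := r) (fun _ _ => Nat.zero_le _) (Finset.mem_range.2 hi)
    generalize ∑ i ∈ Finset.range t, r i = R at *
    calc (n + 1) * (n + 1 + r i) + (n + 1) * (n + 1) + k * r i + k
        = 2 * (n + 1) ^ 2 + (n + 1) * r i + (k * r i + k) * 1 := by ring
      _ ≤ 2 * (n + 1) ^ 2 + (n + 1) ^ 2 * R + (k * R + k) * (n + 1) ^ 2 := by
          gcongr
          omega
      _ = _ := by ring
  · show s.arr 6 0 = 0
    rw [hV.ctr]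
  · show s.arr 6 1 = 0
    rw [hV.ctr]

end BakerGame

theorem mainTheorem4 (k : ℕ) (hk : 1 ≤ k) :
    ∃ f s : ℕ → ℕ,
      ((fun n : ℕ => (f n : ℝ)) =O[atTop] fun n : ℕ => (n : ℝ) ^ 2) ∧
      ((fun n : ℕ => (s n : ℝ)) =O[atTop] fun n : ℕ => (n : ℝ)) ∧
      BakerGame.EfficientlyBaker f s (BakerGame.completeMinorFree k) := by
  refine ⟨_, _, ?_, ?_, BakerGame.efficientlyBaker_completeMinorFree k hk⟩
  -- Here `66 = 31 + 30 + 5`, `186 = 31 * 6` and `80 = 2 * 40`, lower powers of `n` being raised to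
  -- `n ^ 2`.
  · refine IsBigO.of_bound (66 + 186 * (k * k) + 80 * k : ℕ) ?_
    filter_upwards [eventually_ge_atTop 1] with n hn
    rw [Real.norm_natCast, norm_pow, Real.norm_natCast]
    norm_cast
    have h1 : n ≤ n ^ 2 := Nat.le_self_pow two_ne_zero n
    have h2 : k * n ≤ k * n ^ 2 := Nat.mul_le_mul_left _ h1
    calc _ = 31 * n ^ 2 + 186 * (k * k) * n ^ 2 + 40 * (k * n ^ 2) + 40 * (k * n) + 30 * n + 5 := by
          ring
      _ ≤ 31 * n ^ 2 + 186 * (k * k) * n ^ 2 + 40 * (k * n ^ 2) + 40 * (k * n ^ 2) + 30 * n ^ 2 +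
          5 * n ^ 2 := by omega
      _ = _ := by ring
  · refine IsBigO.of_bound (201 : ℕ) ?_
    filter_upwards [eventually_ge_atTop 1] with n hn
    rw [Real.norm_natCast, Real.norm_natCast]
    norm_cast
    omega
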